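/- Let $G=(V,E)$ be a finite simple undirected graph and let $S\subseteq V\times V$ be a set of terminal pairs. A Steiner forest of $(G,S)$ is a subgraph $F$ of $G$ such that, for every $(s,t)\in S$, the vertices $s$ and $t$ belong to the same connected component of $F$. The problem Steiner Forest asks, given $G$, $S$ and an integer $k$, whether $(G,S)$ has a Steiner forest $F$ with $|E(F)|\le k$. A $2$-deletion set of $G$ is a set $T\subseteq V$ such that every connected component of $G-T$ has at most two vertices. Steiner Forest is polynomial-time solvable for graphs with a $2$-deletion set of size at most $2$. That is, there is a deterministic algorithm (a program of a random access machine with addition and subtraction at unit cost) and a polynomial $p$ such that, for every instance $(G,S,k)$ for which $G$ has a $2$-deletion set of size at most $2$, the algorithm, given only a binary encoding of $(G,S,k)$ of length $\ell$ (the adjacency matrix of $G$, the matrix of $S$, and $k$ in binary), halts after at most $p(\ell)$ steps and correctly decides whether $(G,S)$ has a Steiner forest with at most $k$ edges. -/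

import Mathlib

namespace SteinerForest

/-! ### Random access machines with a step count -/

/-- Programs of a random access machine in structured form.  The machine has registers
`R[0], R[1], …` (of which a program mentions only finitely many, by fixed index) and a memory
`M[0], M[1], …` that is addressed indirectly.  All cells hold natural numbers.  The arithmetic
consists of addition and truncated subtraction only (no multiplication), so that with unit cost per
instruction the machine is polynomially equivalent to a Turing machine. -/
inductive Prog : Type
  /-- do nothing -/
  | skip : Prog
  /-- `R[d] := c` -/
  | const (d c : ℕ) : Prog
  /-- `R[d] := R[a]` -/
  | copy (d a : ℕ) : Prog
  /-- `R[d] := R[a] + R[b]` -/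
  | plus (d a b : ℕ) : Prog
  /-- `R[d] := R[a] - R[b]`, truncated at `0` -/
  | minus (d a b : ℕ) : Prog
  /-- `R[d] := M[R[a]]` -/
  | load (d a : ℕ) : Prog
  /-- `M[R[a]] := R[b]` -/
  | store (a b : ℕ) : Prog
  /-- first `p`, then `q` -/
  | seq (p q : Prog) : Prog
  /-- if `R[a] ≠ 0` then `p` else `q` -/
  | ite (a : ℕ) (p q : Prog) : Prog
  /-- while `R[a] ≠ 0` do `p` -/
  | loop (a : ℕ) (p : Prog) : Prog

/-- The contents of the registers and of the memory. -/
structure State : Type where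
  reg : ℕ → ℕ
  mem : ℕ → ℕ

/-- `R[d] := x`. -/
def State.setReg (s : State) (d x : ℕ) : State :=
  { s with reg := Function.update s.reg d x }

/-- `M[i] := x`. -/
def State.setMem (s : State) (i x : ℕ) : State :=
  { s with mem := Function.update s.mem i x }

/-- `Exec p s t s'`: the program `p`, started in the state `s`, halts after exactly `t` steps in the
state `s'`.  Every elementary instruction and every evaluation of the test of a conditional or of a
loop is one step. -/
inductive Exec : Prog → State → ℕ → State → Prop
  | skip (s : State) : Exec .skip s 1 s
  | const (s : State) (d c : ℕ) : Exec (.const d c) s 1 (s.setReg d c)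
  | copy (s : State) (d a : ℕ) : Exec (.copy d a) s 1 (s.setReg d (s.reg a))
  | plus (s : State) (d a b : ℕ) : Exec (.plus d a b) s 1 (s.setReg d (s.reg a + s.reg b))
  | minus (s : State) (d a b : ℕ) : Exec (.minus d a b) s 1 (s.setReg d (s.reg a - s.reg b))
  | load (s : State) (d a : ℕ) : Exec (.load d a) s 1 (s.setReg d (s.mem (s.reg a)))
  | store (s : State) (a b : ℕ) : Exec (.store a b) s 1 (s.setMem (s.reg a) (s.reg b))
  | seq {p q : Prog} {s s' s'' : State} {t t' : ℕ} (hp : Exec p s t s') (hq : Exec q s' t' s'') :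
      Exec (.seq p q) s (t + t') s''
  | ite_true {a : ℕ} {p q : Prog} {s s' : State} {t : ℕ} (ha : s.reg a ≠ 0) (hp : Exec p s t s') :
      Exec (.ite a p q) s (t + 1) s'
  | ite_false {a : ℕ} {p q : Prog} {s s' : State} {t : ℕ} (ha : s.reg a = 0) (hq : Exec q s t s') :
      Exec (.ite a p q) s (t + 1) s'
  | loop_done {a : ℕ} {p : Prog} {s : State} (ha : s.reg a = 0) : Exec (.loop a p) s 1 s
  | loop_step {a : ℕ} {p : Prog} {s s' s'' : State} {t t' : ℕ} (ha : s.reg a ≠ 0)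
      (hp : Exec p s t s') (hl : Exec (.loop a p) s' t' s'') :
      Exec (.loop a p) s (t + t' + 1) s''

/-- The initial state on the input word `w`: `R[0]` holds the length of `w`, the cell `M[i]` holds
the `i`-th bit of `w`, and everything else is `0`. -/
def initState (w : List Bool) : State where
  reg i := if i = 0 then w.length else 0
  mem i := (w.getD i false).toNat

/-- The decision problem with instances `α`, encoded as binary words by `enc`, and yes-instances
`Yes`, is solvable in polynomial time on the instances that satisfy `Class`: one program, on each
such instance, halts after a number of steps that is polynomial in the length of the encoding, with
the answer (`1` for yes, `0` for no) in `R[0]`. -/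
def PolyTimeSolvableOn {α : Type} (enc : α → List Bool) (Class Yes : α → Prop) : Prop :=
  ∃ (prog : Prog) (bound : Polynomial ℕ), ∀ x : α, Class x →
    ∃ (t : ℕ) (s : State), Exec prog (initState (enc x)) t s ∧
      t ≤ bound.eval (enc x).length ∧
      (Yes x → s.reg 0 = 1) ∧ (¬ Yes x → s.reg 0 = 0)

/-! ### Steiner forests and deletion sets -/

/-- A subgraph `F` of `G` is a Steiner forest for the set `S` of terminal pairs if the two vertices
of each pair lie in the same connected component of `F`. -/
def IsSteinerForest {V : Type} {G : SimpleGraph V} (S : Finset (V × V)) (F : G.Subgraph) : Prop :=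
  ∀ p ∈ S, ∃ (hs : p.1 ∈ F.verts) (ht : p.2 ∈ F.verts), F.coe.Reachable ⟨p.1, hs⟩ ⟨p.2, ht⟩

/-- `T` is a `c`-deletion set of `G` if each connected component of `G - T` has at most `c`
vertices. -/
def IsDeletionSet {V : Type} (G : SimpleGraph V) (c : ℕ) (T : Finset V) : Prop :=
  ∀ C : (G.induce {v | v ∉ T}).ConnectedComponent, C.supp.encard ≤ c

/-- An instance of the Steiner Forest problem: a finite graph, a set of terminal pairs, and an
integer. -/
structure Inst : Type where
  n : ℕ
  G : SimpleGraph (Fin n)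
  S : Finset (Fin n × Fin n)
  k : ℤ

/-- The question of the Steiner Forest problem: is there a Steiner forest with at most `k` edges? -/
def Inst.Yes (I : Inst) : Prop :=
  ∃ F : I.G.Subgraph, IsSteinerForest I.S F ∧ (F.edgeSet.ncard : ℤ) ≤ I.k

open Classical in
/-- The `n × n` Boolean matrix of a relation on `Fin n`, row by row. -/
noncomputable def matrixBits {n : ℕ} (r : Fin n → Fin n → Prop) : List Bool :=
  (List.finRange n).flatMap fun i => (List.finRange n).map fun j => decide (r i j)

/-- The encoding of an instance as a binary word: `n` ones and a zero, the adjacency matrix, the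
matrix of the set of terminal pairs, the sign of `k`, and `|k|` in binary. -/
noncomputable def Inst.encode (I : Inst) : List Bool :=
  List.replicate I.n true ++ [false] ++ matrixBits I.G.Adj ++
    matrixBits (fun i j => (i, j) ∈ I.S) ++ [decide (I.k < 0)] ++ I.k.natAbs.bits

end SteinerForest

namespace SteinerForest

open Finset

/-! Fill up the deletion set to exactly two vertices `u`, `v`, if need be with additional isolated
vertices. Every component of `G - {u, v}` is then a vertex or an edge, and the ends of such an edge
are mates. Call a vertex required (`Req`) if the terminal pairs force it to be connected to `u` or
`v`. A terminal pair that involves neither `u` nor `v` nor a required vertex consists of two mates,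
and it costs one edge unless the forest connects it anyway.

Suppose that the forest connects `u` and `v`. All required vertices lie in one tree with `u` and
`v`, and what remains to be chosen is the path from `u` to `v`, which has at most two inner
vertices. For a fixed path (`Bridge`) the optimum is obtained by counting: the vertices of the tree
other than `u` and `v`, one more edge, and the pairs of mates that are not covered by the path
(`join_lower`, `join_upper`).

Suppose that the forest separates `u` and `v`. Each required vertex chooses a side. The cost is the
number of required vertices and of inner pairs, plus one for each required vertex that reaches its
side only through a mate that is not required. Both the forbidden choices and the additional costs
have the form "`i` on the side of `u`, `j` on the side of `v`", so that the optimum is a minimum cut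
(`sep_lower`, `sep_upper`, `cutCap_of_not_blocked`). The lower bounds in both cases rest on the
injectivity of the map from attached vertices to their first edges towards `u` or `v`
(`parentEdge_injective`). `exists_forest_iff` combines the two cases.

The minimum cut is found by unit augmentations along arcs of decreasing distance labels, in fewer
than `N ^ 5` steps, where `N` is the length of the input (`Flow.run_spec`).

To obtain a machine program, the algorithm is written as an array program, that is, by tables of
expressions with sums over `range N` and by `N`-fold repetition. Such programs compile to machine
programs of polynomial running time (`PolyTimeSolvableOn.of_stm`), and `run_steinerProg` is the
correctness of this one. -/

/-! ### A language of array programs -/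

/-- Expressions over array variables and scalar variables; `size` is the length of the input, which
also bounds the range of every sum. -/
inductive Exp : Type
  | var (x : ℕ) : Exp
  | num (c : ℕ) : Exp
  | size : Exp
  | add (a b : Exp) : Exp
  | sub (a b : Exp) : Exp
  | cond (c a b : Exp) : Exp
  | arr (k : ℕ) (i j : Exp) : Exp
  | sum (x : ℕ) (e : Exp) : Exp

/-- The contents of the two-dimensional arrays. -/
abbrev Arrays := ℕ → ℕ → ℕ → ℕ

/-- The value of an expression. -/
def Exp.eval (N : ℕ) (A : Arrays) : Exp → (ℕ → ℕ) → ℕ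
  | .var x, v => v x
  | .num c, _ => c
  | .size, _ => N
  | .add a b, v => a.eval N A v + b.eval N A v
  | .sub a b, v => a.eval N A v - b.eval N A v
  | .cond c a b, v => if c.eval N A v ≠ 0 then a.eval N A v else b.eval N A v
  | .arr k i j, v => A k (i.eval N A v) (j.eval N A v)
  | .sum x e, v => ∑ i ∈ range N, e.eval N A (Function.update v x i)

/-- The expression does not read the array `k`. -/
def Exp.Avoids (k : ℕ) : Exp → Prop
  | .var _ => True
  | .num _ => True
  | .size => True
  | .add a b => a.Avoids k ∧ b.Avoids k
  | .sub a b => a.Avoids k ∧ b.Avoids k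
  | .cond c a b => c.Avoids k ∧ a.Avoids k ∧ b.Avoids k
  | .arr l i j => l ≠ k ∧ i.Avoids k ∧ j.Avoids k
  | .sum _ e => e.Avoids k

/-- Array programs: `tab k e` fills the array `k` with the values of `e` as a function of the
variables `0` and `1`, and `rep p` runs `p` as often as the input is long. -/
inductive Stm : Type
  | tab (k : ℕ) (e : Exp) : Stm
  | seq (p q : Stm) : Stm
  | rep (p : Stm) : Stm

/-- The valuation `0 ↦ i, 1 ↦ j`. -/
def env (i j : ℕ) : ℕ → ℕ := Function.update (Function.update (fun _ => 0) 0 i) 1 j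

/-- The effect of an array program. -/
def Stm.run (N : ℕ) : Stm → Arrays → Arrays
  | .tab k e, A => Function.update A k fun i j => if i < N ∧ j < N then e.eval N A (env i j) else 0
  | .seq p q, A => q.run N (p.run N A)
  | .rep p, A => (p.run N)^[N] A

/-- No array is read while it is being filled. -/
def Stm.WF : Stm → Prop
  | .tab k e => e.Avoids k
  | .seq p q => p.WF ∧ q.WF
  | .rep p => p.WF

/-- While an array is being filled, its entries are partly old and partly new. An expression that
avoids it does not notice. -/
theorem Exp.eval_congr {N k : ℕ} {A B : Arrays} (h : ∀ l, l ≠ k → A l = B l) (e : Exp)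
    (he : e.Avoids k) (v : ℕ → ℕ) : e.eval N A v = e.eval N B v := by
  induction e generalizing v with
  | var x => rfl
  | num c => rfl
  | size => rfl
  | add a b iha ihb => simp only [eval, iha he.1, ihb he.2]
  | sub a b iha ihb => simp only [eval, iha he.1, ihb he.2]
  | cond c a b ihc iha ihb => simp only [eval, ihc he.1, iha he.2.1, ihb he.2.2]
  | arr l i j ihi ihj => simp only [eval, ihi he.2.1, ihj he.2.2, h l he.1]
  | sum x e ih => simp only [eval, ih he]

/-! ### Executions with a bound on the number of steps -/

/-- `p` takes `s` to `s'` in at most `B` steps. -/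
def Runs (p : Prog) (s : State) (B : ℕ) (s' : State) : Prop := ∃ t ≤ B, Exec p s t s'

theorem Runs.mono {p : Prog} {s s' : State} {B C : ℕ} (h : Runs p s B s') (hBC : B ≤ C) :
    Runs p s C s' := by
  obtain ⟨t, ht, h⟩ := h
  exact ⟨t, ht.trans hBC, h⟩

theorem Runs.seq {p q : Prog} {s s' s'' : State} {B C : ℕ} (hp : Runs p s B s')
    (hq : Runs q s' C s'') : Runs (.seq p q) s (B + C) s'' := by
  obtain ⟨t, ht, h⟩ := hp
  obtain ⟨t', ht', h'⟩ := hq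
  exact ⟨t + t', by omega, .seq h h'⟩

theorem runs_const (s : State) (d c : ℕ) : Runs (.const d c) s 1 (s.setReg d c) :=
  ⟨1, le_rfl, .const s d c⟩
theorem runs_copy (s : State) (d a : ℕ) : Runs (.copy d a) s 1 (s.setReg d (s.reg a)) :=
  ⟨1, le_rfl, .copy s d a⟩
theorem runs_plus (s : State) (d a b : ℕ) :
    Runs (.plus d a b) s 1 (s.setReg d (s.reg a + s.reg b)) := ⟨1, le_rfl, .plus s d a b⟩
theorem runs_minus (s : State) (d a b : ℕ) :
    Runs (.minus d a b) s 1 (s.setReg d (s.reg a - s.reg b)) := ⟨1, le_rfl, .minus s d a b⟩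
theorem runs_load (s : State) (d a : ℕ) :
    Runs (.load d a) s 1 (s.setReg d (s.mem (s.reg a))) := ⟨1, le_rfl, .load s d a⟩
theorem runs_store (s : State) (a b : ℕ) :
    Runs (.store a b) s 1 (s.setMem (s.reg a) (s.reg b)) := ⟨1, le_rfl, .store s a b⟩
theorem runs_skip (s : State) : Runs .skip s 1 s := ⟨1, le_rfl, .skip s⟩

theorem runs_ite {a : ℕ} {p q : Prog} {s s' : State} {B : ℕ}
    (hp : s.reg a ≠ 0 → Runs p s B s') (hq : s.reg a = 0 → Runs q s B s') :
    Runs (.ite a p q) s (B + 1) s' := by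
  by_cases h : s.reg a = 0
  · obtain ⟨t, ht, h'⟩ := hq h
    exact ⟨t + 1, by omega, .ite_false h h'⟩
  · obtain ⟨t, ht, h'⟩ := hp h
    exact ⟨t + 1, by omega, .ite_true h h'⟩

/-- The register `a` counts down from `n`, and `Inv i` describes the state after `i` passes. Each
pass pays one step for its test, and the last, failing test is the final `+ 1`. -/
theorem runs_loop {a n B : ℕ} {p : Prog} (Inv : ℕ → State → Prop)
    (hreg : ∀ i s, Inv i s → s.reg a = n - i)
    (hstep : ∀ i s, i < n → Inv i s → ∃ s', Runs p s B s' ∧ Inv (i + 1) s')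
    (s : State) (h0 : Inv 0 s) :
    ∃ s', Runs (.loop a p) s (n * (B + 1) + 1) s' ∧ Inv n s' := by
  suffices H : ∀ m i s, i + m = n → Inv i s →
      ∃ s', Runs (.loop a p) s (m * (B + 1) + 1) s' ∧ Inv n s' from H n 0 s (by omega) h0
  intro m
  induction m with
  | zero =>
    intro i s hi h
    obtain rfl : i = n := by omega
    exact ⟨s, ⟨1, by omega, .loop_done (by rw [hreg _ _ h]; omega)⟩, h⟩
  | succ m ih =>
    intro i s hi h
    obtain ⟨s', ⟨t, ht, hx⟩, h'⟩ := hstep i s (by omega) h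
    obtain ⟨s'', ⟨t', ht', hx'⟩, h''⟩ := ih (i + 1) s' (by omega) h'
    refine ⟨s'', ⟨t + t' + 1, ?_, .loop_step (by rw [hreg _ _ h]; omega) hx hx'⟩, h''⟩
    rw [Nat.succ_mul]
    omega

theorem State.setReg_reg (s : State) (d x r : ℕ) :
    (s.setReg d x).reg r = if r = d then x else s.reg r := by
  simp [State.setReg, Function.update_apply]

theorem State.setReg_mem (s : State) (d x : ℕ) : (s.setReg d x).mem = s.mem := rfl

theorem State.setMem_reg (s : State) (d x : ℕ) : (s.setMem d x).reg = s.reg := rfl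

/-! ### Compilation -/

/-- A sequence of programs. -/
def block : List Prog → Prog
  | [] => .skip
  | p :: l => .seq p (block l)

/-- `k` times `R[a] := R[a] + R[0]`. -/
def addSize (a : ℕ) : ℕ → Prog
  | 0 => .skip
  | k + 1 => .seq (.plus a a 0) (addSize a k)

/-- `R[a] := (k * N + R[a]) * N + R[a + 2]`, where `N = R[0]`. -/
def addrProg (k a : ℕ) : Prog :=
  block [addSize a k, .const (a + 4) 1, .copy (a + 6) 0, .const (a + 8) 0,
    .loop (a + 6) (block [.plus (a + 8) (a + 8) a, .minus (a + 6) (a + 6) (a + 4)]),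
    .plus a (a + 8) (a + 2)]

/-- The code of an expression, which leaves its value in the register `2 * d + 2`. -/
def Exp.code : Exp → ℕ → Prog
  | .var x, d => .copy (2 * d + 2) (2 * x + 1)
  | .num c, d => .const (2 * d + 2) c
  | .size, d => .copy (2 * d + 2) 0
  | .add a b, d =>
    block [a.code d, b.code (d + 1), .plus (2 * d + 2) (2 * d + 2) (2 * d + 4)]
  | .sub a b, d =>
    block [a.code d, b.code (d + 1), .minus (2 * d + 2) (2 * d + 2) (2 * d + 4)]
  | .cond c a b, d => .seq (c.code d) (.ite (2 * d + 2) (a.code d) (b.code d))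
  | .arr k i j, d =>
    block [i.code d, j.code (d + 1), .minus (2 * d + 12) 0 (2 * d + 2),
      .minus (2 * d + 14) 0 (2 * d + 4), addrProg k (2 * d + 2), .load (2 * d + 2) (2 * d + 2),
      .ite (2 * d + 12) .skip (.const (2 * d + 2) 0),
      .ite (2 * d + 14) .skip (.const (2 * d + 2) 0)]
  | .sum x e, d =>
    block [.copy (2 * d + 6) (2 * x + 1), .const (2 * d + 2) 0, .copy (2 * d + 4) 0,
      .const (2 * x + 1) 0,
      .loop (2 * d + 4) (block [e.code (d + 3), .plus (2 * d + 2) (2 * d + 2) (2 * d + 8),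
        .const (2 * d + 8) 1, .plus (2 * x + 1) (2 * x + 1) (2 * d + 8),
        .minus (2 * d + 4) (2 * d + 4) (2 * d + 8)]),
      .copy (2 * x + 1) (2 * d + 6)]

/-- The code of an array program, which uses only the registers `2 * d' + 2` with `d ≤ d'` and
those of the variables. -/
def Stm.code : Stm → ℕ → Prog
  | .tab k e, d =>
    block [.copy (2 * d + 2) 0,
      .loop (2 * d + 2) (block [.copy (2 * d + 4) 0,
        .loop (2 * d + 4) (block [e.code (d + 3), .copy (2 * d + 10) 1, .copy (2 * d + 12) 3,
          addrProg k (2 * d + 10), .store (2 * d + 10) (2 * d + 8), .const (2 * d + 6) 1,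
          .plus 3 3 (2 * d + 6), .minus (2 * d + 4) (2 * d + 4) (2 * d + 6)]),
        .const 3 0, .const (2 * d + 6) 1, .plus 1 1 (2 * d + 6),
        .minus (2 * d + 2) (2 * d + 2) (2 * d + 6)]),
      .const 1 0]
  | .seq p q, d => .seq (p.code d) (q.code d)
  | .rep p, d =>
    block [.copy (2 * d + 2) 0,
      .loop (2 * d + 2) (block [p.code (d + 1), .const (2 * d + 4) 1,
        .minus (2 * d + 2) (2 * d + 2) (2 * d + 4)])]

theorem runs_block_nil (s : State) : Runs (block []) s 1 s := runs_skip s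

theorem runs_block_cons {p : Prog} {l : List Prog} {s s' s'' : State} {B C : ℕ}
    (hp : Runs p s B s') (hq : Runs (block l) s' C s'') : Runs (block (p :: l)) s (B + C) s'' :=
  hp.seq hq

/-- The registers below `2 * d + 2` and those of odd number are the same. -/
def SameRegs (d : ℕ) (s s' : State) : Prop :=
  ∀ r, r % 2 = 1 ∨ r < 2 * d + 2 → s'.reg r = s.reg r

theorem runs_addSize (a k : ℕ) (ha : a ≠ 0) (s : State) :
    Runs (addSize a k) s (k + 1) (s.setReg a (k * s.reg 0 + s.reg a)) := by
  induction k generalizing s with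
  | zero =>
    have : s.setReg a (0 * s.reg 0 + s.reg a) = s := by simp [State.setReg]
    rw [this]
    exact runs_skip s
  | succ k ih =>
    have h := (runs_plus s a a 0).seq (ih (s.setReg a (s.reg a + s.reg 0)))
    have e : (s.setReg a (s.reg a + s.reg 0)).setReg a
        (k * (s.setReg a (s.reg a + s.reg 0)).reg 0 + (s.setReg a (s.reg a + s.reg 0)).reg a) =
        s.setReg a ((k + 1) * s.reg 0 + s.reg a) := by
      simp only [State.setReg, Function.update_idem, Function.update_self,
        Function.update_of_ne ha.symm]
      congr 2
      ring
    rw [e] at h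
    exact h.mono (by omega)

/-- The machine cannot multiply. As `k` is fixed, `k * N` is unrolled into `k` additions, while the
other product takes a loop of `N` additions. The even registers from `2 * d + 2` to `2 * d + 10` are
scratch space. -/
theorem runs_addrProg (k d : ℕ) (s : State) :
    ∃ s', Runs (addrProg k (2 * d + 2)) s (k + 10 + s.reg 0 * 4) s' ∧ s'.mem = s.mem ∧
      s'.reg (2 * d + 2) = (k * s.reg 0 + s.reg (2 * d + 2)) * s.reg 0 + s.reg (2 * d + 4) ∧
      ∀ r, (r % 2 = 1 ∨ r < 2 * d + 2 ∨ 2 * d + 10 < r) → s'.reg r = s.reg r := by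
  set a := 2 * d + 2 with ha
  have h1 := runs_addSize a k (by omega) s
  set x := k * s.reg 0 + s.reg a with hx
  have h2 := runs_const (s.setReg a x) (a + 4) 1
  set s2 := (s.setReg a x).setReg (a + 4) 1 with hs2
  have h3 := runs_copy s2 (a + 6) 0
  set s3 := s2.setReg (a + 6) (s2.reg 0) with hs3
  have h4 := runs_const s3 (a + 8) 0
  set s4 := s3.setReg (a + 8) 0 with hs4
  obtain ⟨s5, h5, i1, i2, i3, i4, i5, i6⟩ := runs_loop (a := a + 6) (n := s.reg 0) (B := 3)
    (p := block [.plus (a + 8) (a + 8) a, .minus (a + 6) (a + 6) (a + 4)])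
    (fun i t => t.reg (a + 6) = s.reg 0 - i ∧ t.reg (a + 8) = i * x ∧ t.reg a = x ∧
      t.reg (a + 4) = 1 ∧ t.mem = s.mem ∧
      ∀ r, (r % 2 = 1 ∨ r < a ∨ a + 8 < r ∨ r = a + 2) → t.reg r = s.reg r)
    (fun i t h => h.1) (by
      rintro i t hi ⟨j1, j2, j3, j4, j5, j6⟩
      refine ⟨_, runs_block_cons (runs_plus _ _ _ _) (runs_block_cons (runs_minus _ _ _ _)
        (runs_block_nil _)), ?_, ?_, ?_, ?_, ?_, ?_⟩
      · simp [State.setReg_reg, j1, j4]; omega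
      · simp [State.setReg_reg, j2, j3]; ring
      · simp [State.setReg_reg, j3]
      · simp [State.setReg_reg, j4]
      · exact j5
      · intro r hr
        simp only [State.setReg_reg]
        rw [if_neg (by omega), if_neg (by omega), j6 r hr])
    s4 (by
      refine ⟨?_, ?_, ?_, ?_, rfl, ?_⟩
      · simp [hs4, hs3, hs2, State.setReg_reg, ha]
      · simp [hs4, State.setReg_reg]
      · simp [hs4, hs3, hs2, State.setReg_reg]
      · simp [hs4, hs3, hs2, State.setReg_reg]
      · intro r hr
        simp only [hs4, hs3, hs2, State.setReg_reg]
        rw [if_neg (by omega), if_neg (by omega), if_neg (by omega), if_neg (by omega)])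
  refine ⟨_, (runs_block_cons h1 (runs_block_cons h2 (runs_block_cons h3 (runs_block_cons h4
    (runs_block_cons h5 (runs_block_cons (runs_plus s5 a (a + 8) (a + 2))
      (runs_block_nil _))))))).mono (by omega), i5, ?_, ?_⟩
  · have : s5.reg (a + 2) = s.reg (2 * d + 4) := i6 _ (by omega)
    simp only [State.setReg_reg, if_true, i2, this]
    ring
  · intro r hr
    simp only [State.setReg_reg]
    rw [if_neg (by omega), i6 r (by omega)]

/-! ### Correctness and running time of compiled code -/

/-- The memory holds the arrays, which vanish outside of the range of their indices. -/
def MemRep (N : ℕ) (A : Arrays) (mem : ℕ → ℕ) : Prop :=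
  (∀ k i j, i < N → j < N → mem ((k * N + i) * N + j) = A k i j) ∧
    ∀ k i j, ¬ (i < N ∧ j < N) → A k i j = 0

/-- A bound on the running time of the code of an expression. -/
noncomputable def Exp.cost : Exp → Polynomial ℕ
  | .var _ => 1
  | .num _ => 1
  | .size => 1
  | .add a b => a.cost + b.cost + 2
  | .sub a b => a.cost + b.cost + 2
  | .cond c a b => c.cost + a.cost + b.cost + 1
  | .arr k i j => i.cost + j.cost + Polynomial.C k + 18 + .X * 4
  | .sum _ e => 7 + .X * (e.cost + 5 + 1)

/-- Variables live in odd registers and intermediate results in even ones from `2 * d + 2` on. Hence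
a subexpression compiled at greater depth preserves the results that are still needed. -/
theorem runs_exp {N : ℕ} {A : Arrays} (e : Exp) (d : ℕ) (v : ℕ → ℕ) (s : State)
    (h0 : s.reg 0 = N) (hA : MemRep N A s.mem) (hv : ∀ x, s.reg (2 * x + 1) = v x) :
    ∃ s', Runs (e.code d) s (e.cost.eval N) s' ∧ s'.mem = s.mem ∧
      s'.reg (2 * d + 2) = e.eval N A v ∧ SameRegs d s s' := by
  induction e generalizing d v s with
  | var x =>
    refine ⟨_, (runs_copy _ _ _).mono (by simp [Exp.cost]), rfl, ?_, ?_⟩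
    · simp [State.setReg_reg, Exp.eval, hv]
    · intro r hr
      rw [State.setReg_reg, if_neg (by omega)]
  | num c =>
    refine ⟨_, (runs_const _ _ _).mono (by simp [Exp.cost]), rfl, ?_, ?_⟩
    · simp [State.setReg_reg, Exp.eval]
    · intro r hr
      rw [State.setReg_reg, if_neg (by omega)]
  | size =>
    refine ⟨_, (runs_copy _ _ _).mono (by simp [Exp.cost]), rfl, ?_, ?_⟩
    · simp [State.setReg_reg, Exp.eval, h0]
    · intro r hr
      rw [State.setReg_reg, if_neg (by omega)]
  | add a b iha ihb =>
    obtain ⟨s1, r1, m1, v1, k1⟩ := iha d v s h0 hA hv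
    obtain ⟨s2, r2, m2, v2, k2⟩ := ihb (d + 1) v s1 (by rw [k1 0 (by omega), h0]) (m1 ▸ hA)
      (fun x => by rw [k1 _ (by omega), hv])
    refine ⟨_, (runs_block_cons r1 (runs_block_cons r2 (runs_block_cons (runs_plus _ _ _ _)
      (runs_block_nil _)))).mono (by simp [Exp.cost]; omega), m2.trans m1, ?_, ?_⟩
    · have := k2 (2 * d + 2) (by omega)
      have v2' : s2.reg (2 * d + 4) = _ := v2
      simp [State.setReg_reg, Exp.eval, this, v1, v2']
    · intro r hr
      rw [State.setReg_reg, if_neg (by omega), k2 r (by omega), k1 r hr]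
  | sub a b iha ihb =>
    obtain ⟨s1, r1, m1, v1, k1⟩ := iha d v s h0 hA hv
    obtain ⟨s2, r2, m2, v2, k2⟩ := ihb (d + 1) v s1 (by rw [k1 0 (by omega), h0]) (m1 ▸ hA)
      (fun x => by rw [k1 _ (by omega), hv])
    refine ⟨_, (runs_block_cons r1 (runs_block_cons r2 (runs_block_cons (runs_minus _ _ _ _)
      (runs_block_nil _)))).mono (by simp [Exp.cost]; omega), m2.trans m1, ?_, ?_⟩
    · have := k2 (2 * d + 2) (by omega)
      have v2' : s2.reg (2 * d + 4) = _ := v2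
      simp [State.setReg_reg, Exp.eval, this, v1, v2']
    · intro r hr
      rw [State.setReg_reg, if_neg (by omega), k2 r (by omega), k1 r hr]
  | cond c a b ihc iha ihb =>
    obtain ⟨s1, r1, m1, v1, k1⟩ := ihc d v s h0 hA hv
    have h0' : s1.reg 0 = N := by rw [k1 0 (by omega), h0]
    have hv' : ∀ x, s1.reg (2 * x + 1) = v x := fun x => by rw [k1 _ (by omega), hv]
    by_cases hc : s1.reg (2 * d + 2) = 0
    · obtain ⟨s2, r2, m2, v2, k2⟩ := ihb d v s1 h0' (m1 ▸ hA) hv'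
      refine ⟨s2, (r1.seq (runs_ite (fun h => absurd hc h) fun _ => r2)).mono
        (by simp [Exp.cost]; omega), m2.trans m1, ?_, fun r hr => by rw [k2 r hr, k1 r hr]⟩
      rw [v1] at hc
      simp [Exp.eval, hc, v2]
    · obtain ⟨s2, r2, m2, v2, k2⟩ := iha d v s1 h0' (m1 ▸ hA) hv'
      refine ⟨s2, (r1.seq (runs_ite (fun _ => r2) fun h => absurd h hc)).mono
        (by simp [Exp.cost]; omega), m2.trans m1, ?_, fun r hr => by rw [k2 r hr, k1 r hr]⟩
      rw [v1] at hc
      simp [Exp.eval, hc, v2]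
  | arr k a b iha ihb =>
    obtain ⟨s1, r1, m1, v1, k1⟩ := iha d v s h0 hA hv
    obtain ⟨s2, r2, m2, v2, k2⟩ := ihb (d + 1) v s1 (by rw [k1 0 (by omega), h0]) (m1 ▸ hA)
      (fun x => by rw [k1 _ (by omega), hv])
    have v1' : s2.reg (2 * d + 2) = a.eval N A v := by rw [k2 _ (by omega), v1]
    have v2' : s2.reg (2 * d + 4) = b.eval N A v := v2
    have z2 : s2.reg 0 = N := by rw [k2 0 (by omega), k1 0 (by omega), h0]
    -- The truncated difference `N - i` is nonzero exactly if the index `i` is in range. The two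
    -- differences are kept beyond the scratch registers of `addrProg`; they later decide whether
    -- the loaded value, which for a bad index may belong to another entry, is replaced by `0`.
    have r3 := runs_minus s2 (2 * d + 12) 0 (2 * d + 2)
    set s3 := s2.setReg (2 * d + 12) (s2.reg 0 - s2.reg (2 * d + 2)) with hs3
    have r4 := runs_minus s3 (2 * d + 14) 0 (2 * d + 4)
    set s4 := s3.setReg (2 * d + 14) (s3.reg 0 - s3.reg (2 * d + 4)) with hs4
    have z4 : s4.reg 0 = N := by simp [hs4, hs3, State.setReg_reg, z2]
    obtain ⟨s5, r5, m5, v5, k5⟩ := runs_addrProg k d s4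
    have m5' : s5.mem = s.mem := by rw [m5, ← m1, ← m2]; rfl
    have v5' : s5.reg (2 * d + 2) = (k * N + a.eval N A v) * N + b.eval N A v := by
      rw [v5, z4]
      simp [hs4, hs3, State.setReg_reg, v1', v2']
    have w1 : s5.reg (2 * d + 12) = N - a.eval N A v := by
      rw [k5 _ (by omega)]
      simp [hs4, hs3, State.setReg_reg, v1', z2]
    have w2 : s5.reg (2 * d + 14) = N - b.eval N A v := by
      rw [k5 _ (by omega)]
      simp [hs4, hs3, State.setReg_reg, v2', z2]
    have r6 := runs_load s5 (2 * d + 2) (2 * d + 2)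
    set s6 := s5.setReg (2 * d + 2) (s5.mem (s5.reg (2 * d + 2))) with hs6
    have hclear : ∀ (t : State) (q : ℕ), q ≠ 2 * d + 2 →
        Runs (.ite q .skip (.const (2 * d + 2) 0)) t 2
          (t.setReg (2 * d + 2) (if t.reg q ≠ 0 then t.reg (2 * d + 2) else 0)) := by
      intro t q hq
      refine runs_ite (fun h => ?_) fun h => ?_
      · have : t.setReg (2 * d + 2) (if t.reg q ≠ 0 then t.reg (2 * d + 2) else 0) = t := by
          simp [h, State.setReg]
        rw [this]
        exact runs_skip t
      · simpa [h] using runs_const t (2 * d + 2) 0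
    have r7 := hclear s6 (2 * d + 12) (by omega)
    set s7 := s6.setReg (2 * d + 2)
      (if s6.reg (2 * d + 12) ≠ 0 then s6.reg (2 * d + 2) else 0) with hs7
    have r8 := hclear s7 (2 * d + 14) (by omega)
    rw [z4] at r5
    refine ⟨_, (runs_block_cons r1 (runs_block_cons r2 (runs_block_cons r3 (runs_block_cons r4
      (runs_block_cons r5 (runs_block_cons r6 (runs_block_cons r7 (runs_block_cons r8
      (runs_block_nil _))))))))).mono (by simp [Exp.cost]; omega), m5', ?_, ?_⟩
    · simp only [hs7, hs6, State.setReg_reg, if_true, m5', v5',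
        if_neg (show ¬ 2 * d + 14 = 2 * d + 2 by omega),
        if_neg (show ¬ 2 * d + 12 = 2 * d + 2 by omega), w1, w2, Exp.eval]
      by_cases hi : a.eval N A v < N
      · by_cases hj : b.eval N A v < N
        · rw [if_pos (by omega), if_pos (by omega), hA.1 _ _ _ hi hj]
        · rw [if_neg (by omega), hA.2 _ _ _ (by omega)]
      · rw [if_neg (show ¬ N - a.eval N A v ≠ 0 by omega), hA.2 _ _ _ (by omega), ite_self]
    · intro r hr
      simp only [hs7, hs6, State.setReg_reg, if_neg (show ¬ r = 2 * d + 2 by omega)]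
      rw [k5 r (by omega)]
      simp only [hs4, hs3, State.setReg_reg]
      rw [if_neg (by omega), if_neg (by omega), k2 r (by omega), k1 r hr]
  | sum x e ih =>
    -- The summation variable may have a value outside of the sum, so this value is saved in `2 * d
    -- + 6` and restored after the loop.
    have r1 := runs_copy s (2 * d + 6) (2 * x + 1)
    set s1 := s.setReg (2 * d + 6) (s.reg (2 * x + 1)) with hs1
    have r2 := runs_const s1 (2 * d + 2) 0
    set s2 := s1.setReg (2 * d + 2) 0 with hs2
    have r3 := runs_copy s2 (2 * d + 4) 0
    set s3 := s2.setReg (2 * d + 4) (s2.reg 0) with hs3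
    have r4 := runs_const s3 (2 * x + 1) 0
    set s4 := s3.setReg (2 * x + 1) 0 with hs4
    obtain ⟨s5, r5, i1, i2, i3, i4, i5, i6⟩ := runs_loop (a := 2 * d + 4) (n := N)
      (B := e.cost.eval N + 5)
      (p := block [e.code (d + 3), .plus (2 * d + 2) (2 * d + 2) (2 * d + 8),
        .const (2 * d + 8) 1, .plus (2 * x + 1) (2 * x + 1) (2 * d + 8),
        .minus (2 * d + 4) (2 * d + 4) (2 * d + 8)])
      (fun i t => t.reg (2 * d + 4) = N - i ∧
        t.reg (2 * d + 2) = ∑ j ∈ range i, e.eval N A (Function.update v x j) ∧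
        t.reg (2 * x + 1) = i ∧ t.reg (2 * d + 6) = v x ∧ t.mem = s.mem ∧
        ∀ r, (r % 2 = 1 ∨ r < 2 * d + 2) → r ≠ 2 * x + 1 → t.reg r = s.reg r)
      (fun i t h => h.1) (by
        rintro i t hi ⟨j1, j2, j3, j4, j5, j6⟩
        obtain ⟨t1, q1, p1, p2, p3⟩ := ih (d + 3) (Function.update v x i) t
          (by rw [j6 0 (by omega) (by omega), h0]) (j5 ▸ hA) (by
            intro y
            by_cases hy : y = x
            · subst hy; simp [j3]
            · rw [j6 _ (by omega) (by omega), hv, Function.update_of_ne hy])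
        have p2' : t1.reg (2 * d + 8) = _ := p2
        have e1 := p3 (2 * d + 2) (by omega)
        have e2 := p3 (2 * d + 4) (by omega)
        have e3 := p3 (2 * d + 6) (by omega)
        have e4 := p3 (2 * x + 1) (by omega)
        refine ⟨_, (runs_block_cons q1 (runs_block_cons (runs_plus _ _ _ _) (runs_block_cons
          (runs_const _ _ _) (runs_block_cons (runs_plus _ _ _ _) (runs_block_cons
          (runs_minus _ _ _ _) (runs_block_nil _)))))).mono (by omega), ?_, ?_, ?_, ?_, ?_, ?_⟩
        · have n1 : ¬ 2 * d + 4 = 2 * x + 1 := by omega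
          have n2 : ¬ 2 * d + 8 = 2 * x + 1 := by omega
          simp [State.setReg_reg, e2, j1, n1, n2]; omega
        · have n1 : ¬ 2 * d + 2 = 2 * x + 1 := by omega
          simp [State.setReg_reg, e1, j2, p2', n1, sum_range_succ]
        · have n1 : ¬ 2 * x = 2 * d + 3 := by omega
          have n2 : ¬ 2 * x = 2 * d + 7 := by omega
          have n3 : ¬ 2 * x = 2 * d + 1 := by omega
          simp [State.setReg_reg, e4, j3, n1, n2, n3]
        · have n1 : ¬ 2 * d + 6 = 2 * x + 1 := by omega
          simp [State.setReg_reg, e3, j4, n1]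
        · exact p1.trans j5
        · intro r hr hrx
          simp only [State.setReg_reg]
          rw [if_neg (by omega), if_neg (by omega), if_neg (by omega), if_neg (by omega),
            p3 r (by omega), j6 r hr hrx])
      s4 (by
        refine ⟨?_, ?_, ?_, ?_, rfl, ?_⟩
        · have n1 : ¬ 2 * d + 4 = 2 * x + 1 := by omega
          simp [hs4, hs3, hs2, hs1, State.setReg_reg, h0, n1]
        · have n1 : ¬ 2 * d + 2 = 2 * x + 1 := by omega
          simp [hs4, hs3, hs2, hs1, State.setReg_reg, n1]
        · simp [hs4, State.setReg_reg]
        · have n1 : ¬ 2 * d + 6 = 2 * x + 1 := by omega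
          simp [hs4, hs3, hs2, hs1, State.setReg_reg, n1, hv]
        · intro r hr hrx
          simp only [hs4, hs3, hs2, hs1, State.setReg_reg]
          rw [if_neg (by omega), if_neg (by omega), if_neg (by omega), if_neg (by omega)])
    refine ⟨_, (runs_block_cons r1 (runs_block_cons r2 (runs_block_cons r3 (runs_block_cons r4
      (runs_block_cons r5 (runs_block_cons (runs_copy _ _ _) (runs_block_nil _))))))).mono
        (by simp [Exp.cost]; omega), i5, ?_, ?_⟩
    · simp only [State.setReg_reg]
      rw [if_neg (by omega), i2, Exp.eval]
    · intro r hr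
      by_cases hrx : r = 2 * x + 1
      · subst hrx
        simp [State.setReg_reg, i4, hv]
      · simp only [State.setReg_reg]
        rw [if_neg hrx, i6 r hr hrx]

/-- A bound on the running time of the code of an array program. -/
noncomputable def Stm.cost : Stm → Polynomial ℕ
  | .tab k e => 3 + (.X * (.X * (e.cost + Polynomial.C k + 17 + .X * 4 + 1) + 7 + 1) + 1)
  | .seq p q => p.cost + q.cost
  | .rep p => 2 + (.X * (p.cost + 3 + 1) + 1)

/-- Divide with remainder by `N` twice. The array number is the leading digit and needs no bound. -/
theorem address_injective {N k l i i' j j' : ℕ} (hi : i < N) (hi' : i' < N) (hj : j < N)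
    (hj' : j' < N) (h : (k * N + i) * N + j = (l * N + i') * N + j') :
    k = l ∧ i = i' ∧ j = j' := by
  have aux : ∀ {a b x y : ℕ}, x < N → y < N → a * N + x = b * N + y → a = b ∧ x = y := by
    intro a b x y hx hy hxy
    have h1 : (a * N + x) / N = a := by
      rw [mul_comm, Nat.mul_add_div (by omega), Nat.div_eq_of_lt hx, add_zero]
    have h2 : (b * N + y) / N = b := by
      rw [mul_comm, Nat.mul_add_div (by omega), Nat.div_eq_of_lt hy, add_zero]
    have h3 : a = b := by rw [← h1, ← h2, hxy]
    subst h3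
    exact ⟨rfl, by omega⟩
  obtain ⟨h1, h2⟩ := aux hj hj' h
  obtain ⟨h3, h4⟩ := aux hi hi' h1
  exact ⟨h3, h4, h2⟩

/-- The arrays while the entry `(i, j)` of the array `k` is about to be filled. -/
def partialTab (N : ℕ) (A : Arrays) (k : ℕ) (e : Exp) (i j : ℕ) : Arrays :=
  Function.update A k fun a b =>
    if a < N ∧ b < N then if a < i ∨ a = i ∧ b < j then e.eval N A (env a b) else A k a b else 0

theorem partialTab_zero {N : ℕ} {A : Arrays} {mem : ℕ → ℕ} (hA : MemRep N A mem) (k : ℕ)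
    (e : Exp) : partialTab N A k e 0 0 = A := by
  rw [partialTab, Function.update_eq_self_iff]
  funext a b
  by_cases h : a < N ∧ b < N
  · simp [h]
  · simp [h, hA.2 k a b h]

theorem partialTab_row (N : ℕ) (A : Arrays) (k : ℕ) (e : Exp) (i : ℕ) :
    partialTab N A k e i N = partialTab N A k e (i + 1) 0 := by
  rw [partialTab, partialTab]
  congr 1
  funext a b
  by_cases h : a < N ∧ b < N
  · rw [if_pos h, if_pos h]
    exact if_congr (by omega) rfl rfl
  · simp [h]

theorem partialTab_end (N : ℕ) (A : Arrays) (k : ℕ) (e : Exp) :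
    partialTab N A k e N 0 = (Stm.tab k e).run N A := by
  rw [partialTab, Stm.run]
  congr 1
  funext a b
  by_cases h : a < N ∧ b < N
  · simp [h]
  · simp [h]

theorem memRep_partialTab_succ {N : ℕ} {A : Arrays} {mem : ℕ → ℕ} {k : ℕ} {e : Exp} {i j : ℕ}
    (hi : i < N) (hj : j < N) (hA : MemRep N (partialTab N A k e i j) mem) :
    MemRep N (partialTab N A k e i (j + 1))
      (Function.update mem ((k * N + i) * N + j) (e.eval N A (env i j))) := by
  refine ⟨fun l a b ha hb => ?_, fun l a b hab => ?_⟩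
  · by_cases h : l = k ∧ a = i ∧ b = j
    · obtain ⟨rfl, rfl, rfl⟩ := h
      simp [partialTab, ha, hb]
    · rw [Function.update_of_ne (fun h' => h (address_injective ha hi hb hj h')), hA.1 l a b ha hb]
      by_cases hl : l = k
      · subst hl
        simp only [partialTab, Function.update_self, ha, hb, and_self, if_true]
        congr 1
        apply propext
        omega
      · simp [partialTab, Function.update_of_ne hl]
  · have := hA.2 l a b hab
    by_cases hl : l = k
    · subst hl
      simp [partialTab, hab]
    · simpa [partialTab, Function.update_of_ne hl] using this

/-- For a table, two nested countdown loops visit the entries row by row, with `partialTab` as the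
invariant. The registers `1` and `3` of the two index variables are reset to `0`, so that every
statement starts with all variables equal to `0`, as `env` presupposes. -/
theorem runs_stm {N : ℕ} (p : Stm) (hp : p.WF) (d : ℕ) (A : Arrays) (s : State)
    (h0 : s.reg 0 = N) (hA : MemRep N A s.mem) (hv : ∀ x, s.reg (2 * x + 1) = 0) :
    ∃ s', Runs (p.code d) s (p.cost.eval N) s' ∧ MemRep N (p.run N A) s'.mem ∧
      SameRegs d s s' := by
  induction p generalizing d A s with
  | seq p q ihp ihq =>
    obtain ⟨s1, r1, m1, k1⟩ := ihp hp.1 d A s h0 hA hv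
    obtain ⟨s2, r2, m2, k2⟩ := ihq hp.2 d _ s1 (by rw [k1 0 (by omega), h0]) m1
      (fun x => by rw [k1 _ (by omega), hv])
    exact ⟨s2, (r1.seq r2).mono (by simp [Stm.cost]), m2, fun r hr => by rw [k2 r hr, k1 r hr]⟩
  | rep p ih =>
    have r1 := runs_copy s (2 * d + 2) 0
    set s1 := s.setReg (2 * d + 2) (s.reg 0) with hs1
    obtain ⟨s2, r2, i1, i2, i3⟩ := runs_loop (a := 2 * d + 2) (n := N)
      (B := p.cost.eval N + 3)
      (p := block [p.code (d + 1), .const (2 * d + 4) 1,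
        .minus (2 * d + 2) (2 * d + 2) (2 * d + 4)])
      (fun i t => t.reg (2 * d + 2) = N - i ∧ MemRep N ((p.run N)^[i] A) t.mem ∧
        SameRegs d s t)
      (fun i t h => h.1) (by
        rintro i t hi ⟨j1, j2, j3⟩
        obtain ⟨t1, q1, p1, p2⟩ := ih hp (d + 1) _ t (by rw [j3 0 (by omega), h0]) j2
          (fun x => by rw [j3 _ (by omega), hv])
        have e1 := p2 (2 * d + 2) (by omega)
        refine ⟨_, (runs_block_cons q1 (runs_block_cons (runs_const _ _ _) (runs_block_cons
          (runs_minus _ _ _ _) (runs_block_nil _)))).mono (by omega), ?_, ?_, ?_⟩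
        · simp [State.setReg_reg, e1, j1]; omega
        · rw [Function.iterate_succ_apply']
          exact p1
        · intro r hr
          simp only [State.setReg_reg]
          rw [if_neg (by omega), if_neg (by omega), p2 r (by omega), j3 r hr])
      s1 ⟨by simp [hs1, State.setReg_reg, h0], hA, fun r hr => by
        rw [hs1, State.setReg_reg, if_neg (by omega)]⟩
    exact ⟨s2, (runs_block_cons r1 (runs_block_cons r2 (runs_block_nil _))).mono
      (by simp [Stm.cost]; omega), i2, i3⟩
  | tab k e =>
    have r1 := runs_copy s (2 * d + 2) 0
    set s1 := s.setReg (2 * d + 2) (s.reg 0) with hs1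
    have hinner : ∀ i t, i < N → t.reg 0 = N → MemRep N (partialTab N A k e i 0) t.mem →
        t.reg 1 = i → (∀ x, x ≠ 0 → t.reg (2 * x + 1) = 0) → t.reg (2 * d + 4) = N →
        ∃ t', Runs (.loop (2 * d + 4) (block [e.code (d + 3), .copy (2 * d + 10) 1,
          .copy (2 * d + 12) 3, addrProg k (2 * d + 10), .store (2 * d + 10) (2 * d + 8),
          .const (2 * d + 6) 1, .plus 3 3 (2 * d + 6),
          .minus (2 * d + 4) (2 * d + 4) (2 * d + 6)])) t
          (N * (e.cost.eval N + k + 17 + N * 4 + 1) + 1) t' ∧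
          MemRep N (partialTab N A k e i N) t'.mem ∧
          ∀ r, (r % 2 = 1 ∨ r < 2 * d + 4) → r ≠ 3 → t'.reg r = t.reg r := by
      intro i t hi t0 tA t1 tv tc
      obtain ⟨t', q, i1, i2, i3, i4⟩ := runs_loop (a := 2 * d + 4) (n := N)
        (B := e.cost.eval N + k + 17 + N * 4)
        (p := block [e.code (d + 3), .copy (2 * d + 10) 1,
          .copy (2 * d + 12) 3, addrProg k (2 * d + 10), .store (2 * d + 10) (2 * d + 8),
          .const (2 * d + 6) 1, .plus 3 3 (2 * d + 6),
          .minus (2 * d + 4) (2 * d + 4) (2 * d + 6)])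
        (fun j t' => t'.reg (2 * d + 4) = N - j ∧ MemRep N (partialTab N A k e i j) t'.mem ∧
          t'.reg 3 = j ∧ ∀ r, (r % 2 = 1 ∨ r < 2 * d + 4) → r ≠ 3 → t'.reg r = t.reg r)
        (fun j t' h => h.1) (by
          rintro j w hj ⟨j1, j2, j3, j4⟩
          have w0 : w.reg 0 = N := by rw [j4 0 (by omega) (by omega), t0]
          obtain ⟨w1, q1, m1, v1, k1⟩ := runs_exp e (d + 3) (env i j) w w0 j2 (by
            intro x
            by_cases h1 : x = 1
            · subst h1; simpa [env] using j3
            · rw [j4 _ (by omega) (by omega)]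
              by_cases h2 : x = 0
              · subst h2; simpa [env] using t1
              · rw [tv x h2]; simp [env, h1, h2])
          rw [e.eval_congr (B := A) (fun l hl => by simp [partialTab, Function.update_of_ne hl])
            hp] at v1
          have q2 := runs_copy w1 (2 * d + 10) 1
          set w2 := w1.setReg (2 * d + 10) (w1.reg 1) with hw2
          have q3 := runs_copy w2 (2 * d + 12) 3
          set w3 := w2.setReg (2 * d + 12) (w2.reg 3) with hw3
          obtain ⟨w4, q4, m4, v4, k4⟩ := runs_addrProg k (d + 4) w3
          have a0 : w3.reg 0 = N := by
            simp [hw3, hw2, State.setReg_reg, k1 0 (by omega), w0]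
          have a1 : w3.reg (2 * (d + 4) + 2) = i := by
            simp only [hw3, hw2, State.setReg_reg]
            rw [if_neg (by omega), if_pos (by omega), k1 1 (by omega),
              j4 1 (by omega) (by omega), t1]
          have a2 : w3.reg (2 * (d + 4) + 4) = j := by
            simp only [hw3, hw2, State.setReg_reg]
            rw [if_pos (by omega), if_neg (by omega), k1 3 (by omega), j3]
          rw [a0, a1, a2] at v4
          rw [a0] at q4
          have c4 : w4.reg (2 * d + 8) = e.eval N A (env i j) := by
            rw [k4 _ (by omega)]
            simp only [hw3, hw2, State.setReg_reg]
            rw [if_neg (by omega), if_neg (by omega)]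
            exact v1
          have b4 : ∀ r, (r % 2 = 1 ∨ r < 2 * d + 8) → w4.reg r = w.reg r := by
            intro r hr
            rw [k4 r (by omega)]
            simp only [hw3, hw2, State.setReg_reg]
            rw [if_neg (by omega), if_neg (by omega), k1 r (by omega)]
          refine ⟨_, (runs_block_cons q1 (runs_block_cons q2 (runs_block_cons q3
            (runs_block_cons q4 (runs_block_cons (runs_store _ _ _) (runs_block_cons
            (runs_const _ _ _) (runs_block_cons (runs_plus _ _ _ _) (runs_block_cons
            (runs_minus _ _ _ _) (runs_block_nil _))))))))).mono (by omega), ?_, ?_, ?_, ?_⟩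
          · simp [State.setReg_reg, State.setMem_reg, b4 (2 * d + 4) (by omega), j1]; omega
          · have := memRep_partialTab_succ hi hj j2
            have hm : w4.mem = w.mem := by rw [m4, ← m1]; rfl
            simp only [State.setReg_mem]
            rw [State.setMem, hm, c4]
            have v4' : w4.reg (2 * d + 10) = _ := v4
            rw [v4']
            exact this
          · simp only [State.setReg_reg, State.setMem_reg, if_true]
            rw [if_neg (by omega), if_neg (by omega), b4 3 (by omega), j3]
          · intro r hr hr3
            simp only [State.setReg_reg, State.setMem_reg]
            rw [if_neg (by omega), if_neg (by omega), if_neg (by omega), b4 r (by omega),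
              j4 r hr hr3])
        t ⟨by simp [tc], tA, tv 1 (by omega), fun r _ _ => rfl⟩
      exact ⟨t', q, i2, i4⟩
    obtain ⟨s2, r2, i1, i2, i3, i4⟩ := runs_loop (a := 2 * d + 2) (n := N)
      (B := N * (e.cost.eval N + k + 17 + N * 4 + 1) + 7)
      (p := block [.copy (2 * d + 4) 0,
        .loop (2 * d + 4) (block [e.code (d + 3), .copy (2 * d + 10) 1, .copy (2 * d + 12) 3,
          addrProg k (2 * d + 10), .store (2 * d + 10) (2 * d + 8), .const (2 * d + 6) 1,
          .plus 3 3 (2 * d + 6), .minus (2 * d + 4) (2 * d + 4) (2 * d + 6)]),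
        .const 3 0, .const (2 * d + 6) 1, .plus 1 1 (2 * d + 6),
        .minus (2 * d + 2) (2 * d + 2) (2 * d + 6)])
      (fun i t => t.reg (2 * d + 2) = N - i ∧ MemRep N (partialTab N A k e i 0) t.mem ∧
        t.reg 1 = i ∧ ∀ r, (r % 2 = 1 ∨ r < 2 * d + 2) → r ≠ 1 → t.reg r = s.reg r)
      (fun i t h => h.1) (by
        rintro i t hi ⟨j1, j2, j3, j4⟩
        have t0 : t.reg 0 = N := by rw [j4 0 (by omega) (by omega), h0]
        have q1 := runs_copy t (2 * d + 4) 0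
        set t1 := t.setReg (2 * d + 4) (t.reg 0) with ht1
        obtain ⟨t2, q2, m2, k2⟩ := hinner i t1 hi (by simp [ht1, State.setReg_reg, t0]) j2
          (by rw [ht1, State.setReg_reg, if_neg (by omega), j3])
          (fun x hx => by
            rw [ht1, State.setReg_reg, if_neg (by omega), j4 _ (by omega) (by omega), hv])
          (by simp [ht1, State.setReg_reg, t0])
        have b2 : ∀ r, (r % 2 = 1 ∨ r < 2 * d + 4) → r ≠ 3 → t2.reg r = t.reg r := by
          intro r hr hr3
          rw [k2 r hr hr3, ht1, State.setReg_reg, if_neg (by omega)]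
        refine ⟨_, (runs_block_cons q1 (runs_block_cons q2 (runs_block_cons (runs_const _ _ _)
          (runs_block_cons (runs_const _ _ _) (runs_block_cons (runs_plus _ _ _ _)
          (runs_block_cons (runs_minus _ _ _ _) (runs_block_nil _))))))).mono (by omega),
          ?_, ?_, ?_, ?_⟩
        · simp only [State.setReg_reg, if_true]
          rw [if_neg (by omega), if_neg (by omega), if_neg (by omega),
            if_neg (by omega), b2 _ (by omega) (by omega), j1]
          omega
        · rw [← partialTab_row]
          exact m2
        · simp only [State.setReg_reg, if_true]
          rw [if_neg (by omega), if_neg (by omega), if_neg (by omega),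
            b2 1 (by omega) (by omega), j3]
        · intro r hr hr1
          simp only [State.setReg_reg]
          rw [if_neg (by omega), if_neg (by omega), if_neg (by omega)]
          split_ifs with h3
          · rw [h3, ← hv 1]
          · rw [b2 r (by omega) h3, j4 r hr hr1])
      s1 ⟨by simp [hs1, State.setReg_reg, h0], (partialTab_zero hA k e).symm ▸ hA, by
        rw [hs1, State.setReg_reg, if_neg (by omega)]; exact hv 0, fun r hr _ => by
        rw [hs1, State.setReg_reg, if_neg (by omega)]⟩
    refine ⟨_, (runs_block_cons r1 (runs_block_cons r2 (runs_block_cons (runs_const _ _ _)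
      (runs_block_nil _)))).mono (by simp [Stm.cost]; omega), ?_, ?_⟩
    · rw [← partialTab_end]
      exact i2
    · intro r hr
      rw [State.setReg_reg]
      split_ifs with h1
      · rw [h1, ← hv 0]
      · exact i4 r hr h1

/-! ### Input and output of array programs -/

/-- The arrays that hold the input word. -/
def inputArrays (w : List Bool) : Arrays := fun k i j =>
  if k = 0 ∧ i = 0 then (w.getD j false).toNat else 0

/-- As `N` is the length of the word, row `0` of array `0` occupies exactly the cells of the input.
All other addresses lie beyond its end, where the memory is `0`. -/
theorem memRep_input (w : List Bool) : MemRep w.length (inputArrays w) (initState w).mem := by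
  refine ⟨fun k i j hi hj => ?_, fun k i j h => ?_⟩
  · by_cases hk : k = 0 ∧ i = 0
    · obtain ⟨rfl, rfl⟩ := hk
      simp [inputArrays, initState]
    · have h1 : 1 ≤ k * w.length + i := by
        rcases Nat.eq_zero_or_pos i with h | h
        · have : 1 ≤ k := by omega
          have := Nat.mul_le_mul this (show 1 ≤ w.length by omega)
          omega
        · omega
      have h2 := Nat.mul_le_mul_right w.length h1
      rw [inputArrays, if_neg hk, initState]
      simp only
      rw [List.getD_eq_default _ _ (by omega)]
      rfl
  · by_cases hk : k = 0 ∧ i = 0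
    · obtain ⟨rfl, rfl⟩ := hk
      simp only [inputArrays, and_self, if_true]
      rcases Nat.eq_zero_or_pos w.length with h' | h'
      · rw [List.getD_eq_default _ _ (by omega)]
        rfl
      · rw [List.getD_eq_default _ _ (by omega)]
        rfl
    · rw [inputArrays, if_neg hk]

/-- A decision problem that is solved by an array program, with the answer in the entry `(0, 0)` of
the array `k`, is solvable in polynomial time. -/
theorem PolyTimeSolvableOn.of_stm {α : Type} {enc : α → List Bool} {Class Yes : α → Prop}
    (p : Stm) (hp : p.WF) (k : ℕ)
    (h : ∀ x, Class x → (Yes x → p.run (enc x).length (inputArrays (enc x)) k 0 0 = 1) ∧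
      (¬ Yes x → p.run (enc x).length (inputArrays (enc x)) k 0 0 = 0)) :
    PolyTimeSolvableOn enc Class Yes := by
  refine ⟨block [p.code 0, (Exp.arr k (.num 0) (.num 0)).code 0, .copy 0 2],
    p.cost + ((Exp.arr k (.num 0) (.num 0)).cost + 2), fun x hx => ?_⟩
  set w := enc x
  obtain ⟨s1, r1, m1, k1⟩ := runs_stm p hp 0 _ (initState w) (N := w.length) (by simp [initState])
    (memRep_input w) (fun y => by simp [initState])
  obtain ⟨s2, r2, m2, v2, k2⟩ := runs_exp (Exp.arr k (.num 0) (.num 0)) 0 (fun _ => 0) s1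
    (by rw [k1 0 (by omega)]; simp [initState]) m1
    (fun y => by rw [k1 _ (by omega)]; simp [initState])
  obtain ⟨t, ht, r⟩ := runs_block_cons r1 (runs_block_cons r2 (runs_block_cons
    (runs_copy s2 0 2) (runs_block_nil _)))
  have hval : (s2.setReg 0 (s2.reg 2)).reg 0 = p.run w.length (inputArrays w) k 0 0 := by
    rw [State.setReg_reg, if_pos rfl]
    exact v2
  refine ⟨t, _, r, ?_, ?_, ?_⟩
  · simpa using ht
  · rw [hval]; exact (h x hx).1
  · rw [hval]; exact (h x hx).2

/-! ### Minimum cuts -/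

/-! ### Truth values, counting, and least elements as sums -/

open Classical in
/-- The truth value of a proposition. -/
noncomputable def tr (p : Prop) : ℕ := if p then 1 else 0

@[simp] theorem tr_eq_zero {p : Prop} : tr p = 0 ↔ ¬ p := by
  by_cases h : p <;> simp [tr, h]

theorem tr_of_true {p : Prop} (h : p) : tr p = 1 := if_pos h

theorem tr_of_false {p : Prop} (h : ¬ p) : tr p = 0 := if_neg h

theorem tr_eq_ite (p : Prop) [Decidable p] : tr p = if p then 1 else 0 := by
  by_cases h : p <;> simp [tr, h]

open Classical in
/-- The number of elements of `range N` with the property `Q`. -/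
noncomputable def count (N : ℕ) (Q : ℕ → Prop) : ℕ := ((range N).filter Q).card

theorem sum_tr (N : ℕ) (Q : ℕ → Prop) : ∑ x ∈ range N, tr (Q x) = count N Q := by
  classical
  rw [count, card_filter]
  exact sum_congr rfl fun x _ => by by_cases h : Q x <;> simp [tr, h]

/-- The least number below `N` with the property `Q`, and `N` if there is none. -/
noncomputable def leastBelow (N : ℕ) (Q : ℕ → Prop) : ℕ :=
  ∑ x ∈ range N, tr (∀ y < N, y ≤ x → ¬ Q y)

/-- The numbers up to which `Q` has no witness are exactly those below the least witness, so their
number is that witness. In this form a search is a sum of truth values. -/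
theorem leastBelow_eq {N m : ℕ} {Q : ℕ → Prop} (hm : m < N) (hQ : Q m)
    (hmin : ∀ y < m, ¬ Q y) : leastBelow N Q = m := by
  classical
  have : (range N).filter (fun x => ∀ y < N, y ≤ x → ¬ Q y) = range m := by
    ext x
    simp only [mem_filter, mem_range]
    constructor
    · rintro ⟨hx, h'⟩
      by_contra hxm
      exact h' m hm (by omega) hQ
    · intro hx
      exact ⟨by omega, fun y hy hyx => hmin y (by omega)⟩
  rw [leastBelow, sum_tr, count]
  calc _ = ((range N).filter (fun x => ∀ y < N, y ≤ x → ¬ Q y)).card := by congr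
    _ = m := by rw [this, card_range]

theorem leastBelow_spec {N : ℕ} {Q : ℕ → Prop} (h : ∃ y < N, Q y) :
    leastBelow N Q < N ∧ Q (leastBelow N Q) := by
  classical
  have hm := Nat.find_spec h
  have : leastBelow N Q = Nat.find h := leastBelow_eq hm.1 hm.2 fun y hy hQ =>
    Nat.find_min h hy ⟨by omega, hQ⟩
  rw [this]
  exact hm

theorem exists_of_leastBelow_lt {N : ℕ} {Q : ℕ → Prop} (h : leastBelow N Q < N) :
    ∃ y < N, Q y := by
  classical
  by_contra hne
  push Not at hne
  have : leastBelow N Q = N := by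
    rw [leastBelow, sum_congr rfl (fun x hx => tr_of_true (fun y hy _ => hne y hy))]
    simp
  omega

/-! ### Augmenting paths with distance labels -/

/-- The state of the augmenting path algorithm: residual capacities, lower bounds for the distances
from the source, the position of the token that travels from the sink to the source, and the number
of its travels. -/
@[ext] structure Flow : Type where
  c : ℕ → ℕ → ℕ
  lab : ℕ → ℕ
  cur : ℕ
  cnt : ℕ

/-- A vertex from which the token can be reached by an admissible arc. -/
noncomputable def Flow.pred (N : ℕ) (f : Flow) : ℕ :=
  leastBelow N fun p => f.c p f.cur ≠ 0 ∧ f.lab p < f.lab f.cur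

/-- One step of the algorithm: restart the token, move it backwards along an arc, or increase the
label of its position. -/
noncomputable def Flow.step (N s t : ℕ) (f : Flow) : Flow :=
  if f.cur = s then { f with cur := t, cnt := f.cnt + 1 }
  else if f.pred N < N then
    { f with
      c := fun i j => f.c i j + (if i = f.cur ∧ j = f.pred N then 1 else 0) -
        (if i = f.pred N ∧ j = f.cur then 1 else 0)
      cur := f.pred N }
  else if f.lab f.cur < N then
    { f with lab := fun x => f.lab x + if x = f.cur then 1 else 0 }
  else f

/-- The capacity of the cut `X` in the graph on `range N`. -/
def cutCap (N : ℕ) (c : ℕ → ℕ → ℕ) (X : Finset ℕ) : ℕ := ∑ i ∈ X, ∑ j ∈ range N \ X, c i j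

theorem cutCap_add (N : ℕ) (c d : ℕ → ℕ → ℕ) (X : Finset ℕ) :
    cutCap N (fun i j => c i j + d i j) X = cutCap N c X + cutCap N d X := by
  simp only [cutCap, sum_add_distrib]

theorem cutCap_single {N a b : ℕ} (hb : b < N) (X : Finset ℕ) :
    cutCap N (fun i j => if i = a ∧ j = b then 1 else 0) X =
      if a ∈ X ∧ b ∉ X then 1 else 0 := by
  have h1 : ∀ i, ∑ j ∈ range N \ X, (if i = a ∧ j = b then 1 else 0) =
      if i = a then (if b ∉ X then 1 else 0) else 0 := by
    intro i
    by_cases hi : i = a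
    · simp [hi, hb]
    · simp [hi]
  simp only [cutCap, h1, sum_ite_eq']
  by_cases ha : a ∈ X <;> simp [ha]

/-- One unit of capacity from `p` to `q` is turned into one from `q` to `p`, which affects only cuts
that separate `p` and `q`. The hypothesis `hc` makes the truncated subtraction exact. -/
theorem cutCap_push {N p q : ℕ} {c : ℕ → ℕ → ℕ} (hp : p < N) (hq : q < N)
    (hc : c p q ≠ 0) (X : Finset ℕ) :
    cutCap N (fun i j => c i j + (if i = q ∧ j = p then 1 else 0) -
        (if i = p ∧ j = q then 1 else 0)) X + (if p ∈ X then 1 else 0) =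
      cutCap N c X + if q ∈ X then 1 else 0 := by
  have h1 := cutCap_add N (fun i j => c i j + (if i = q ∧ j = p then 1 else 0) -
        (if i = p ∧ j = q then 1 else 0)) (fun i j => if i = p ∧ j = q then 1 else 0) X
  have h2 := cutCap_add N c (fun i j => if i = q ∧ j = p then 1 else 0) X
  have h3 : (fun i j => c i j + (if i = q ∧ j = p then 1 else 0) -
        (if i = p ∧ j = q then 1 else 0) + (if i = p ∧ j = q then 1 else 0)) =
      fun i j => c i j + (if i = q ∧ j = p then 1 else 0) := by
    funext i j
    by_cases h : i = p ∧ j = q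
    · obtain ⟨rfl, rfl⟩ := h
      simp only [and_self, if_true]
      omega
    · simp [h]
  rw [h3, h2, cutCap_single hp, cutCap_single hq] at h1
  by_cases hpX : p ∈ X <;> by_cases hqX : q ∈ X <;> simp [hpX, hqX] at h1 ⊢ <;> omega

/-- The invariant of the algorithm, started with the capacities `c₀`. -/
structure Flow.Inv (N s t : ℕ) (c₀ : ℕ → ℕ → ℕ) (f : Flow) : Prop where
  cur_lt : f.cur < N
  lab_source : f.lab s = 0
  lab_le : ∀ x < N, f.lab x ≤ N
  valid : ∀ p < N, ∀ x < N, f.c p x ≠ 0 → f.lab x ≤ f.lab p + 1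
  cut : ∀ X ⊆ range N, s ∈ X →
    cutCap N f.c X + (if f.cur ∈ X then 1 else 0) + (if t ∈ X then 0 else f.cnt) =
      cutCap N c₀ X + if t ∈ X then 1 else 0

/-- The algorithm has come to a halt. -/
def Flow.Done (N s : ℕ) (f : Flow) : Prop := f.cur ≠ s ∧ f.lab f.cur = N

/-- A quantity that decreases in every step. -/
def Flow.measure (N s : ℕ) (f : Flow) : ℕ :=
  (N + 1) * (cutCap N f.c {s} + if f.cur = s then 1 else 0) +
    2 * ∑ x ∈ range N, (N - f.lab x) + f.lab f.cur

/-- The `cut` equation says that `cnt` units have gone from `s` to `t` and one more from the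
position of the token to `t`. As to `measure`: a restart lowers its first term by `N + 1` and raises
the label of the token by at most `N`; a move preserves the first term and lowers the label of the
token; a relabelling lowers twice the sum by two and raises the label of the token by one. -/
theorem Flow.step_spec {N s t : ℕ} {c₀ : ℕ → ℕ → ℕ} (ht : t < N) (hst : s ≠ t)
    {f : Flow} (hf : f.Inv N s t c₀) :
    (f.step N s t).Inv N s t c₀ ∧
      (f.Done N s ∧ f.step N s t = f ∨ (f.step N s t).measure N s < f.measure N s) := by
  by_cases h1 : f.cur = s
  · rw [Flow.step, if_pos h1]
    refine ⟨⟨ht, hf.lab_source, hf.lab_le, hf.valid, fun X hX hsX => ?_⟩, Or.inr ?_⟩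
    · have := hf.cut X hX hsX
      rw [h1] at this
      by_cases htX : t ∈ X <;> simp [htX, hsX] at this ⊢ <;> omega
    · have := hf.lab_le t ht
      simp only [Flow.measure, h1, hst.symm, if_true, if_false]
      rw [hf.lab_source]
      nlinarith
  by_cases h2 : f.pred N < N
  · have hp := leastBelow_spec (exists_of_leastBelow_lt h2)
    rw [Flow.step, if_neg h1, if_pos h2]
    change f.pred N < N ∧ f.c (f.pred N) f.cur ≠ 0 ∧ f.lab (f.pred N) < f.lab f.cur at hp
    set p := f.pred N
    have hpush := cutCap_push hp.1 hf.cur_lt hp.2.1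
    refine ⟨⟨hp.1, hf.lab_source, hf.lab_le, fun a ha x hx hc => ?_, fun X hX hsX => ?_⟩,
      Or.inr ?_⟩
    · simp only at hc ⊢
      by_cases h : a = f.cur ∧ x = p
      · rw [h.1, h.2]
        omega
      · apply hf.valid a ha x hx
        simp only [h, if_false] at hc
        omega
    · have e1 := hf.cut X hX hsX
      have e2 := hpush X
      simp only
      omega
    · have e := hpush {s}
      simp only [mem_singleton] at e
      simp only [Flow.measure]
      rw [e]
      omega
  have hno : ∀ p < N, f.c p f.cur ≠ 0 → f.lab f.cur ≤ f.lab p := by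
    intro p hp hc
    by_contra hlt
    exact h2 (leastBelow_spec ⟨p, hp, hc, by omega⟩).1
  by_cases h3 : f.lab f.cur < N
  · rw [Flow.step, if_neg h1, if_neg h2, if_pos h3]
    refine ⟨⟨hf.cur_lt, ?_, fun x hx => ?_, fun a ha x hx hc => ?_, hf.cut⟩, Or.inr ?_⟩
    · simp [hf.lab_source, Ne.symm h1]
    · simp only
      split_ifs with h
      · rw [h]; omega
      · exact hf.lab_le x hx
    · simp only at hc ⊢
      have := hf.valid a ha x hx hc
      by_cases hx' : x = f.cur
      · subst hx'
        have := hno a ha hc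
        simp only [if_true]
        omega
      · simp only [hx', if_false]
        omega
    · have e : ∑ x ∈ range N, (N - f.lab x) =
          ∑ x ∈ range N, (N - (f.lab x + if x = f.cur then 1 else 0)) + 1 := by
        have : ∑ x ∈ range N, (if x = f.cur then 1 else 0) = 1 := by
          simp [hf.cur_lt]
        rw [← this, ← sum_add_distrib]
        refine sum_congr rfl fun x hx => ?_
        by_cases h : x = f.cur
        · subst h
          simp only [if_true]
          omega
        · simp [h]
      simp only [Flow.measure]
      rw [e]
      simp only [if_true]
      omega
  · have : f.step N s t = f := by rw [Flow.step, if_neg h1, if_neg h2, if_neg h3]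
    rw [this]
    exact ⟨hf, Or.inl ⟨⟨h1, by have := hf.lab_le _ hf.cur_lt; omega⟩, rfl⟩⟩

/-- A halted state is a fixed point, so the number of iterations may be fixed in advance. -/
theorem Flow.iterate_spec {N s t : ℕ} {c₀ : ℕ → ℕ → ℕ} (ht : t < N) (hst : s ≠ t)
    (m : ℕ) {f : Flow} (hf : f.Inv N s t c₀) (hm : f.measure N s < m) :
    ((Flow.step N s t)^[m] f).Inv N s t c₀ ∧ ((Flow.step N s t)^[m] f).Done N s := by
  induction m generalizing f with
  | zero => omega
  | succ m ih =>
    rw [Function.iterate_succ_apply]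
    obtain ⟨h1, h2 | h2⟩ := Flow.step_spec ht hst hf
    · rw [h2.2]
      rw [Function.iterate_fixed h2.2]
      exact ⟨hf, h2.1⟩
    · exact ih h1 (by omega)

/-- The `N` vertices cannot take all of the labels `0, …, N`. If `g` is a label that is missed, no
residual arc leaves the set of vertices of label less than `g`, because labels increase by at most
one along residual arcs. The invariant for this set shows that its capacity is `cnt`; the invariant
for an arbitrary cut gives the inequality. -/
theorem Flow.min_cut {N s t : ℕ} {c₀ : ℕ → ℕ → ℕ} (hs : s < N) {f : Flow}
    (hf : f.Inv N s t c₀) (hd : f.Done N s) :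
    (∀ X ⊆ range N, s ∈ X → t ∉ X → f.cnt ≤ cutCap N c₀ X) ∧
      ∃ X ⊆ range N, s ∈ X ∧ t ∉ X ∧ cutCap N c₀ X = f.cnt := by
  constructor
  · intro X hX hsX htX
    have := hf.cut X hX hsX
    simp only [htX, if_false] at this
    omega
  · obtain ⟨g, hgN, hg⟩ : ∃ g ≤ N, ∀ x < N, f.lab x ≠ g := by
      by_contra hcon
      push Not at hcon
      have : range (N + 1) ⊆ (range N).image f.lab := by
        intro g hg
        obtain ⟨x, hx, hxg⟩ := hcon g (by simpa [Nat.lt_succ_iff] using hg)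
        exact mem_image.2 ⟨x, mem_range.2 hx, hxg⟩
      have := (card_le_card this).trans card_image_le
      simp at this
    have hgs := hg s hs
    have hgc := hg _ hf.cur_lt
    rw [hf.lab_source] at hgs
    rw [hd.2] at hgc
    set X := (range N).filter fun x => f.lab x < g with hX
    have hsX : s ∈ X := by
      simp only [hX, mem_filter, mem_range, hf.lab_source]
      omega
    have hcX : f.cur ∉ X := by
      simp only [hX, mem_filter, hd.2]
      omega
    have hout : cutCap N f.c X = 0 := by
      refine sum_eq_zero fun i hi => sum_eq_zero fun j hj => ?_
      simp only [hX, mem_filter, mem_sdiff, mem_range, not_and] at hi hj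
      by_contra hne
      have := hf.valid i hi.1 j hj.1 hne
      have := hg j hj.1
      have := hj.2 hj.1
      omega
    have hcut := hf.cut X (filter_subset _ _) hsX
    rw [hout, if_neg hcX] at hcut
    -- With `t ∈ X` the invariant would read `0 = cutCap N c₀ X + 1`.
    by_cases htX : t ∈ X
    · simp only [htX, if_true] at hcut
      omega
    · simp only [htX, if_false] at hcut
      exact ⟨X, filter_subset _ _, hsX, htX, by omega⟩

/-- The initial state of the algorithm. -/
def Flow.init (t : ℕ) (c₀ : ℕ → ℕ → ℕ) : Flow := ⟨c₀, fun _ => 0, t, 0⟩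

theorem Flow.init_inv {N s t : ℕ} {c₀ : ℕ → ℕ → ℕ} (ht : t < N) :
    (Flow.init t c₀).Inv N s t c₀ := by
  refine ⟨ht, rfl, fun x hx => Nat.zero_le _, fun p hp x hx h => by simp [Flow.init], ?_⟩
  intro X hX hsX
  by_cases htX : t ∈ X <;> simp [Flow.init, htX]

theorem Flow.run_spec {N s t : ℕ} {c₀ : ℕ → ℕ → ℕ} (hs : s < N) (ht : t < N) (hst : s ≠ t)
    (hc : ∀ i < N, ∀ j < N, c₀ i j ≤ N) :
    (∀ X ⊆ range N, s ∈ X → t ∉ X →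
      ((Flow.step N s t)^[N ^ 5] (Flow.init t c₀)).cnt ≤ cutCap N c₀ X) ∧
      ∃ X ⊆ range N, s ∈ X ∧ t ∉ X ∧
        cutCap N c₀ X = ((Flow.step N s t)^[N ^ 5] (Flow.init t c₀)).cnt := by
  have h0 : (Flow.init t c₀).Inv N s t c₀ := Flow.init_inv ht
  have hm : (Flow.init t c₀).measure N s < N ^ 5 := by
    have h1 : cutCap N c₀ {s} ≤ N * N := by
      rw [cutCap, sum_singleton]
      calc ∑ j ∈ range N \ {s}, c₀ s j ≤ ∑ j ∈ range N \ {s}, N :=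
            sum_le_sum fun j hj => hc s hs j (mem_range.1 (mem_sdiff.1 hj).1)
        _ ≤ ∑ j ∈ range N, N := sum_le_sum_of_subset sdiff_subset
        _ = N * N := by simp
    have h2 : (Flow.init t c₀).measure N s = (N + 1) * cutCap N c₀ {s} + 2 * (N * N) := by
      simp [Flow.measure, Flow.init, hst.symm]
    rw [h2]
    have hN : 2 ≤ N := by omega
    have h3 : (N + 1) * cutCap N c₀ {s} ≤ (N + 1) * (N * N) := Nat.mul_le_mul_left _ h1
    -- The initial measure is at most `(N + 3) * N ^ 2`, and `N + 3 < 4 * N ≤ N ^ 3` because `s ≠ t`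
    -- forces `2 ≤ N`. The exponent `5` becomes the number of nested repetitions in the program.
    have h4 : (N + 3) * (N * N) < N ^ 5 := by
      have h5 : 4 * N ≤ N ^ 3 := by nlinarith [Nat.mul_le_mul hN hN]
      have h6 : 0 < N * N := by positivity
      calc (N + 3) * (N * N) < N ^ 3 * (N * N) := by
            apply Nat.mul_lt_mul_of_pos_right _ h6
            omega
        _ = N ^ 5 := by ring
    nlinarith
  obtain ⟨h1, h2⟩ := Flow.iterate_spec ht hst (N ^ 5) h0 hm
  exact Flow.min_cut hs h1 h2

/-! ### Graphs with a deletion set of two vertices -/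

section

variable (G : SimpleGraph ℕ) (P : ℕ → ℕ → Prop) (u v : ℕ)

/-- `x` and `y` are adjacent in `G - {u, v}`. -/
def Mate (x y : ℕ) : Prop := x ≠ u ∧ x ≠ v ∧ y ≠ u ∧ y ≠ v ∧ G.Adj x y

/-- `x` is paired with a vertex other than its mate. -/
def Outer (x : ℕ) : Prop := ∃ y, P x y ∧ ¬ Mate G u v x y

/-- `x` has to be connected to `u` or `v` in every Steiner forest. -/
def Req (x : ℕ) : Prop :=
  x ≠ u ∧ x ≠ v ∧ (Outer G P u v x ∨ ∃ y, Mate G u v x y ∧ P x y ∧ Outer G P u v y)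

/-- `x` is the smaller vertex of a pair of mates that need not be connected to `u` or `v`. -/
def InnerPair (x : ℕ) : Prop := ∃ y, x < y ∧ Mate G u v x y ∧ P x y ∧ ¬ Req G P u v x

/-- `G` is a graph on `range N` with pairs `P`, and the components of `G - {u, v}` have at most two
vertices. -/
structure Setting (N : ℕ) : Prop where
  ne : u ≠ v
  u_lt : u < N
  v_lt : v < N
  adj_lt : ∀ x y, G.Adj x y → x < N
  pair_symm : ∀ x y, P x y → P y x
  pair_ne : ∀ x y, P x y → x ≠ y
  pair_lt : ∀ x y, P x y → x < N
  mate_unique : ∀ x y z, Mate G u v x y → Mate G u v x z → y = z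

open Classical in
/-- The mate of a vertex. -/
noncomputable def mate (x : ℕ) : ℕ := if h : ∃ y, Mate G u v x y then h.choose else x

/-- `x` is connected to `u` or `v` by a path of `H` in its component of `G - {u, v}`. -/
def Loc (H : SimpleGraph ℕ) (x : ℕ) : Prop :=
  x ≠ u ∧ x ≠ v ∧ (H.Adj x u ∨ H.Adj x v ∨
    ∃ y, Mate G u v x y ∧ H.Adj x y ∧ (H.Adj y u ∨ H.Adj y v))

open Classical in
/-- The first edge on the way from `x` to `u` or `v`. -/
noncomputable def parentEdge (H : SimpleGraph ℕ) (x : ℕ) : Sym2 ℕ :=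
  if H.Adj x u then s(x, u) else if H.Adj x v then s(x, v) else s(x, mate G u v x)

end

section

variable {G : SimpleGraph ℕ} {P : ℕ → ℕ → Prop} {u v N : ℕ}

theorem Mate.symm {x y : ℕ} (h : Mate G u v x y) : Mate G u v y x :=
  ⟨h.2.2.1, h.2.2.2.1, h.1, h.2.1, h.2.2.2.2.symm⟩

theorem Setting.mate_eq (hS : Setting G P u v N) {x y : ℕ} (h : Mate G u v x y) :
    mate G u v x = y := by
  have hx : ∃ y, Mate G u v x y := ⟨y, h⟩
  rw [mate, dif_pos hx]
  exact hS.mate_unique x _ _ hx.choose_spec h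

/-- The two alternatives in `Req` are interchanged on passing to a mate with which the vertex is
paired. -/
theorem Setting.req_mate (hS : Setting G P u v N) {x y : ℕ} (h : Mate G u v x y) (hp : P x y)
    (hx : Req G P u v x) : Req G P u v y := by
  refine ⟨h.2.2.1, h.2.2.2.1, ?_⟩
  rcases hx.2.2 with h1 | ⟨z, hz, -, h1⟩
  · exact Or.inr ⟨x, h.symm, hS.pair_symm _ _ hp, h1⟩
  · rw [hS.mate_unique x z y hz h] at h1
    exact Or.inl h1

theorem Setting.req_of_not_mate {x y : ℕ} (hp : P x y)
    (h : ¬ Mate G u v x y) : x = u ∨ x = v ∨ Req G P u v x := by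
  by_cases h1 : x = u
  · exact Or.inl h1
  by_cases h2 : x = v
  · exact Or.inr (Or.inl h2)
  exact Or.inr (Or.inr ⟨h1, h2, Or.inl ⟨y, hp, h⟩⟩)

theorem Setting.req_lt (hS : Setting G P u v N) {x : ℕ} (h : Req G P u v x) : x < N := by
  rcases h.2.2 with ⟨y, hy, -⟩ | ⟨y, -, hy, -⟩ <;> exact hS.pair_lt _ _ hy

theorem mem_of_reachable {H : SimpleGraph ℕ} {Y : Set ℕ}
    (hY : ∀ x y, x ∈ Y → H.Adj x y → y ∈ Y) {a b : ℕ} (h : H.Reachable a b) (ha : a ∈ Y) :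
    b ∈ Y := by
  obtain ⟨w⟩ := h
  induction w with
  | nil => exact ha
  | cons h _ ih => exact ih (hY _ _ ha h)

/-! ### Lower bounds -/

/-- If `x` is not attached, then `x` together with its mate, if `H` joins them, is closed under
adjacency in `H`, so that `x` reaches nothing else. -/
theorem Setting.loc_of_reachable (hS : Setting G P u v N) {H : SimpleGraph ℕ} (hH : H ≤ G)
    {x y : ℕ} (hxu : x ≠ u) (hxv : x ≠ v) (h : H.Reachable x y) (hxy : x ≠ y)
    (hm : ¬ Mate G u v x y) : Loc G u v H x := by
  by_contra hloc
  have hloc' : ∀ w, H.Adj x w → Mate G u v x w := by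
    intro w hw
    refine ⟨hxu, hxv, ?_, ?_, hH hw⟩
    · rintro rfl
      exact hloc ⟨hxu, hxv, Or.inl hw⟩
    · rintro rfl
      exact hloc ⟨hxu, hxv, Or.inr (Or.inl hw)⟩
  have := mem_of_reachable (Y := {z | z = x ∨ Mate G u v x z ∧ H.Adj x z}) (by
    rintro z w (rfl | ⟨hz, hz'⟩) hw
    · exact Or.inr ⟨hloc' w hw, hw⟩
    · have h1 : w ≠ u := by
        rintro rfl
        exact hloc ⟨hxu, hxv, Or.inr (Or.inr ⟨z, hz, hz', Or.inl hw⟩)⟩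
      have h2 : w ≠ v := by
        rintro rfl
        exact hloc ⟨hxu, hxv, Or.inr (Or.inr ⟨z, hz, hz', Or.inr hw⟩)⟩
      have h3 : Mate G u v z w := ⟨hz.2.2.1, hz.2.2.2.1, h1, h2, hH hw⟩
      exact Or.inl (hS.mate_unique z w x h3 hz.symm)) h (Or.inl rfl)
  rcases this with h1 | h1
  · exact hxy h1.symm
  · exact hm h1.1

/-- In the second case of `Req` the forest leads from `x` through its mate `y` to a vertex `z`
paired with `y`, and `z` is neither `x` nor `y`. So `x` reaches a vertex outside of its component in
both cases. -/
theorem Setting.loc_of_req (hS : Setting G P u v N) {H : SimpleGraph ℕ} (hH : H ≤ G)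
    (hP : ∀ x y, P x y → H.Reachable x y) {x : ℕ} (hx : Req G P u v x) : Loc G u v H x := by
  obtain ⟨h1, h2, ⟨y, hy, hm⟩ | ⟨y, hm, hy, z, hz, hm'⟩⟩ := hx
  · exact hS.loc_of_reachable hH h1 h2 (hP x y hy) (hS.pair_ne _ _ hy) hm
  · by_cases hxz : x = z
    · subst hxz
      exact absurd hm.symm hm'
    · refine hS.loc_of_reachable hH h1 h2 ((hP x y hy).trans (hP y z hz)) hxz fun h => ?_
      exact hS.pair_ne _ _ hz (hS.mate_unique x y z hm h)

theorem Setting.adj_or_loc (hS : Setting G P u v N) {H : SimpleGraph ℕ} (hH : H ≤ G)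
    {x y : ℕ} (hm : Mate G u v x y) (h : H.Reachable x y) : H.Adj x y ∨ Loc G u v H x := by
  by_contra hcon
  push Not at hcon
  have := mem_of_reachable (Y := {x}) (by
    rintro z w rfl hw
    exfalso
    have h1 : w ≠ u := by
      rintro rfl
      exact hcon.2 ⟨hm.1, hm.2.1, Or.inl hw⟩
    have h2 : w ≠ v := by
      rintro rfl
      exact hcon.2 ⟨hm.1, hm.2.1, Or.inr (Or.inl hw)⟩
    have := hS.mate_unique _ _ _ ⟨hm.1, hm.2.1, h1, h2, hH hw⟩ hm
    subst this
    exact hcon.1 hw) h rfl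
  have h' : y = x := this
  subst h'
  exact G.loopless.irrefl _ hm.2.2.2.2

theorem Loc.of_adj {H : SimpleGraph ℕ} {x y : ℕ} (hS : Setting G P u v N)
    (hm : Mate G u v x y) (h : H.Adj x y) (hx : Loc G u v H x) : Loc G u v H y := by
  refine ⟨hm.2.2.1, hm.2.2.2.1, ?_⟩
  rcases hx.2.2 with h1 | h1 | ⟨z, hz, -, h1⟩
  · exact Or.inr (Or.inr ⟨x, hm.symm, h.symm, Or.inl h1⟩)
  · exact Or.inr (Or.inr ⟨x, hm.symm, h.symm, Or.inr h1⟩)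
  · rw [hS.mate_unique x z y hz hm] at h1
    rcases h1 with h1 | h1
    · exact Or.inl h1
    · exact Or.inr (Or.inl h1)

theorem Setting.loc_mate (hS : Setting G P u v N) {H : SimpleGraph ℕ} (hH : H ≤ G)
    {x y : ℕ} (hm : Mate G u v x y) (h : H.Reachable x y) (hx : Loc G u v H x) :
    Loc G u v H y := by
  rcases hS.adj_or_loc hH hm.symm h.symm with h1 | h1
  · exact hx.of_adj hS hm h1.symm
  · exact h1

theorem Setting.parentEdge_cases (hS : Setting G P u v N) {H : SimpleGraph ℕ} {x : ℕ}
    (hx : Loc G u v H x) :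
    parentEdge G u v H x = s(x, u) ∧ H.Adj x u ∨
      parentEdge G u v H x = s(x, v) ∧ H.Adj x v ∧ ¬ H.Adj x u ∨
      ∃ y, parentEdge G u v H x = s(x, y) ∧ Mate G u v x y ∧ H.Adj x y ∧
        (H.Adj y u ∨ H.Adj y v) ∧ ¬ H.Adj x u ∧ ¬ H.Adj x v := by
  by_cases h1 : H.Adj x u
  · exact Or.inl ⟨by rw [parentEdge, if_pos h1], h1⟩
  by_cases h2 : H.Adj x v
  · exact Or.inr (Or.inl ⟨by rw [parentEdge, if_neg h1, if_pos h2], h2, h1⟩)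
  rcases hx.2.2 with h | h | ⟨y, hm, h, h'⟩
  · exact absurd h h1
  · exact absurd h h2
  · exact Or.inr (Or.inr ⟨y, by rw [parentEdge, if_neg h1, if_neg h2, hS.mate_eq hm],
      hm, h, h', h1, h2⟩)

theorem Setting.parentEdge_mem (hS : Setting G P u v N) {H : SimpleGraph ℕ} {x : ℕ}
    (hx : Loc G u v H x) : parentEdge G u v H x ∈ H.edgeSet := by
  rcases hS.parentEdge_cases hx with ⟨h, h'⟩ | ⟨h, h', -⟩ | ⟨y, h, -, h', -⟩ <;> rw [h] <;>
    exact h'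

theorem Setting.mem_parentEdge (hS : Setting G P u v N) {H : SimpleGraph ℕ} {x : ℕ}
    (hx : Loc G u v H x) : x ∈ parentEdge G u v H x := by
  rcases hS.parentEdge_cases hx with ⟨h, -⟩ | ⟨h, -⟩ | ⟨y, h, -⟩ <;> rw [h] <;> simp

theorem Setting.eq_or_of_mem_parentEdge (hS : Setting G P u v N) {H : SimpleGraph ℕ} {x y : ℕ}
    (hx : Loc G u v H x) (hy : Loc G u v H y) (h : x ∈ parentEdge G u v H y) :
    x = y ∨ ((H.Adj x u ∨ H.Adj x v) ∧ ¬ H.Adj y u ∧ ¬ H.Adj y v) := by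
  rcases hS.parentEdge_cases hy with ⟨e, -⟩ | ⟨e, -⟩ | ⟨z, e, -, -, a, n⟩ <;>
    rw [e, Sym2.mem_iff] at h <;> rcases h with h | h
  · exact Or.inl h
  · exact absurd h hx.1
  · exact Or.inl h
  · exact absurd h hx.2.1
  · exact Or.inl h
  · exact Or.inr ⟨h ▸ a, n⟩

/-- A parent edge leads to `u` or `v`, or from a vertex adjacent to neither of them in `H` to a mate
that is adjacent to one of them. If two vertices shared a parent edge, it would have to lead from
each to the other. -/
theorem Setting.parentEdge_injective (hS : Setting G P u v N) {H : SimpleGraph ℕ} {x y : ℕ}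
    (hx : Loc G u v H x) (hy : Loc G u v H y)
    (h : parentEdge G u v H x = parentEdge G u v H y) : x = y := by
  rcases hS.eq_or_of_mem_parentEdge hx hy (h ▸ hS.mem_parentEdge hx) with h1 | ⟨h1, -⟩
  · exact h1
  rcases hS.eq_or_of_mem_parentEdge hy hx (h ▸ hS.mem_parentEdge hy) with h2 | ⟨-, h2, h3⟩
  · exact h2.symm
  exact absurd h1 (by tauto)

/-- The edges counted by `Z` and `D` are distinct: a parent edge contains an attached vertex,
whereas an edge of `D` joins two unattached ones, since attachment passes along an edge of `H`
between mates. -/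
theorem Setting.card_le_edges (hS : Setting G P u v N) {H : SimpleGraph ℕ}
    (hfin : H.edgeSet.Finite) (Z D : Finset ℕ) (X : Finset (Sym2 ℕ))
    (hZ : ∀ x ∈ Z, Loc G u v H x)
    (hD : ∀ x ∈ D, ¬ Loc G u v H x ∧ ∃ y, x < y ∧ Mate G u v x y ∧ H.Adj x y)
    (hX : ∀ e ∈ X, e ∈ H.edgeSet ∧ (∀ x, Loc G u v H x → parentEdge G u v H x ≠ e) ∧
      ∀ x y, ¬ Loc G u v H x → Mate G u v x y → s(x, y) ≠ e) :
    Z.card + D.card + X.card ≤ H.edgeSet.ncard := by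
  classical
  have hE1 : (Z.image (parentEdge G u v H)).card = Z.card :=
    card_image_of_injOn fun x hx y hy h => hS.parentEdge_injective (hZ x hx) (hZ y hy) h
  have hE2 : (D.image fun x => s(x, mate G u v x)).card = D.card := by
    refine card_image_of_injOn fun x hx y hy h => ?_
    obtain ⟨-, x', h1, h2, -⟩ := hD x hx
    obtain ⟨-, y', h3, h4, -⟩ := hD y hy
    simp only [hS.mate_eq h2, hS.mate_eq h4, Sym2.eq_iff] at h
    omega
  have hd1 : Disjoint (Z.image (parentEdge G u v H)) (D.image fun x => s(x, mate G u v x)) := by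
    rw [disjoint_left]
    intro e he he'
    obtain ⟨z, hz, rfl⟩ := mem_image.1 he
    obtain ⟨x, hx, hxe⟩ := mem_image.1 he'
    obtain ⟨hn, y, -, hm, ha⟩ := hD x hx
    rw [hS.mate_eq hm] at hxe
    have hz' := hZ z hz
    have hn' : ¬ Loc G u v H y := fun hy => hn (hy.of_adj hS hm.symm ha.symm)
    have hmem := hS.mem_parentEdge hz'
    rw [← hxe, Sym2.mem_iff] at hmem
    rcases hmem with rfl | rfl
    · exact hn hz'
    · exact hn' hz'
  have hd2 : Disjoint (Z.image (parentEdge G u v H) ∪ D.image fun x => s(x, mate G u v x)) X := by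
    rw [disjoint_left]
    intro e he heX
    obtain ⟨-, h1, h2⟩ := hX e heX
    rcases mem_union.1 he with he | he
    · obtain ⟨z, hz, hze⟩ := mem_image.1 he
      exact h1 z (hZ z hz) hze
    · obtain ⟨x, hx, hxe⟩ := mem_image.1 he
      obtain ⟨hn, y, -, hm, -⟩ := hD x hx
      rw [hS.mate_eq hm] at hxe
      exact h2 x y hn hm hxe
  rw [← hE1, ← hE2, ← card_union_of_disjoint hd1, ← card_union_of_disjoint hd2,
    ← Set.ncard_coe_finset]
  refine Set.ncard_le_ncard (fun e he => ?_) hfin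
  rcases mem_union.1 (mem_coe.1 he) with he | he
  · rcases mem_union.1 he with he | he
    · obtain ⟨z, hz, rfl⟩ := mem_image.1 he
      exact hS.parentEdge_mem (hZ z hz)
    · obtain ⟨x, hx, rfl⟩ := mem_image.1 he
      obtain ⟨hn, y, -, hm, ha⟩ := hD x hx
      rw [hS.mate_eq hm]
      exact ha
  · exact (hX e he).1

/-- A pair of `D` that is not attached is joined by its own edge. Otherwise both of its vertices are
attached, and `rep x`, which is outside of `B`, contributes its parent edge. -/
theorem Setting.card_add_card_pairs_le_edges (hS : Setting G P u v N) {H : SimpleGraph ℕ}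
    (hH : H ≤ G) (hP : ∀ x y, P x y → H.Reachable x y) (hfin : H.edgeSet.Finite)
    (B D : Finset ℕ) (X : Finset (Sym2 ℕ)) (rep : ℕ → ℕ)
    (hB : ∀ x ∈ B, Loc G u v H x)
    (hD : ∀ x ∈ D, ∃ y, x < y ∧ Mate G u v x y ∧ P x y ∧ (rep x = x ∨ rep x = y) ∧ rep x ∉ B)
    (hX : ∀ e ∈ X, e ∈ H.edgeSet ∧ (∀ x, Loc G u v H x → parentEdge G u v H x ≠ e) ∧
      ∀ x y, ¬ Loc G u v H x → Mate G u v x y → s(x, y) ≠ e) :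
    B.card + D.card + X.card ≤ H.edgeSet.ncard := by
  classical
  have key := hS.card_le_edges hfin (B ∪ (D.filter fun x => Loc G u v H x).image rep)
    (D.filter fun x => ¬ Loc G u v H x) X (fun x hx => by
      rcases mem_union.1 hx with hx | hx
      · exact hB x hx
      · obtain ⟨z, hz, rfl⟩ := mem_image.1 hx
        obtain ⟨hz, hl⟩ := mem_filter.1 hz
        obtain ⟨y, -, hm, hp, h | h, -⟩ := hD z hz
        · rw [h]; exact hl
        · rw [h]; exact hS.loc_mate hH hm (hP _ _ hp) hl)
    (fun x hx => by
      obtain ⟨hx, hl⟩ := mem_filter.1 hx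
      obtain ⟨y, hxy, hm, hp, -⟩ := hD x hx
      refine ⟨hl, y, hxy, hm, ?_⟩
      rcases hS.adj_or_loc hH hm (hP _ _ hp) with h | h
      · exact h
      · exact absurd h hl) hX
  rw [card_union_of_disjoint, card_image_of_injOn] at key
  · have := card_filter_add_card_filter_not (s := D) (fun x => Loc G u v H x)
    omega
  · intro x hx y hy h
    obtain ⟨x', h1, h2, -, h3, -⟩ := hD x (mem_filter.1 hx).1
    obtain ⟨y', h4, h5, -, h6, -⟩ := hD y (mem_filter.1 hy).1
    rcases h3 with h3 | h3 <;> rcases h6 with h6 | h6 <;> simp only [h3, h6] at h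
    · exact h
    · subst h
      have := hS.mate_unique _ _ _ h5.symm h2
      omega
    · subst h
      have := hS.mate_unique _ _ _ h2.symm h5
      omega
    · subst h
      exact hS.mate_unique _ _ _ h2.symm h5.symm
  · rw [disjoint_left]
    intro x hx hx'
    obtain ⟨z, hz, rfl⟩ := mem_image.1 hx'
    obtain ⟨y, -, -, -, -, h⟩ := hD z (mem_filter.1 hz).1
    exact h hx

/-! ### Upper bounds -/

/-- This is the converse of the counting of parent edges. Each `z` pays for one edge: the one to its
target `L z`, or the one to a mate in `Z` that has the same target and is adjacent to it. -/
theorem Setting.exists_subgraph (hS : Setting G P u v N) (Z D : Finset ℕ) (X : Finset (Sym2 ℕ))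
    (L : ℕ → ℕ)
    (hZ : ∀ z ∈ Z, G.Adj z (L z) ∨ ∃ y ∈ Z, Mate G u v z y ∧ L y = L z ∧ G.Adj y (L y))
    (hD : ∀ x ∈ D, ∃ y, Mate G u v x y) (hX : ∀ e ∈ X, e ∈ G.edgeSet) :
    ∃ H ≤ G, H.edgeSet.ncard ≤ Z.card + D.card + X.card ∧ (∀ z ∈ Z, H.Reachable z (L z)) ∧
      (∀ x ∈ D, ∀ y, Mate G u v x y → H.Adj x y) ∧ ∀ e ∈ X, e ∈ H.edgeSet := by
  classical
  let par : ℕ → Sym2 ℕ := fun z => if G.Adj z (L z) then s(z, L z) else s(z, mate G u v z)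
  let E : Finset (Sym2 ℕ) := Z.image par ∪ D.image (fun x => s(x, mate G u v x)) ∪ X
  have hEG : ∀ e ∈ E, e ∈ G.edgeSet := by
    intro e he
    rcases mem_union.1 he with he | he
    · rcases mem_union.1 he with he | he
      · obtain ⟨z, hz, rfl⟩ := mem_image.1 he
        by_cases h : G.Adj z (L z)
        · simp only [par, if_pos h]
          exact h
        · obtain ⟨y, -, hm, -⟩ := (hZ z hz).resolve_left h
          simp only [par, if_neg h, hS.mate_eq hm]
          exact hm.2.2.2.2
      · obtain ⟨x, hx, rfl⟩ := mem_image.1 he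
        obtain ⟨y, hm⟩ := hD x hx
        rw [hS.mate_eq hm]
        exact hm.2.2.2.2
    · exact hX e he
  have hset : (SimpleGraph.fromEdgeSet (E : Set (Sym2 ℕ))).edgeSet = E := by
    rw [SimpleGraph.edgeSet_fromEdgeSet, sdiff_eq_left, Set.disjoint_left]
    intro e he hd
    exact G.not_isDiag_of_mem_edgeSet (hEG e he) hd
  have hpar : ∀ z ∈ Z, par z ∈ (SimpleGraph.fromEdgeSet (E : Set (Sym2 ℕ))).edgeSet := by
    intro z hz
    rw [hset]
    exact mem_coe.2 (mem_union_left _ (mem_union_left _ (mem_image_of_mem _ hz)))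
  have hdir : ∀ z ∈ Z, G.Adj z (L z) →
      (SimpleGraph.fromEdgeSet (E : Set (Sym2 ℕ))).Reachable z (L z) := by
    intro z hz h
    have := hpar z hz
    simp only [par, if_pos h] at this
    exact SimpleGraph.Adj.reachable this
  refine ⟨SimpleGraph.fromEdgeSet E, ?_, ?_, ?_, ?_, ?_⟩
  · rw [← SimpleGraph.edgeSet_subset_edgeSet, hset]
    exact fun e he => hEG e he
  · rw [hset, Set.ncard_coe_finset]
    refine (card_union_le _ _).trans (Nat.add_le_add_right ((card_union_le _ _).trans
      (Nat.add_le_add card_image_le card_image_le)) _)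
  · intro z hz
    by_cases h : G.Adj z (L z)
    · exact hdir z hz h
    · obtain ⟨y, hy, hm, hL, ha⟩ := (hZ z hz).resolve_left h
      have h1 := hpar z hz
      simp only [par, if_neg h, hS.mate_eq hm] at h1
      have h2 := hdir y hy ha
      rw [hL] at h2
      exact (SimpleGraph.Adj.reachable h1).trans h2
  · intro x hx y hm
    have : s(x, y) ∈ (SimpleGraph.fromEdgeSet (E : Set (Sym2 ℕ))).edgeSet := by
      rw [hset]
      refine mem_coe.2 (mem_union_left _ (mem_union_right _ (mem_image.2 ⟨x, hx, ?_⟩)))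
      rw [hS.mate_eq hm]
    exact this
  · intro e he
    rw [hset]
    exact mem_coe.2 (mem_union_right _ he)

end

/-! ### Steiner forests that connect the two vertices of the deletion set -/

section

variable (G : SimpleGraph ℕ) (P : ℕ → ℕ → Prop) (u v : ℕ)

/-- Every vertex that has to be connected to `u` or `v` can be. -/
def Attachable : Prop := ∀ x, Req G P u v x →
  G.Adj x u ∨ G.Adj x v ∨ ∃ y, Mate G u v x y ∧ (G.Adj y u ∨ G.Adj y v)

/-- `u, a, b, v` is a walk, up to repetitions. -/
def Bridge (a b : ℕ) : Prop := (a = u ∨ G.Adj a u) ∧ (a = b ∨ Mate G u v a b) ∧ G.Adj b v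

/-- `x` is an inner vertex of the path given by `a` and `b`. -/
def OnBridge (a b x : ℕ) : Prop := x ≠ u ∧ (x = a ∨ x = b)

/-- The vertex `y` has to be used to connect its mate. -/
def Helper (y : ℕ) : Prop := ¬ Req G P u v y ∧
  ∃ x, Mate G u v y x ∧ Req G P u v x ∧ ¬ G.Adj x u ∧ ¬ G.Adj x v

/-- The vertices other than `u` and `v` of the component of `u` and `v`. -/
def JoinVert (a b x : ℕ) : Prop := Req G P u v x ∨ Helper G P u v x ∨ OnBridge u a b x

/-- The pairs of mates that are connected separately. -/
def JoinPair (a b x : ℕ) : Prop :=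
  ∃ y, x < y ∧ Mate G u v x y ∧ P x y ∧ ¬ Req G P u v x ∧
    ¬ (OnBridge u a b x ∧ OnBridge u a b y)

end

section

variable {G : SimpleGraph ℕ} {P : ℕ → ℕ → Prop} {u v N : ℕ}

theorem Setting.mate_lt (hS : Setting G P u v N) {x y : ℕ} (h : Mate G u v x y) : x < N :=
  hS.adj_lt _ _ h.2.2.2.2

/-- The three shapes are the edge `uv`, encoded by `a = b = u`, a common neighbour `a = b`, and two
mates. -/
theorem Bridge.cases {a b : ℕ} (hS : Setting G P u v N) (h : Bridge G u v a b) :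
    a = u ∧ b = u ∧ G.Adj u v ∨ a ≠ u ∧ a ≠ v ∧ a = b ∧ G.Adj a u ∧ G.Adj a v ∨
      Mate G u v a b ∧ G.Adj a u ∧ G.Adj b v := by
  obtain ⟨h1, h2, h3⟩ := h
  rcases h2 with rfl | h2
  · rcases h1 with rfl | h1
    · exact Or.inl ⟨rfl, rfl, h3⟩
    · exact Or.inr (Or.inl ⟨h1.ne, h3.ne, rfl, h1, h3⟩)
  · rcases h1 with rfl | h1
    · exact absurd rfl h2.1
    · exact Or.inr (Or.inr ⟨h2, h1, h3⟩)

/-- Otherwise `u`, its neighbours in `H`, and the mates of these to which `H` joins them would form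
a set that is closed under adjacency in `H` and misses `v`. -/
theorem Setting.exists_bridge (hS : Setting G P u v N) {H : SimpleGraph ℕ} (hH : H ≤ G)
    (h : H.Reachable u v) :
    ∃ a b, Bridge G u v a b ∧ (a = b ∨ H.Adj a b) ∧ (a = u ∨ H.Adj a u) ∧ H.Adj b v := by
  by_contra hcon
  push Not at hcon
  have huv : ¬ H.Adj u v := fun h' =>
    hcon u u ⟨Or.inl rfl, Or.inl rfl, hH h'⟩ (Or.inl rfl) (Or.inl rfl) h'
  have := mem_of_reachable (H := H)
    (Y := {x | x ≠ v ∧ (x = u ∨ H.Adj x u ∨ ∃ z, Mate G u v z x ∧ H.Adj z x ∧ H.Adj z u)}) (by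
    rintro x y ⟨hxv, hx⟩ hxy
    have hyv : y ≠ v := by
      rintro rfl
      rcases hx with rfl | hx | ⟨z, hm, hzx, hz⟩
      · exact huv hxy
      · exact hcon x x ⟨Or.inr (hH hx), Or.inl rfl, hH hxy⟩ (Or.inl rfl) (Or.inr hx) hxy
      · exact hcon z x ⟨Or.inr (hH hz), Or.inr hm, hH hxy⟩ (Or.inr hzx) (Or.inr hz) hxy
    refine ⟨hyv, ?_⟩
    by_cases hyu : y = u
    · exact Or.inl hyu
    rcases hx with rfl | hx | ⟨z, hm, hzx, hz⟩
    · exact Or.inr (Or.inl hxy.symm)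
    · exact Or.inr (Or.inr ⟨x, ⟨hx.ne, hxv, hyu, hyv, hH hxy⟩, hxy, hx⟩)
    · have : z = y := hS.mate_unique x z y hm.symm ⟨hm.2.2.1, hm.2.2.2.1, hyu, hyv, hH hxy⟩
      subst this
      exact Or.inr (Or.inl hz)) h ⟨hS.ne, Or.inl rfl⟩
  exact this.1 rfl

/-- Each vertex of `JoinVert` is attached and contributes its parent edge. The summand `1` is an
edge of the path from `u` to `v` that is nobody's parent edge. -/
theorem Setting.join_lower (hS : Setting G P u v N) {H : SimpleGraph ℕ}
    (hH : H ≤ G) (hP : ∀ x y, P x y → H.Reachable x y) (hfin : H.edgeSet.Finite)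
    (h : H.Reachable u v) :
    Attachable G P u v ∧ ∃ a < N, ∃ b < N, Bridge G u v a b ∧
      1 + count N (JoinVert G P u v a b) + count N (JoinPair G P u v a b) ≤ H.edgeSet.ncard := by
  classical
  refine ⟨fun x hx => ?_, ?_⟩
  · rcases (hS.loc_of_req hH hP hx).2.2 with h | h | ⟨y, hm, h, h'⟩
    · exact Or.inl (hH h)
    · exact Or.inr (Or.inl (hH h))
    · exact Or.inr (Or.inr ⟨y, hm, h'.imp (fun h => hH h) fun h => hH h⟩)
  obtain ⟨a, b, hab, h1, h2, h3⟩ := hS.exists_bridge hH h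
  have ha : a < N := by
    rcases hab.1 with h | h
    · exact h ▸ hS.u_lt
    · exact hS.adj_lt _ _ h
  refine ⟨a, ha, b, hS.adj_lt _ _ hab.2.2, hab, ?_⟩
  have honloc : ∀ x, OnBridge u a b x → Loc G u v H x := by
    rintro x ⟨hxu, hx⟩
    rcases hab.cases hS with ⟨rfl, rfl, -⟩ | ⟨k1, k2, rfl, -⟩ | ⟨hm, k1, k2⟩
    · simp at hx
      exact absurd hx hxu
    · simp only [or_self] at hx
      subst hx
      exact ⟨hxu, k2, Or.inr (Or.inl h3)⟩
    · rcases hx with rfl | rfl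
      · exact ⟨hm.1, hm.2.1, Or.inl (h2.resolve_left hm.1)⟩
      · exact ⟨hm.2.2.1, hm.2.2.2.1, Or.inr (Or.inl h3)⟩
  -- The edge is `uv`, or `av` for a common neighbour `a`, whose parent edge is `au` because
  -- `parentEdge` prefers `u`, or `ab` for two mates, each of which has an edge to `u` or `v`.
  have hX : ∃ e, e ∈ H.edgeSet ∧ (∀ x, Loc G u v H x → parentEdge G u v H x ≠ e) ∧
      ∀ x y, ¬ Loc G u v H x → Mate G u v x y → s(x, y) ≠ e := by
    rcases hab.cases hS with ⟨rfl, rfl, -⟩ | ⟨k1, k2, rfl, -⟩ | ⟨hm, k1, k2⟩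
    · refine ⟨s(b, v), h3, fun x hx he => ?_, fun x y hx hm he => ?_⟩
      · have := hS.mem_parentEdge hx
        rw [he, Sym2.mem_iff] at this
        exact this.elim hx.1 hx.2.1
      · rw [Sym2.eq_iff] at he
        rcases he with ⟨he, -⟩ | ⟨he, -⟩
        · exact hm.1 he
        · exact hm.2.1 he
    · have hau := h2.resolve_left k1
      have hl : Loc G u v H a := ⟨k1, k2, Or.inl hau⟩
      refine ⟨s(a, v), h3, fun x hx he => ?_, fun x y hx hm he => ?_⟩
      · have := hS.mem_parentEdge hx
        rw [he, Sym2.mem_iff] at this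
        rcases this with rfl | this
        · rw [parentEdge, if_pos hau, Sym2.eq_iff] at he
          rcases he with ⟨-, he⟩ | ⟨he, -⟩
          · exact hS.ne he
          · exact k2 he
        · exact hx.2.1 this
      · rw [Sym2.eq_iff] at he
        rcases he with ⟨rfl, -⟩ | ⟨he, -⟩
        · exact hx hl
        · exact hm.2.1 he
    · have hau := h2.resolve_left hm.1
      have hab' : H.Adj a b := h1.resolve_left hm.2.2.2.2.ne
      have hla : Loc G u v H a := ⟨hm.1, hm.2.1, Or.inl hau⟩
      have hlb : Loc G u v H b := ⟨hm.2.2.1, hm.2.2.2.1, Or.inr (Or.inl h3)⟩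
      refine ⟨s(a, b), hab', fun x hx he => ?_, fun x y hx hm' he => ?_⟩
      · rcases hS.parentEdge_cases hx with ⟨e, -⟩ | ⟨e, -⟩ | ⟨y, e, -, -, -, n1, n2⟩ <;>
          rw [e, Sym2.eq_iff] at he
        · rcases he with ⟨-, he⟩ | ⟨-, he⟩
          · exact hm.2.2.1 he.symm
          · exact hm.1 he.symm
        · rcases he with ⟨-, he⟩ | ⟨-, he⟩
          · exact hm.2.2.2.1 he.symm
          · exact hm.2.1 he.symm
        · rcases he with ⟨he, -⟩ | ⟨he, -⟩
          · subst he; exact n1 hau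
          · subst he; exact n2 h3
      · rw [Sym2.eq_iff] at he
        rcases he with ⟨rfl, -⟩ | ⟨rfl, -⟩
        · exact hx hla
        · exact hx hlb
  obtain ⟨e, he⟩ := hX
  have key := hS.card_add_card_pairs_le_edges hH hP hfin
    ((range N).filter (JoinVert G P u v a b)) ((range N).filter (JoinPair G P u v a b)) {e}
    -- A vertex on the path is already counted in `JoinVert`, so its pair is represented by the
    -- mate, which is not on the path.
    (fun x => if OnBridge u a b x then mate G u v x else x)
    (by
      intro x hx
      rcases (mem_filter.1 hx).2 with hx | ⟨-, y, hm, hy, n1, n2⟩ | hx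
      · exact hS.loc_of_req hH hP hx
      · rcases (hS.loc_of_req hH hP hy).2.2 with h | h | ⟨z, hz, h4, h5⟩
        · exact absurd (hH h) n1
        · exact absurd (hH h) n2
        · rw [hS.mate_unique _ _ _ hz hm.symm] at h4 h5
          exact ⟨hm.1, hm.2.1, by tauto⟩
      · exact honloc x hx)
    (by
      intro x hx
      obtain ⟨y, hxy, hm, hp, hn, hon⟩ := (mem_filter.1 hx).2
      have hny : ¬ Req G P u v y := fun hy => hn (hS.req_mate hm.symm (hS.pair_symm _ _ hp) hy)
      have hnot : ∀ z w, Mate G u v z w → ¬ Req G P u v z → ¬ Req G P u v w →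
          ¬ OnBridge u a b z → z ∉ (range N).filter (JoinVert G P u v a b) := by
        intro z w hzw hz hw hb hmem
        rcases (mem_filter.1 hmem).2 with h | ⟨-, y, hy, hry, -⟩ | h
        · exact hz h
        · exact hw (hS.mate_unique _ _ _ hy hzw ▸ hry)
        · exact hb h
      refine ⟨y, hxy, hm, hp, ?_⟩
      by_cases hb : OnBridge u a b x
      · simp only [hb, if_true, hS.mate_eq hm]
        exact ⟨Or.inr trivial, hnot y x hm.symm hny hn fun h => hon ⟨hb, h⟩⟩
      · simp only [hb, if_false]
        exact ⟨Or.inl trivial, hnot x y hm hn hny hb⟩)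
    (by
      intro e' he'
      rw [mem_singleton.1 he']
      exact he)
  rw [card_singleton] at key
  rw [count, count]
  omega

theorem Setting.join_upper (hS : Setting G P u v N) (hA : Attachable G P u v) {a b : ℕ}
    (hab : Bridge G u v a b) :
    ∃ H ≤ G, (∀ x y, P x y → H.Reachable x y) ∧ H.edgeSet.ncard ≤
      1 + count N (JoinVert G P u v a b) + count N (JoinPair G P u v a b) := by
  classical
  -- The target of a vertex. The ends `a` and `b` come first, to make the path to `u` and `v`
  -- available. The last two alternatives give a vertex without an edge to `u` or `v` the target of
  -- its mate.
  let L : ℕ → ℕ := fun z =>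
    if z = a then u else if z = b then v else if G.Adj z u then u else if G.Adj z v then v
    else if G.Adj (mate G u v z) u then u else v
  have hLT : ∀ z, L z = u ∨ L z = v := by
    intro z
    simp only [L]
    split_ifs <;> simp
  have hLadj : ∀ z, JoinVert G P u v a b z → (G.Adj z u ∨ G.Adj z v) → G.Adj z (L z) := by
    intro z hz hT
    have hzu : z ≠ u := by
      rcases hz with hz | ⟨-, y, hm, -⟩ | hz
      · exact hz.1
      · exact hm.1
      · exact hz.1
    by_cases h1 : z = a
    · simp only [L, if_pos h1]
      rcases hab.1 with h | h
      · exact absurd (h1.trans h) hzu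
      · exact h1 ▸ h
    by_cases h2 : z = b
    · simp only [L, if_neg h1, if_pos h2]
      exact h2 ▸ hab.2.2
    by_cases h3 : G.Adj z u
    · simp only [L, if_neg h1, if_neg h2, if_pos h3]
      exact h3
    · simp only [L, if_neg h1, if_neg h2, if_neg h3, if_pos (hT.resolve_left h3)]
      exact hT.resolve_left h3
  -- The edge of the path that is not supplied by the targets of `a` and `b`.
  let e : Sym2 ℕ := if a = b then s(b, v) else s(a, b)
  have he : e ∈ G.edgeSet := by
    by_cases h : a = b
    · simp only [e, if_pos h]
      exact hab.2.2
    · simp only [e, if_neg h]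
      exact (hab.2.1.resolve_left h).2.2.2.2
  obtain ⟨H, hH, hcard, hr, hd, hx⟩ := hS.exists_subgraph
    ((range N).filter (JoinVert G P u v a b)) ((range N).filter (JoinPair G P u v a b)) {e} L
    (by
      intro z hz
      have hz' := (mem_filter.1 hz).2
      by_cases hT : G.Adj z u ∨ G.Adj z v
      · exact Or.inl (hLadj z hz' hT)
      -- Helpers and vertices on the path are adjacent to `u` or `v`.
      have hreq : Req G P u v z := by
        rcases hz' with h | ⟨-, x, hm, hrx, n1, n2⟩ | ⟨hzu, h⟩
        · exact h
        · obtain ⟨y, hy, hyT⟩ := ((hA x hrx).resolve_left n1).resolve_left n2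
          rw [hS.mate_unique _ _ _ hy hm.symm] at hyT
          exact absurd hyT hT
        · exfalso
          rcases hab.cases hS with ⟨rfl, rfl, -⟩ | ⟨k1, k2, rfl, k3, -⟩ | ⟨hm, k1, k2⟩
          · simp at h
            exact hzu h
          · simp only [or_self] at h
            exact hT (Or.inl (h ▸ k3))
          · rcases h with h | h
            · exact hT (Or.inl (h ▸ k1))
            · exact hT (Or.inr (h ▸ k2))
      push Not at hT
      obtain ⟨y, hm, hyT⟩ := ((hA z hreq).resolve_left hT.1).resolve_left hT.2
      have hyJ : JoinVert G P u v a b y := by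
        by_cases h : Req G P u v y
        · exact Or.inl h
        · exact Or.inr (Or.inl ⟨h, z, hm.symm, hreq, hT⟩)
      refine Or.inr ⟨y, mem_filter.2 ⟨mem_range.2 (hS.mate_lt hm.symm), hyJ⟩, hm, ?_,
        hLadj y hyJ hyT⟩
      have hza : z ≠ a := by
        rintro rfl
        rcases hab.1 with h | h
        · exact hm.1 h
        · exact hT.1 h
      have hzb : z ≠ b := by
        rintro rfl
        exact hT.2 hab.2.2
      have hLz : L z = if G.Adj y u then u else v := by
        simp only [L, if_neg hza, if_neg hzb, if_neg hT.1, if_neg hT.2, hS.mate_eq hm]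
      rw [hLz]
      by_cases hya : y = a
      · have : G.Adj y u := by
          rcases hab.1 with h | h
          · exact absurd (hya.trans h) hm.2.2.1
          · exact hya ▸ h
        simp only [L, if_pos hya, if_pos this]
      by_cases hyb : y = b
      · rcases hab.2.1 with h | h
        · exact absurd (hyb.trans h.symm) hya
        · subst hyb
          exact absurd (hS.mate_unique _ _ _ hm.symm h.symm) hza
      simp only [L, if_neg hya, if_neg hyb]
      by_cases h1 : G.Adj y u
      · simp only [if_pos h1]
      · simp only [if_neg h1, if_pos (hyT.resolve_left h1)])
    (by
      intro x hx
      obtain ⟨y, -, hm, -⟩ := (mem_filter.1 hx).2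
      exact ⟨y, hm⟩)
    (by
      intro e' he'
      rw [mem_singleton.1 he']
      exact he)
  have hrJ : ∀ z, JoinVert G P u v a b z → H.Reachable z (L z) := by
    intro z hz
    refine hr z (mem_filter.2 ⟨mem_range.2 ?_, hz⟩)
    rcases hz with hz | ⟨-, y, hm, -⟩ | ⟨hzu, hz⟩
    · exact hS.req_lt hz
    · exact hS.mate_lt hm
    · rcases hz with rfl | rfl
      · exact hS.adj_lt _ _ (hab.1.resolve_left hzu)
      · exact hS.adj_lt _ _ hab.2.2
  have huv : H.Reachable u v := by
    have he' := hx e (mem_singleton_self _)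
    rcases hab.cases hS with ⟨rfl, rfl, -⟩ | ⟨k1, k2, rfl, k3, -⟩ | ⟨hm, k1, k2⟩
    · simp only [e, if_true] at he'
      exact SimpleGraph.Adj.reachable he'
    · simp only [e, if_true] at he'
      have := hrJ a (Or.inr (Or.inr ⟨k1, Or.inl rfl⟩))
      simp only [L, if_true] at this
      exact this.symm.trans (SimpleGraph.Adj.reachable he')
    · have hne := hm.2.2.2.2.ne
      simp only [e, if_neg hne] at he'
      have h1 := hrJ a (Or.inr (Or.inr ⟨hm.1, Or.inl rfl⟩))
      have h2 := hrJ b (Or.inr (Or.inr ⟨hm.2.2.1, Or.inr rfl⟩))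
      simp only [L, if_true] at h1
      simp only [L, if_neg hne.symm, if_true] at h2
      exact (h1.symm.trans (SimpleGraph.Adj.reachable he')).trans h2
  have hru : ∀ z, z = u ∨ z = v ∨ JoinVert G P u v a b z → H.Reachable z u := by
    rintro z (rfl | rfl | hz)
    · exact SimpleGraph.Reachable.refl _
    · exact huv.symm
    · have := hrJ z hz
      rcases hLT z with h | h
      · rwa [h] at this
      · rw [h] at this
        exact this.trans huv.symm
  refine ⟨H, hH, ?_, ?_⟩
  · have main : ∀ x y, P x y → x < y → H.Reachable x y := by
      intro x y hp hxy
      by_cases hc : Mate G u v x y ∧ ¬ Req G P u v x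
      · by_cases hon : OnBridge u a b x ∧ OnBridge u a b y
        · exact (hru x (Or.inr (Or.inr (Or.inr (Or.inr hon.1))))).trans
            (hru y (Or.inr (Or.inr (Or.inr (Or.inr hon.2))))).symm
        · exact (hd x (mem_filter.2 ⟨mem_range.2 (hS.pair_lt _ _ hp),
            y, hxy, hc.1, hp, hc.2, hon⟩) y hc.1).reachable
      · have hboth : (x = u ∨ x = v ∨ Req G P u v x) ∧ (y = u ∨ y = v ∨ Req G P u v y) := by
          by_cases hm : Mate G u v x y
          · have hrx : Req G P u v x := by tauto
            exact ⟨Or.inr (Or.inr hrx), Or.inr (Or.inr (hS.req_mate hm hp hrx))⟩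
          · exact ⟨Setting.req_of_not_mate hp hm,
              Setting.req_of_not_mate (hS.pair_symm _ _ hp) fun h => hm h.symm⟩
        have h1 := hru x (hboth.1.imp_right (Or.imp_right Or.inl))
        have h2 := hru y (hboth.2.imp_right (Or.imp_right Or.inl))
        exact h1.trans h2.symm
    intro x y hp
    rcases lt_or_gt_of_ne (hS.pair_ne _ _ hp) with h | h
    · exact main x y hp h
    · exact (main y x (hS.pair_symm _ _ hp) h).symm
  · rw [card_singleton] at hcard
    rw [count, count]
    refine hcard.trans (le_of_eq ?_)
    ring

end

/-! ### Steiner forests that separate the two vertices of the deletion set -/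

section

variable (G : SimpleGraph ℕ) (P : ℕ → ℕ → Prop) (u v : ℕ)

/-- No Steiner forest has `i` in the component of `u` and `j` in that of `v`, or contains just one
of the two. -/
def Blocked (i j : ℕ) : Prop :=
  P i j ∧ ¬ (Mate G u v i j ∧ ¬ Req G P u v i) ∨
  Mate G u v i j ∧ Req G P u v i ∧ Req G P u v j ∧ (¬ G.Adj i u ∨ ¬ G.Adj j v) ∨
  j = v ∧ Req G P u v i ∧ ¬ G.Adj i u ∧ (¬ ∃ y, Mate G u v i y ∧ G.Adj y u) ∨
  i = u ∧ Req G P u v j ∧ ¬ G.Adj j v ∧ ¬ ∃ y, Mate G u v j y ∧ G.Adj y v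

/-- To connect `x` to `w`, its mate has to be added. -/
def Extra (w x : ℕ) : Prop :=
  Req G P u v x ∧ ¬ G.Adj x w ∧ ∃ y, Mate G u v x y ∧ ¬ Req G P u v y

open Classical in
/-- The capacities of the cut problem. -/
noncomputable def capacity (N i j : ℕ) : ℕ :=
  if Blocked G P u v i j then N
  else if j = v ∧ Extra G P u v u i ∨ i = u ∧ Extra G P u v v j then 1 else 0

/-- The vertex among `u` and `v` to which `x` is to be connected. -/
def side (X : Finset ℕ) (x : ℕ) : ℕ := if x ∈ X then u else v

end

section

variable {G : SimpleGraph ℕ} {P : ℕ → ℕ → Prop} {u v N : ℕ}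

/-- Let `X` be the component of `u`. A required vertex in `X` is attached to `u`, any other to `v`,
and nothing blocked can occur. A vertex counted by `Extra` must use its mate, which is not required
and so adds its own parent edge to those of the required vertices. -/
theorem Setting.sep_lower (hS : Setting G P u v N) {H : SimpleGraph ℕ}
    (hH : H ≤ G) (hP : ∀ x y, P x y → H.Reachable x y) (hfin : H.edgeSet.Finite)
    (h : ¬ H.Reachable u v) :
    ∃ X ⊆ range N, u ∈ X ∧ v ∉ X ∧ (∀ i ∈ X, ∀ j < N, j ∉ X → ¬ Blocked G P u v i j) ∧
      count N (Req G P u v) + count N (InnerPair G P u v) +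
        count N (fun x => Extra G P u v (side u v X x) x) ≤ H.edgeSet.ncard := by
  classical
  have hlocU : ∀ x, Loc G u v H x → H.Reachable u x →
      H.Adj x u ∨ ∃ y, Mate G u v x y ∧ H.Adj x y ∧ H.Adj y u := by
    intro x hx hr
    rcases hx.2.2 with h1 | h1 | ⟨y, hm, h1, h2 | h2⟩
    · exact Or.inl h1
    · exact absurd (hr.trans h1.reachable) h
    · exact Or.inr ⟨y, hm, h1, h2⟩
    · exact absurd ((hr.trans h1.reachable).trans h2.reachable) h
  have hlocV : ∀ x, Loc G u v H x → ¬ H.Reachable u x →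
      H.Adj x v ∨ ∃ y, Mate G u v x y ∧ H.Adj x y ∧ H.Adj y v := by
    intro x hx hr
    rcases hx.2.2 with h1 | h1 | ⟨y, hm, h1, h2 | h2⟩
    · exact absurd h1.symm.reachable hr
    · exact Or.inl h1
    · exact absurd (h2.symm.reachable.trans h1.symm.reachable) hr
    · exact Or.inr ⟨y, hm, h1, h2⟩
  have hreq := fun x => hS.loc_of_req hH hP (x := x)
  set X := (range N).filter fun x => H.Reachable u x with hX
  have hmemX : ∀ x < N, (x ∈ X ↔ H.Reachable u x) := fun x hx => by
    simp [hX, hx]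
  refine ⟨X, filter_subset _ _, (hmemX u hS.u_lt).2 (SimpleGraph.Reachable.refl _),
    fun hv => h ((hmemX v hS.v_lt).1 hv), fun i hi j hjN hj => ?_, ?_⟩
  · have hi' : H.Reachable u i := (mem_filter.1 hi).2
    have hj' : ¬ H.Reachable u j := fun hr => hj ((hmemX j hjN).2 hr)
    rintro (⟨hp, -⟩ | ⟨hm, hri, hrj, hn⟩ | ⟨rfl, hr, hn, hn'⟩ | ⟨rfl, hr, hn, hn'⟩)
    · exact hj' (hi'.trans (hP _ _ hp))
    · rcases hlocU i (hreq i hri) hi' with h1 | ⟨y, hy, h1, h2⟩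
      · rcases hlocV j (hreq j hrj) hj' with h3 | ⟨y, hy, h3, h4⟩
        · exact hn.elim (fun k => k (hH h1)) fun k => k (hH h3)
        · rw [hS.mate_unique _ _ _ hy hm.symm] at h3
          exact hj' (hi'.trans h3.symm.reachable)
      · rw [hS.mate_unique _ _ _ hy hm] at h1
        exact hj' (hi'.trans h1.reachable)
    · rcases hlocU i (hreq i hr) hi' with h1 | ⟨y, hy, h1, h2⟩
      · exact hn (hH h1)
      · exact hn' ⟨y, hy, hH h2⟩
    · rcases hlocV j (hreq j hr) hj' with h1 | ⟨y, hy, h1, h2⟩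
      · exact hn (hH h1)
      · exact hn' ⟨y, hy, hH h2⟩
  · set R := (range N).filter (Req G P u v) with hR
    set E := (range N).filter (fun x => Extra G P u v (side u v X x) x) with hE
    have hEmate : ∀ x ∈ E, ∃ y, Mate G u v x y ∧ ¬ Req G P u v y ∧ Loc G u v H y := by
      intro x hx
      obtain ⟨hxN, hr, hn, y, hm, hy⟩ := mem_filter.1 hx
      refine ⟨y, hm, hy, hm.2.2.1, hm.2.2.2.1, ?_⟩
      by_cases hxX : x ∈ X
      · rw [side, if_pos hxX] at hn
        rcases hlocU x (hreq x hr) (mem_filter.1 hxX).2 with h1 | ⟨z, hz, -, h1⟩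
        · exact absurd (hH h1) hn
        · exact Or.inl (hS.mate_unique _ _ _ hz hm ▸ h1)
      · rw [side, if_neg hxX] at hn
        rcases hlocV x (hreq x hr) (fun h => hxX ((hmemX x (mem_range.1 hxN)).2 h)) with
          h1 | ⟨z, hz, -, h1⟩
        · exact absurd (hH h1) hn
        · exact Or.inr (Or.inl (hS.mate_unique _ _ _ hz hm ▸ h1))
    have hcE : (E.image (mate G u v)).card = E.card := by
      refine card_image_of_injOn fun x hx y hy hxy => ?_
      obtain ⟨x', hx', -⟩ := hEmate x hx
      obtain ⟨y', hy', -⟩ := hEmate y hy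
      rw [hS.mate_eq hx', hS.mate_eq hy'] at hxy
      subst hxy
      exact hS.mate_unique _ _ _ hx'.symm hy'.symm
    have hdis : Disjoint R (E.image (mate G u v)) := by
      rw [disjoint_left]
      intro z hz hz'
      obtain ⟨x, hx, rfl⟩ := mem_image.1 hz'
      obtain ⟨y, hm, hn, -⟩ := hEmate x hx
      rw [hS.mate_eq hm] at hz
      exact hn (mem_filter.1 hz).2
    have key := hS.card_add_card_pairs_le_edges hH hP hfin (R ∪ E.image (mate G u v))
      ((range N).filter (InnerPair G P u v)) ∅ (fun x => x)
      (by
        intro x hx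
        rcases mem_union.1 hx with hx | hx
        · exact hreq x (mem_filter.1 hx).2
        · obtain ⟨z, hz, rfl⟩ := mem_image.1 hx
          obtain ⟨y, hm, -, hl⟩ := hEmate z hz
          rw [hS.mate_eq hm]
          exact hl)
      (by
        intro x hx
        obtain ⟨y, hxy, hm, hp, hn⟩ := (mem_filter.1 hx).2
        refine ⟨y, hxy, hm, hp, Or.inl rfl, fun hmem => ?_⟩
        rcases mem_union.1 hmem with hx | hx
        · exact hn (mem_filter.1 hx).2
        · obtain ⟨z, hz, hzx⟩ := mem_image.1 hx
          obtain ⟨x', hm', -⟩ := hEmate z hz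
          rw [hS.mate_eq hm'] at hzx
          subst hzx
          have := hS.mate_unique _ _ _ hm hm'.symm
          subst this
          exact hn (hS.req_mate hm.symm (hS.pair_symm _ _ hp) (mem_filter.1 hz).2.1))
      (by simp)
    rw [card_union_of_disjoint hdis, hcE, card_empty] at key
    rw [count, count, count, ← hR, ← hE]
    omega

theorem Setting.sep_upper (hS : Setting G P u v N) {X : Finset ℕ} (hu : u ∈ X) (hv : v ∉ X)
    (hX : ∀ i ∈ X, ∀ j < N, j ∉ X → ¬ Blocked G P u v i j) :
    ∃ H ≤ G, (∀ x y, P x y → H.Reachable x y) ∧ H.edgeSet.ncard ≤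
      count N (Req G P u v) + count N (InnerPair G P u v) +
        count N (fun x => Extra G P u v (side u v X x) x) := by
  classical
  set R := (range N).filter (Req G P u v) with hR
  set E := (range N).filter (fun x => Extra G P u v (side u v X x) x) with hE
  -- A vertex that is not required is added only for the sake of its mate and takes over its target.
  let L : ℕ → ℕ := fun z =>
    if Req G P u v z then side u v X z else side u v X (mate G u v z)
  have hLreq : ∀ z, Req G P u v z → L z = side u v X z := fun z hz => if_pos hz
  -- This is where three of the four cases of `Blocked` enter: two of them provide a mate adjacent
  -- to the target of `x`, and the case of two required mates shows that a required mate is on the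
  -- same side.
  have hmate : ∀ x, Req G P u v x → ¬ G.Adj x (side u v X x) →
      ∃ y, Mate G u v x y ∧ G.Adj y (side u v X x) ∧
        (Req G P u v y → side u v X y = side u v X x) := by
    intro x hx hn
    by_cases hxX : x ∈ X
    · rw [side, if_pos hxX] at hn ⊢
      have h1 := hX x hxX v hS.v_lt hv
      have : ∃ y, Mate G u v x y ∧ G.Adj y u := by
        by_contra hne
        exact h1 (Or.inr (Or.inr (Or.inl ⟨rfl, hx, hn, hne⟩)))
      obtain ⟨y, hm, hy⟩ := this
      refine ⟨y, hm, hy, fun hr => if_pos ?_⟩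
      by_contra hyX
      exact hX x hxX y (hS.mate_lt hm.symm) hyX (Or.inr (Or.inl ⟨hm, hx, hr, Or.inl hn⟩))
    · rw [side, if_neg hxX] at hn ⊢
      have h1 := hX u hu x (hS.req_lt hx) hxX
      have : ∃ y, Mate G u v x y ∧ G.Adj y v := by
        by_contra hne
        exact h1 (Or.inr (Or.inr (Or.inr ⟨rfl, hx, hn, hne⟩)))
      obtain ⟨y, hm, hy⟩ := this
      refine ⟨y, hm, hy, fun hr => if_neg fun hyX => ?_⟩
      exact hX y hyX x (hS.req_lt hx) hxX (Or.inr (Or.inl ⟨hm.symm, hr, hx, Or.inr hn⟩))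
  obtain ⟨H, hH, hcard, hr, hd, -⟩ := hS.exists_subgraph (R ∪ E.image (mate G u v))
    ((range N).filter (InnerPair G P u v)) ∅ L
    (by
      intro z hz
      by_cases hzr : Req G P u v z
      · rw [hLreq z hzr]
        by_cases ha : G.Adj z (side u v X z)
        · exact Or.inl ha
        · obtain ⟨y, hm, hy, hs⟩ := hmate z hzr ha
          right
          by_cases hry : Req G P u v y
          · refine ⟨y, mem_union_left _ (mem_filter.2 ⟨mem_range.2 (hS.req_lt hry), hry⟩), hm, ?_⟩
            rw [hLreq y hry, hs hry]
            exact ⟨rfl, hy⟩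
          · refine ⟨y, mem_union_right _ (mem_image.2 ⟨z, mem_filter.2
              ⟨mem_range.2 (hS.req_lt hzr), hzr, ha, y, hm, hry⟩, hS.mate_eq hm⟩), hm, ?_⟩
            simp only [L, if_neg hry, hS.mate_eq hm.symm]
            exact ⟨trivial, hy⟩
      · left
        rcases mem_union.1 hz with hz | hz
        · exact absurd (mem_filter.1 hz).2 hzr
        · obtain ⟨x, hx, hxz⟩ := mem_image.1 hz
          obtain ⟨-, hrx, hn, y, hm, -⟩ := mem_filter.1 hx
          obtain ⟨y', hm', hy', -⟩ := hmate x hrx hn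
          rw [hS.mate_eq hm'] at hxz
          subst hxz
          simp only [L, if_neg hzr, hS.mate_eq hm'.symm]
          exact hy')
    (by
      intro x hx
      obtain ⟨y, -, hm, -⟩ := (mem_filter.1 hx).2
      exact ⟨y, hm⟩)
    (by simp)
  have hru : ∀ z, z = u ∨ z = v ∨ Req G P u v z → H.Reachable z (side u v X z) := by
    rintro z (rfl | rfl | hz)
    · rw [side, if_pos hu]
    · rw [side, if_neg hv]
    · have := hr z (mem_union_left _ (mem_filter.2 ⟨mem_range.2 (hS.req_lt hz), hz⟩))
      rwa [hLreq z hz] at this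
  refine ⟨H, hH, ?_, ?_⟩
  · have main : ∀ x y, P x y → x < y → H.Reachable x y := by
      intro x y hp hxy
      by_cases hc : Mate G u v x y ∧ ¬ Req G P u v x
      · exact (hd x (mem_filter.2 ⟨mem_range.2 (hS.pair_lt _ _ hp),
            y, hxy, hc.1, hp, hc.2⟩) y hc.1).reachable
      · have hboth : (x = u ∨ x = v ∨ Req G P u v x) ∧ (y = u ∨ y = v ∨ Req G P u v y) := by
          by_cases hm : Mate G u v x y
          · have hrx : Req G P u v x := by tauto
            exact ⟨Or.inr (Or.inr hrx), Or.inr (Or.inr (hS.req_mate hm hp hrx))⟩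
          · exact ⟨Setting.req_of_not_mate hp hm,
              Setting.req_of_not_mate (hS.pair_symm _ _ hp) fun h => hm h.symm⟩
        have hp' := hS.pair_symm _ _ hp
        have hc' : ¬ (Mate G u v y x ∧ ¬ Req G P u v y) := fun h =>
          hc ⟨h.1.symm, fun hx => h.2 (hS.req_mate h.1.symm hp hx)⟩
        -- A pair that is not inner is blocked in both orders, so the cut cannot separate it.
        have hside : side u v X x = side u v X y := by
          by_cases hx : x ∈ X <;> by_cases hy : y ∈ X
          · rw [side, side, if_pos hx, if_pos hy]
          · exact absurd (Or.inl ⟨hp, hc⟩) (hX x hx y (hS.pair_lt _ _ hp') hy)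
          · exact absurd (Or.inl ⟨hp', hc'⟩) (hX y hy x (hS.pair_lt _ _ hp) hx)
          · rw [side, side, if_neg hx, if_neg hy]
        have h1 := hru x hboth.1
        have h2 := hru y hboth.2
        rw [hside] at h1
        exact h1.trans h2.symm
    intro x y hp
    rcases lt_or_gt_of_ne (hS.pair_ne _ _ hp) with h | h
    · exact main x y hp h
    · exact (main y x (hS.pair_symm _ _ hp) h).symm
  · rw [card_empty] at hcard
    have h1 := card_union_le R (E.image (mate G u v))
    have h2 : (E.image (mate G u v)).card ≤ E.card := card_image_le
    rw [count, count, count, ← hR, ← hE]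
    omega

/-- A vertex `x` in `X` pays through the arc from `x` to `v`, a vertex outside of `X` through the
arc from `u` to `x`; all other arcs across the cut have capacity `0`. -/
theorem Setting.cutCap_of_not_blocked (hS : Setting G P u v N) {X : Finset ℕ}
    (hXN : X ⊆ range N) (hu : u ∈ X) (hv : v ∉ X)
    (hX : ∀ i ∈ X, ∀ j < N, j ∉ X → ¬ Blocked G P u v i j) :
    cutCap N (capacity G P u v N) X = count N (fun x => Extra G P u v (side u v X x) x) := by
  classical
  have h1 : cutCap N (capacity G P u v N) X = ∑ i ∈ X, ∑ j ∈ range N \ X,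
      ((if j = v then (if Extra G P u v u i then 1 else 0) else 0) +
        if i = u then (if Extra G P u v v j then 1 else 0) else 0) := by
    refine sum_congr rfl fun i hi => sum_congr rfl fun j hj => ?_
    rw [mem_sdiff, mem_range] at hj
    rw [capacity, if_neg (hX i hi j hj.1 hj.2)]
    -- The arc from `u` to `v` belongs to both families of arcs, but has capacity `0` because `u`
    -- and `v` are never required.
    have hnu : ¬ Extra G P u v u u := fun h => h.1.1 rfl
    by_cases hjv : j = v <;> by_cases hiu : i = u
    · have hnv : ¬ Extra G P u v v v := fun h => h.1.2.1 rfl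
      simp [hjv, hiu, hnu, hnv]
    · simp [hjv, hiu]
    · simp [hjv, hiu]
    · simp [hjv, hiu]
  have hvm : v ∈ range N \ X := mem_sdiff.2 ⟨mem_range.2 hS.v_lt, hv⟩
  rw [h1]
  simp only [sum_add_distrib, sum_ite_eq', hvm, if_true]
  rw [sum_comm (s := X)]
  simp only [sum_ite_eq', hu, if_true]
  rw [count, card_filter, ← sum_sdiff hXN, add_comm]
  congr 1
  · refine sum_congr rfl fun j hj => ?_
    rw [side, if_neg (mem_sdiff.1 hj).2]
  · refine sum_congr rfl fun j hj => ?_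
    rw [side, if_pos hj]

/-- The existence of a Steiner forest with at most `k` edges in terms of bridges and cuts. -/
theorem Setting.exists_forest_iff (hS : Setting G P u v N) (k : ℕ) :
    (∃ H ≤ G, (∀ x y, P x y → H.Reachable x y) ∧ H.edgeSet.ncard ≤ k) ↔
      (Attachable G P u v ∧ ∃ a < N, ∃ b < N, Bridge G u v a b ∧
        1 + count N (JoinVert G P u v a b) + count N (JoinPair G P u v a b) ≤ k) ∨
      ∃ X ⊆ range N, u ∈ X ∧ v ∉ X ∧ cutCap N (capacity G P u v N) X < N ∧
        count N (Req G P u v) + count N (InnerPair G P u v) +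
          cutCap N (capacity G P u v N) X ≤ k := by
  classical
  constructor
  · rintro ⟨H, hH, hP, hk⟩
    have hfin : H.edgeSet.Finite := by
      refine ((range N ×ˢ range N).image fun p => s(p.1, p.2)).finite_toSet.subset fun e he => ?_
      induction e with
      | h x y =>
        have h1 : G.Adj x y := hH he
        refine mem_coe.2 (mem_image.2 ⟨(x, y), mem_product.2 ⟨mem_range.2 (hS.adj_lt _ _ h1),
          mem_range.2 (hS.adj_lt _ _ h1.symm)⟩, rfl⟩)
    by_cases h : H.Reachable u v
    · left
      obtain ⟨hA, a, ha, b, hb, hab, hc⟩ := hS.join_lower hH hP hfin h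
      exact ⟨hA, a, ha, b, hb, hab, hc.trans hk⟩
    · right
      obtain ⟨X, hXN, hu, hv, hX, hc⟩ := hS.sep_lower hH hP hfin h
      have e := hS.cutCap_of_not_blocked hXN hu hv hX
      refine ⟨X, hXN, hu, hv, ?_, by rw [e]; exact hc.trans hk⟩
      rw [e, count]
      -- The vertex `u` is never counted by `Extra`, so an admissible cut has capacity less than
      -- `N`, whereas a single blocked arc already contributes `N`.
      have hss : (range N).filter (fun x => Extra G P u v (side u v X x) x) ⊂ range N := by
        rw [Finset.filter_ssubset]
        exact ⟨u, mem_range.2 hS.u_lt, fun h => h.1.1 rfl⟩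
      simpa using card_lt_card hss
  · rintro (⟨hA, a, -, b, -, hab, hc⟩ | ⟨X, hXN, hu, hv, hlt, hc⟩)
    · obtain ⟨H, hH, hP, hk⟩ := hS.join_upper hA hab
      exact ⟨H, hH, hP, hk.trans hc⟩
    · have hX : ∀ i ∈ X, ∀ j < N, j ∉ X → ¬ Blocked G P u v i j := by
        intro i hi j hj hjX hb
        have h1 : capacity G P u v N i j = N := if_pos hb
        have h2 : capacity G P u v N i j ≤ ∑ j ∈ range N \ X, capacity G P u v N i j :=
          single_le_sum (f := fun j => capacity G P u v N i j) (fun _ _ => Nat.zero_le _)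
            (mem_sdiff.2 ⟨mem_range.2 hj, hjX⟩)
        have h3 : ∑ j ∈ range N \ X, capacity G P u v N i j ≤
            cutCap N (capacity G P u v N) X :=
          single_le_sum (f := fun i => ∑ j ∈ range N \ X, capacity G P u v N i j)
            (fun _ _ => Nat.zero_le _) hi
        omega
      obtain ⟨H, hH, hP, hk⟩ := hS.sep_upper hu hv hX
      rw [hS.cutCap_of_not_blocked hXN hu hv hX] at hc
      exact ⟨H, hH, hP, hk.trans hc⟩

end

/-! ### Instances as graphs on the natural numbers -/

/-- The graph of an instance, with isolated vertices added. -/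
def Inst.graph (I : Inst) : SimpleGraph ℕ := I.G.map Fin.valEmbedding

/-- The symmetric relation given by the terminal pairs. -/
def Inst.pair (I : Inst) (x y : ℕ) : Prop :=
  x ≠ y ∧ ∃ (hx : x < I.n) (hy : y < I.n),
    ((⟨x, hx⟩, ⟨y, hy⟩) ∈ I.S ∨ (⟨y, hy⟩, ⟨x, hx⟩) ∈ I.S)

theorem Inst.graph_adj (I : Inst) (x y : ℕ) :
    I.graph.Adj x y ↔ ∃ (hx : x < I.n) (hy : y < I.n), I.G.Adj ⟨x, hx⟩ ⟨y, hy⟩ := by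
  rw [Inst.graph, SimpleGraph.map_adj]
  constructor
  · rintro ⟨a, b, h, rfl, rfl⟩
    exact ⟨a.2, b.2, h⟩
  · rintro ⟨hx, hy, h⟩
    exact ⟨_, _, h, rfl, rfl⟩

theorem Inst.finite_edgeSet {I : Inst} {H : SimpleGraph ℕ} (hH : H ≤ I.graph) :
    H.edgeSet.Finite := by
  refine ((range I.n ×ˢ range I.n).image fun p => s(p.1, p.2)).finite_toSet.subset fun e he => ?_
  induction e with
  | h x y =>
    obtain ⟨hx, hy, -⟩ := (I.graph_adj x y).1 (hH he)
    exact mem_coe.2 (mem_image.2 ⟨(x, y), mem_product.2 ⟨mem_range.2 hx, mem_range.2 hy⟩, rfl⟩)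

/-- Only edges are counted and vertices are free. Hence a forest may be taken to be spanning, pairs
of equal vertices may be dropped, and isolated vertices may be added. -/
theorem Inst.yes_iff (I : Inst) :
    I.Yes ↔ ∃ H ≤ I.graph, (∀ x y, I.pair x y → H.Reachable x y) ∧
      (H.edgeSet.ncard : ℤ) ≤ I.k := by
  constructor
  · rintro ⟨F, hF, hk⟩
    refine ⟨F.spanningCoe.map Fin.valEmbedding,
      SimpleGraph.map_monotone _ (SimpleGraph.Subgraph.spanningCoe_le F), ?_, ?_⟩
    · have key : ∀ a b : Fin I.n, (a, b) ∈ I.S →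
          (F.spanningCoe.map Fin.valEmbedding).Reachable (a : ℕ) (b : ℕ) := by
        intro a b hab
        obtain ⟨h1, h2, h3⟩ := hF _ hab
        let φ : F.coe →g F.spanningCoe.map Fin.valEmbedding :=
          ⟨fun x => (x.1 : ℕ), fun {x y} h => by
            rw [SimpleGraph.map_adj]
            exact ⟨x.1, y.1, h, rfl, rfl⟩⟩
        exact h3.map φ
      rintro x y ⟨-, hx, hy, h | h⟩
      · exact key _ _ h
      · exact (key _ _ h).symm
    · rw [SimpleGraph.edgeSet_map]
      refine le_trans ?_ hk
      have : F.spanningCoe.edgeSet = F.edgeSet := SimpleGraph.Subgraph.edgeSet_spanningCoe F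
      rw [this]
      exact_mod_cast Set.ncard_image_le (Set.toFinite _)
  · rintro ⟨H, hH, hP, hk⟩
    let F : I.G.Subgraph :=
      { verts := Set.univ
        Adj := fun a b => H.Adj a b
        adj_sub := fun {a b} h => by
          obtain ⟨_, _, h'⟩ := (I.graph_adj _ _).1 (hH h)
          exact h'
        edge_vert := fun _ => Set.mem_univ _
        symm := ⟨fun a b h => SimpleGraph.Adj.symm h⟩ }
    refine ⟨F, fun p hp => ⟨Set.mem_univ _, Set.mem_univ _, ?_⟩, ?_⟩
    · by_cases hne : p.1 = p.2
      · have : (⟨p.1, Set.mem_univ _⟩ : F.verts) = ⟨p.2, Set.mem_univ _⟩ := Subtype.ext hne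
        rw [this]
      · have hr := hP p.1 p.2 ⟨fun h => hne (Fin.ext h), p.1.2, p.2.2, Or.inl hp⟩
        have := mem_of_reachable (Y := {z | ∃ hz : z < I.n,
          F.coe.Reachable ⟨p.1, Set.mem_univ _⟩ ⟨⟨z, hz⟩, Set.mem_univ _⟩}) (by
          rintro x y ⟨hx, h1⟩ hxy
          obtain ⟨-, hy, -⟩ := (I.graph_adj _ _).1 (hH hxy)
          refine ⟨hy, h1.trans (SimpleGraph.Adj.reachable ?_)⟩
          exact hxy) hr ⟨p.1.2, SimpleGraph.Reachable.refl _⟩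
        exact this.2
    · refine le_trans ?_ hk
      have : F.edgeSet.ncard ≤ H.edgeSet.ncard := by
        refine Set.ncard_le_ncard_of_injOn (Sym2.map Fin.val) ?_
          ((Sym2.map.injective Fin.val_injective).injOn) (Inst.finite_edgeSet hH)
        intro e he
        induction e with
        | h x y => exact he
      exact_mod_cast this

/-! ### Positions of the data in the encoding -/

theorem Inst.length_matrixBits {n : ℕ} (r : Fin n → Fin n → Prop) :
    (matrixBits r).length = n * n := by
  simp [matrixBits]

theorem getD_flatMap {α : Type} (f : α → List Bool) (m : ℕ) (l : List α)
    (hf : ∀ a, (f a).length = m) (i j : ℕ) (hi : i < l.length) (hj : j < m) :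
    (l.flatMap f).getD (i * m + j) false = (f l[i]).getD j false := by
  induction l generalizing i with
  | nil => simp at hi
  | cons a l ih =>
    rw [List.flatMap_cons]
    cases i with
    | zero =>
      rw [List.getD_append _ _ _ _ (by rw [hf]; omega)]
      simp
    | succ i =>
      have h1 : (i + 1) * m + j = m + (i * m + j) := by ring
      rw [List.getD_append_right _ _ _ _ (by rw [hf, h1]; omega), hf, h1, Nat.add_sub_cancel_left,
        ih i (by simpa using hi)]
      rfl

theorem getD_matrixBits {n : ℕ} (r : Fin n → Fin n → Prop) {i j : ℕ} (hi : i < n) (hj : j < n) :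
    (matrixBits r).getD (i * n + j) false = true ↔ r ⟨i, hi⟩ ⟨j, hj⟩ := by
  classical
  rw [matrixBits, getD_flatMap _ n _ (by simp) i j (by simpa using hi) hj]
  simp [List.getD_eq_getElem?_getD, hj]

section

variable (I : Inst)

theorem Inst.length_encode :
    I.encode.length = I.n + 1 + I.n * I.n + I.n * I.n + 1 + I.k.natAbs.bits.length := by
  simp [Inst.encode, Inst.length_matrixBits]
  omega

theorem Inst.encode_one {i : ℕ} (hi : i < I.n) : I.encode.getD i false = true := by
  have h : I.encode = List.replicate I.n true ++ ([false] ++ matrixBits I.G.Adj ++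
      matrixBits (fun i j => (i, j) ∈ I.S) ++ [decide (I.k < 0)] ++ I.k.natAbs.bits) := by
    simp [Inst.encode]
  rw [h, List.getD_append _ _ _ _ (by simpa using hi)]
  simp [List.getD_eq_getElem?_getD, hi]

theorem Inst.encode_zero : I.encode.getD I.n false = false := by
  have h : I.encode = List.replicate I.n true ++ (false :: (matrixBits I.G.Adj ++
      matrixBits (fun i j => (i, j) ∈ I.S) ++ [decide (I.k < 0)] ++ I.k.natAbs.bits)) := by
    simp [Inst.encode]
  rw [h, List.getD_append_right _ _ _ _ (by simp)]
  simp

theorem Inst.encode_adj {i j : ℕ} (hi : i < I.n) (hj : j < I.n) :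
    I.encode.getD (I.n + 1 + i * I.n + j) false = true ↔ I.G.Adj ⟨i, hi⟩ ⟨j, hj⟩ := by
  have h : I.encode = (List.replicate I.n true ++ [false]) ++ (matrixBits I.G.Adj ++
      (matrixBits (fun i j => (i, j) ∈ I.S) ++ [decide (I.k < 0)] ++ I.k.natAbs.bits)) := by
    simp [Inst.encode]
  have h1 : i * I.n + j < I.n * I.n := by nlinarith
  rw [h, List.getD_append_right _ _ _ _ (by simp; omega), List.getD_append _ _ _ _
    (by simp [Inst.length_matrixBits]; omega), ← getD_matrixBits I.G.Adj hi hj]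
  have h2 : I.n + 1 + i * I.n + j - (List.replicate I.n true ++ [false]).length =
      i * I.n + j := by simp; omega
  rw [h2]

theorem Inst.encode_pair {i j : ℕ} (hi : i < I.n) (hj : j < I.n) :
    I.encode.getD (I.n + 1 + I.n * I.n + i * I.n + j) false = true ↔
      ((⟨i, hi⟩, ⟨j, hj⟩) : Fin I.n × Fin I.n) ∈ I.S := by
  have h : I.encode = (List.replicate I.n true ++ [false] ++ matrixBits I.G.Adj) ++
      (matrixBits (fun i j => (i, j) ∈ I.S) ++ ([decide (I.k < 0)] ++ I.k.natAbs.bits)) := by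
    simp [Inst.encode]
  have h1 : i * I.n + j < I.n * I.n := by nlinarith
  rw [h, List.getD_append_right _ _ _ _ (by simp [Inst.length_matrixBits]; omega),
    List.getD_append _ _ _ _ (by simp [Inst.length_matrixBits]; omega),
    ← getD_matrixBits (fun i j => (i, j) ∈ I.S) hi hj]
  have h2 : I.n + 1 + I.n * I.n + i * I.n + j -
      (List.replicate I.n true ++ [false] ++ matrixBits I.G.Adj).length =
      i * I.n + j := by simp [Inst.length_matrixBits]; omega
  rw [h2]

theorem Inst.encode_sign :
    I.encode.getD (I.n + 1 + I.n * I.n + I.n * I.n) false = decide (I.k < 0) := by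
  have h : I.encode = (List.replicate I.n true ++ [false] ++ matrixBits I.G.Adj ++
      matrixBits (fun i j => (i, j) ∈ I.S)) ++ (decide (I.k < 0) :: I.k.natAbs.bits) := by
    simp [Inst.encode]
  have h1 : (List.replicate I.n true ++ [false] ++ matrixBits I.G.Adj ++
      matrixBits (fun i j => (i, j) ∈ I.S)).length = I.n + 1 + I.n * I.n + I.n * I.n := by
    simp [Inst.length_matrixBits]
    omega
  rw [h, List.getD_append_right _ _ _ _ (by rw [h1]), h1, Nat.sub_self]
  rfl

theorem Inst.encode_bits (i : ℕ) :
    I.encode.getD (I.n + 1 + I.n * I.n + I.n * I.n + 1 + i) false =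
      I.k.natAbs.bits.getD i false := by
  have h : I.encode = (List.replicate I.n true ++ [false] ++ matrixBits I.G.Adj ++
      matrixBits (fun i j => (i, j) ∈ I.S) ++ [decide (I.k < 0)]) ++ I.k.natAbs.bits := by
    simp [Inst.encode]
  have h1 : (List.replicate I.n true ++ [false] ++ matrixBits I.G.Adj ++
      matrixBits (fun i j => (i, j) ∈ I.S) ++ [decide (I.k < 0)]).length =
      I.n + 1 + I.n * I.n + I.n * I.n + 1 := by
    simp [Inst.length_matrixBits]
    omega
  rw [h, List.getD_append_right _ _ _ _ (by rw [h1]; omega), h1, Nat.add_sub_cancel_left]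

end

/-- Horner's rule, starting from the most significant digit. It needs only doubling, which is an
addition. -/
theorem div_two_pow_eq (m i : ℕ) :
    m / 2 ^ i = 2 * (m / 2 ^ (i + 1)) + (m.bits.getD i false).toNat := by
  have h1 : m.bits.getD i false = m.testBit i := (Nat.testBit_eq_inth m i).symm
  have h2 : (m.testBit i).toNat = m / 2 ^ i % 2 := Nat.toNat_testBit m i
  rw [h1, h2, pow_succ, ← Nat.div_div_eq_div_mul]
  omega

theorem div_two_pow_eq_zero {m N : ℕ} (h : m.bits.length ≤ N) : m / 2 ^ N = 0 := by
  rw [Nat.size_eq_bits_len] at h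
  exact Nat.div_eq_of_lt (Nat.size_le.1 h)

/-! ### Deletion sets as pairs of natural numbers -/

/-- The pair `u`, `v` contains a deletion set. -/
def DeletionPair (G : SimpleGraph ℕ) (u v : ℕ) : Prop :=
  u ≠ v ∧ ∀ x y z, Mate G u v x y → Mate G u v x z → y = z

theorem Inst.setting {I : Inst} {u v N : ℕ} (h : DeletionPair I.graph u v) (hu : u < N)
    (hv : v < N) (hN : I.n ≤ N) : Setting I.graph I.pair u v N where
  ne := h.1
  u_lt := hu
  v_lt := hv
  adj_lt x y hxy := by
    obtain ⟨hx, -⟩ := (I.graph_adj x y).1 hxy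
    omega
  pair_symm := by
    rintro x y ⟨h1, hx, hy, h2⟩
    exact ⟨h1.symm, hy, hx, h2.symm⟩
  pair_ne x y hp := hp.1
  pair_lt := by
    rintro x y ⟨-, hx, -⟩
    omega
  mate_unique := h.2

/-- A set `T` with fewer than two elements is filled up inside `range N`; `n + 2 ≤ N` leaves room
for this even if the graph has no vertices. A vertex with two mates would lie in a component with at
least three vertices. -/
theorem Inst.exists_deletionPair {I : Inst} {N : ℕ} (hN : I.n + 2 ≤ N)
    (h : ∃ T : Finset (Fin I.n), T.card ≤ 2 ∧ IsDeletionSet I.G 2 T) :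
    ∃ u < N, ∃ v < N, DeletionPair I.graph u v := by
  obtain ⟨T, hT, hdel⟩ := h
  obtain ⟨U, hTU, hUN, hU⟩ := exists_subsuperset_card_eq (s := T.map Fin.valEmbedding)
    (t := range N) (n := 2) (by
      intro x hx
      obtain ⟨y, -, rfl⟩ := mem_map.1 hx
      have := y.2
      simp only [Fin.valEmbedding_apply, mem_range]
      omega) (by simpa using hT) (by simp; omega)
  obtain ⟨u, v, huv, rfl⟩ := card_eq_two.1 hU
  refine ⟨u, mem_range.1 (hUN (by simp)), v, mem_range.1 (hUN (by simp)), huv, ?_⟩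
  intro x y z hxy hxz
  by_contra hyz
  have hnot : ∀ (w : ℕ) (hw : w < I.n), w ≠ u → w ≠ v → (⟨w, hw⟩ : Fin I.n) ∉ T := by
    intro w hw h1 h2 h3
    have : w ∈ ({u, v} : Finset ℕ) := hTU (mem_map.2 ⟨_, h3, rfl⟩)
    simp at this
    tauto
  obtain ⟨h1, h2, h3, h4, h5⟩ := hxy
  obtain ⟨-, -, h6, h7, h8⟩ := hxz
  obtain ⟨hx, hy, hxy⟩ := (I.graph_adj _ _).1 h5
  obtain ⟨_, hz, hxz⟩ := (I.graph_adj _ _).1 h8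
  let x' : {v : Fin I.n | v ∉ T} := ⟨⟨x, hx⟩, hnot x hx h1 h2⟩
  let y' : {v : Fin I.n | v ∉ T} := ⟨⟨y, hy⟩, hnot y hy h3 h4⟩
  let z' : {v : Fin I.n | v ∉ T} := ⟨⟨z, hz⟩, hnot z hz h6 h7⟩
  have hle := hdel ((I.G.induce {v | v ∉ T}).connectedComponentMk x')
  have hsub : ({x', y', z'} : Set {v : Fin I.n | v ∉ T}) ⊆
      ((I.G.induce {v | v ∉ T}).connectedComponentMk x').supp := by
    have ay : (I.G.induce {v | v ∉ T}).Adj y' x' := hxy.symm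
    have az : (I.G.induce {v | v ∉ T}).Adj z' x' := hxz.symm
    rintro w (rfl | rfl | rfl)
    · rfl
    · exact SimpleGraph.ConnectedComponent.sound ay.reachable
    · exact SimpleGraph.ConnectedComponent.sound az.reachable
  have h9 := (Set.encard_le_encard hsub).trans hle
  have hxy' : x' ≠ y' := fun h => by
    have := congrArg (fun w => (w.1 : ℕ)) h
    exact h5.ne this
  have hxz' : x' ≠ z' := fun h => by
    have := congrArg (fun w => (w.1 : ℕ)) h
    exact h8.ne this
  have hyz' : y' ≠ z' := fun h => by
    have := congrArg (fun w => (w.1 : ℕ)) h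
    exact hyz this
  rw [Set.encard_insert_of_notMem (by simp [hxy', hxz']), Set.encard_pair hyz'] at h9
  norm_num at h9

/-! ### Derived expressions -/

namespace Exp

def notE (a : Exp) : Exp := cond a (num 0) (num 1)
def andE (a b : Exp) : Exp := cond a (cond b (num 1) (num 0)) (num 0)
def orE (a b : Exp) : Exp := cond a (num 1) (cond b (num 1) (num 0))
def impE (a b : Exp) : Exp := cond a (cond b (num 1) (num 0)) (num 1)
def leE (a b : Exp) : Exp := cond (sub a b) (num 0) (num 1)
def ltE (a b : Exp) : Exp := cond (sub b a) (num 1) (num 0)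
def eqE (a b : Exp) : Exp := andE (leE a b) (leE b a)
def neE (a b : Exp) : Exp := notE (eqE a b)
def exE (x : ℕ) (a : Exp) : Exp := cond (sum x a) (num 1) (num 0)
def allE (x : ℕ) (a : Exp) : Exp := notE (exE x (notE a))
/-- The entry `(0, 0)` of an array. -/
def cell (k : ℕ) : Exp := arr k (num 0) (num 0)
/-- An entry of the first column of an array. -/
def col (k : ℕ) (a : Exp) : Exp := arr k a (num 0)
/-- The least number with a property. -/
def leastE (x y : ℕ) (a : Exp) : Exp := sum x (allE y (impE (leE (var y) (var x)) (notE a)))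

variable {N : ℕ} {A : Arrays} {v : ℕ → ℕ}

attribute [simp] eval

@[simp] theorem eval_notE (a : Exp) : (notE a).eval N A v = tr (a.eval N A v = 0) := by
  by_cases h : a.eval N A v = 0 <;> simp [notE, eval, tr, h]

@[simp] theorem eval_andE (a b : Exp) :
    (andE a b).eval N A v = tr (¬ a.eval N A v = 0 ∧ ¬ b.eval N A v = 0) := by
  by_cases h : a.eval N A v = 0 <;> by_cases h' : b.eval N A v = 0 <;>
    simp [andE, eval, tr, h, h']

@[simp] theorem eval_orE (a b : Exp) :
    (orE a b).eval N A v = tr (¬ a.eval N A v = 0 ∨ ¬ b.eval N A v = 0) := by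
  by_cases h : a.eval N A v = 0 <;> by_cases h' : b.eval N A v = 0 <;>
    simp [orE, eval, tr, h, h']

@[simp] theorem eval_impE (a b : Exp) :
    (impE a b).eval N A v = tr (¬ a.eval N A v = 0 → ¬ b.eval N A v = 0) := by
  by_cases h : a.eval N A v = 0 <;> by_cases h' : b.eval N A v = 0 <;>
    simp [impE, eval, tr, h, h']

@[simp] theorem eval_leE (a b : Exp) : (leE a b).eval N A v = tr (a.eval N A v ≤ b.eval N A v) := by
  by_cases h : a.eval N A v ≤ b.eval N A v
  · simp [leE, eval, tr, h]
  · have : a.eval N A v - b.eval N A v ≠ 0 := by omega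
    simp [leE, eval, tr, h, this]

@[simp] theorem eval_ltE (a b : Exp) : (ltE a b).eval N A v = tr (a.eval N A v < b.eval N A v) := by
  by_cases h : a.eval N A v < b.eval N A v
  · have : b.eval N A v - a.eval N A v ≠ 0 := by omega
    simp [ltE, eval, tr, h, this]
  · have : b.eval N A v - a.eval N A v = 0 := by omega
    simp [ltE, eval, tr, h, this]

@[simp] theorem eval_eqE (a b : Exp) : (eqE a b).eval N A v = tr (a.eval N A v = b.eval N A v) := by
  simp only [eqE, eval_andE, eval_leE, tr_eq_zero, not_not]
  congr 1
  exact propext le_antisymm_iff.symm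

@[simp] theorem eval_neE (a b : Exp) : (neE a b).eval N A v = tr (a.eval N A v ≠ b.eval N A v) := by
  simp only [neE, eval_notE, eval_eqE, tr_eq_zero, ne_eq]

@[simp] theorem eval_exE (x : ℕ) (a : Exp) : (exE x a).eval N A v =
    tr (∃ i < N, ¬ a.eval N A (Function.update v x i) = 0) := by
  by_cases h : ∃ i < N, ¬ a.eval N A (Function.update v x i) = 0
  · have h' : ¬ ∑ i ∈ range N, a.eval N A (Function.update v x i) = 0 := by
      rw [sum_eq_zero_iff]
      simpa using h
    simp only [exE, eval, tr, h, ne_eq, h', not_false_eq_true, if_true]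
  · have h' : ∑ i ∈ range N, a.eval N A (Function.update v x i) = 0 := by
      rw [sum_eq_zero_iff]
      simpa using h
    simp only [exE, eval, tr, h, ne_eq, h', not_true_eq_false, if_false]

@[simp] theorem eval_allE (x : ℕ) (a : Exp) : (allE x a).eval N A v =
    tr (∀ i < N, ¬ a.eval N A (Function.update v x i) = 0) := by
  simp only [allE, eval_notE, eval_exE, tr_eq_zero, not_exists, not_and, not_not]

@[simp] theorem eval_cell (k : ℕ) : (cell k).eval N A v = A k 0 0 := rfl

@[simp] theorem eval_col (k : ℕ) (a : Exp) : (col k a).eval N A v = A k (a.eval N A v) 0 := rfl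

theorem eval_leastE {x y : ℕ} (hxy : x ≠ y) (a : Exp) : (leastE x y a).eval N A v =
    ∑ i ∈ range N, tr (∀ j < N, j ≤ i →
      a.eval N A (Function.update (Function.update v x i) y j) = 0) := by
  simp only [leastE, eval, eval_allE, eval_impE, eval_leE, eval_notE, tr_eq_zero, not_not,
    Function.update_self, Function.update_of_ne hxy]

/-- All arrays read by the expression have a number less than `k`. -/
def readsBelow (k : ℕ) : Exp → Bool
  | var _ => true
  | num _ => true
  | size => true
  | add a b => a.readsBelow k && b.readsBelow k
  | sub a b => a.readsBelow k && b.readsBelow k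
  | cond c a b => c.readsBelow k && a.readsBelow k && b.readsBelow k
  | arr l i j => decide (l < k) && i.readsBelow k && j.readsBelow k
  | sum _ e => e.readsBelow k

theorem eval_congr_readsBelow {k : ℕ} {B : Arrays} (h : ∀ l < k, A l = B l) (e : Exp)
    (he : e.readsBelow k = true) (v : ℕ → ℕ) : e.eval N A v = e.eval N B v := by
  induction e generalizing v with
  | var x => rfl
  | num c => rfl
  | size => rfl
  | add a b iha ihb =>
    simp only [readsBelow, Bool.and_eq_true] at he
    simp only [eval, iha he.1, ihb he.2]
  | sub a b iha ihb =>
    simp only [readsBelow, Bool.and_eq_true] at he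
    simp only [eval, iha he.1, ihb he.2]
  | cond c a b ihc iha ihb =>
    simp only [readsBelow, Bool.and_eq_true] at he
    simp only [eval, ihc he.1.1, iha he.1.2, ihb he.2]
  | arr l i j ihi ihj =>
    simp only [readsBelow, Bool.and_eq_true, decide_eq_true_eq] at he
    simp only [eval, ihi he.1.2, ihj he.2, h l he.1.1]
  | sum x e ih =>
    simp only [eval, ih he]

theorem avoids_of_readsBelow {k : ℕ} (e : Exp) (he : e.readsBelow k = true) : e.Avoids k := by
  induction e with
  | var x => trivial
  | num c => trivial
  | size => trivial
  | add a b iha ihb =>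
    simp only [readsBelow, Bool.and_eq_true] at he
    exact ⟨iha he.1, ihb he.2⟩
  | sub a b iha ihb =>
    simp only [readsBelow, Bool.and_eq_true] at he
    exact ⟨iha he.1, ihb he.2⟩
  | cond c a b ihc iha ihb =>
    simp only [readsBelow, Bool.and_eq_true] at he
    exact ⟨ihc he.1.1, iha he.1.2, ihb he.2⟩
  | arr l i j ihi ihj =>
    simp only [readsBelow, Bool.and_eq_true, decide_eq_true_eq] at he
    exact ⟨by omega, ihi he.1.2, ihj he.2⟩
  | sum x e ih => exact ih he

end Exp

/-! ### Blocks of definitions -/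

/-- The array with the entries given by an expression. -/
def table (N : ℕ) (A : Arrays) (e : Exp) : ℕ → ℕ → ℕ := fun i j =>
  if i < N ∧ j < N then e.eval N A (env i j) else 0

/-- Definitions of the arrays `k`, `k + 1`, … -/
def tabs : ℕ → Exp → List Exp → Stm
  | k, e, [] => .tab k e
  | k, e, e' :: l => .seq (.tab k e) (tabs (k + 1) e' l)

/-- Each array is defined in terms of arrays of smaller number. -/
def readsBelowAll : ℕ → List Exp → Bool
  | _, [] => true
  | k, e :: l => e.readsBelow k && readsBelowAll (k + 1) l

/-- The arrays `k`, `k + 1`, … satisfy their definitions. -/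
def Defines (N : ℕ) (A : Arrays) : ℕ → List Exp → Prop
  | _, [] => True
  | k, e :: l => A k = table N A e ∧ Defines N A (k + 1) l

theorem tabs_wf (k : ℕ) (e : Exp) (l : List Exp) (h : readsBelowAll k (e :: l) = true) :
    (tabs k e l).WF := by
  induction l generalizing k e with
  | nil =>
    simp only [readsBelowAll, Bool.and_true] at h
    exact e.avoids_of_readsBelow h
  | cons e' l ih =>
    rw [readsBelowAll, Bool.and_eq_true] at h
    exact ⟨e.avoids_of_readsBelow h.1, ih _ _ h.2⟩

theorem table_congr {N k : ℕ} {A B : Arrays} (h : ∀ l < k, A l = B l) {e : Exp}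
    (he : e.readsBelow k = true) : table N A e = table N B e := by
  funext i j
  rw [table, table, e.eval_congr_readsBelow h he]

/-- No array changes after it has been filled, and each definition reads only arrays of smaller
number. So all definitions hold simultaneously in the final state. -/
theorem run_tabs {N : ℕ} (k : ℕ) (e : Exp) (l : List Exp) (h : readsBelowAll k (e :: l) = true)
    (A : Arrays) :
    Defines N ((tabs k e l).run N A) k (e :: l) ∧ (∀ m < k, (tabs k e l).run N A m = A m) ∧
      ∀ m, k + l.length < m → (tabs k e l).run N A m = A m := by
  induction l generalizing k e A with
  | nil =>
    simp only [readsBelowAll, Bool.and_true] at h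
    have h1 : ∀ m, m ≠ k → (tabs k e []).run N A m = A m := fun m hm => Function.update_of_ne hm _ _
    refine ⟨⟨?_, trivial⟩, fun m hm => h1 m (by omega), fun m hm => h1 m (by simp at hm; omega)⟩
    rw [table_congr (k := k) (fun l hl => h1 l (by omega)) h]
    exact Function.update_self _ _ _
  | cons e' l ih =>
    have hh := h
    rw [readsBelowAll, Bool.and_eq_true] at hh
    obtain ⟨i1, i2, i3⟩ := ih (k + 1) e' hh.2 ((Stm.tab k e).run N A)
    have h1 : ∀ m, m ≠ k → (Stm.tab k e).run N A m = A m :=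
      fun m hm => Function.update_of_ne hm _ _
    have hrun : (tabs k e (e' :: l)).run N A =
      (tabs (k + 1) e' l).run N ((Stm.tab k e).run N A) := rfl
    rw [hrun]
    refine ⟨⟨?_, i1⟩, fun m hm => ?_, fun m hm => ?_⟩
    · rw [i2 k (by omega), table_congr (k := k) (B := A)
        (fun l hl => by rw [i2 l (by omega), h1 l (by omega)]) hh.1]
      exact Function.update_self _ _ _
    · rw [i2 m (by omega), h1 m (by omega)]
    · simp only [List.length_cons] at hm
      rw [i3 m (by omega), h1 m (by omega)]

/-- The program writes only arrays of number at least `k`. -/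
def Stm.above (k : ℕ) : Stm → Bool
  | .tab l _ => decide (k ≤ l)
  | .seq p q => p.above k && q.above k
  | .rep p => p.above k

theorem Stm.run_above {N k : ℕ} (p : Stm) (h : p.above k = true) (A : Arrays) {l : ℕ}
    (hl : l < k) : p.run N A l = A l := by
  induction p generalizing A with
  | tab m e =>
    simp only [above, decide_eq_true_eq] at h
    exact Function.update_of_ne (by omega) _ _
  | seq p q ihp ihq =>
    simp only [above, Bool.and_eq_true] at h
    rw [run, ihq h.2, ihp h.1]
  | rep p ih =>
    rw [run]
    have : ∀ m, (p.run N)^[m] A l = A l := by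
      intro m
      induction m with
      | zero => rfl
      | succ m ihm => rw [Function.iterate_succ_apply', ih h, ihm]
    exact this N

/-! ### The program -/

namespace Exp

/-- `a` and `b` are adjacent and different from `p` and `q`. -/
def mateE (p q a b : Exp) : Exp :=
  andE (neE a p) (andE (neE a q) (andE (neE b p) (andE (neE b q) (arr 3 a b))))

/-- The number of vertices. -/
def sizeDef : Exp := leastE 2 3 (notE (arr 0 (num 0) (var 3)))

/-- The multiples of the number of vertices. -/
def rowDef : Exp := sum 2 (cond (ltE (var 2) (cell 1)) (var 0) (num 0))

def adjDef : Exp :=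
  andE (ltE (var 0) (cell 1)) (andE (ltE (var 1) (cell 1))
    (arr 0 (num 0) (add (add (add (cell 1) (num 1)) (col 2 (var 0))) (var 1))))

def pairDef : Exp :=
  andE (neE (var 0) (var 1)) (andE (ltE (var 0) (cell 1)) (andE (ltE (var 1) (cell 1))
    (orE
      (arr 0 (num 0) (add (add (add (add (cell 1) (num 1)) (col 2 (cell 1))) (col 2 (var 0)))
        (var 1)))
      (arr 0 (num 0) (add (add (add (add (cell 1) (num 1)) (col 2 (cell 1))) (col 2 (var 1)))
        (var 0))))))

def deletionPairDef : Exp :=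
  andE (neE (var 0) (var 1)) (allE 2 (allE 3 (allE 4 (impE (mateE (var 0) (var 1) (var 2) (var 3))
    (impE (mateE (var 0) (var 1) (var 2) (var 4)) (eqE (var 3) (var 4)))))))

def firstDef : Exp := leastE 2 3 (exE 4 (arr 5 (var 3) (var 4)))

def secondDef : Exp := leastE 2 3 (arr 5 (cell 6) (var 3))

def mateDef : Exp := mateE (cell 6) (cell 7) (var 0) (var 1)

def outerDef : Exp := exE 2 (andE (arr 4 (var 0) (var 2)) (notE (arr 8 (var 0) (var 2))))

def reqDef : Exp :=
  andE (neE (var 0) (cell 6)) (andE (neE (var 0) (cell 7)) (orE (col 9 (var 0))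
    (exE 2 (andE (arr 8 (var 0) (var 2)) (andE (arr 4 (var 0) (var 2)) (col 9 (var 2)))))))

def blockedDef : Exp :=
  orE (andE (arr 4 (var 0) (var 1)) (notE (andE (arr 8 (var 0) (var 1)) (notE (col 10 (var 0))))))
  (orE (andE (arr 8 (var 0) (var 1)) (andE (col 10 (var 0)) (andE (col 10 (var 1))
    (orE (notE (arr 3 (var 0) (cell 6))) (notE (arr 3 (var 1) (cell 7)))))))
  (orE (andE (eqE (var 1) (cell 7)) (andE (col 10 (var 0)) (andE (notE (arr 3 (var 0) (cell 6)))
    (notE (exE 2 (andE (arr 8 (var 0) (var 2)) (arr 3 (var 2) (cell 6))))))))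
  (andE (eqE (var 0) (cell 6)) (andE (col 10 (var 1)) (andE (notE (arr 3 (var 1) (cell 7)))
    (notE (exE 2 (andE (arr 8 (var 1) (var 2)) (arr 3 (var 2) (cell 7))))))))))

def extraDef : Exp :=
  andE (col 10 (var 0)) (andE (notE (arr 3 (var 0) (var 1)))
    (exE 2 (andE (arr 8 (var 0) (var 2)) (notE (col 10 (var 2))))))

def capacityDef : Exp :=
  cond (arr 11 (var 0) (var 1)) size
    (orE (andE (eqE (var 1) (cell 7)) (arr 12 (var 0) (cell 6)))
      (andE (eqE (var 0) (cell 6)) (arr 12 (var 1) (cell 7))))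

/-- The definitions of the arrays from `1` on. -/
def graphDefs : List Exp :=
  [sizeDef, rowDef, adjDef, pairDef, deletionPairDef, firstDef, secondDef, mateDef, outerDef,
    reqDef, blockedDef, extraDef, capacityDef]

end Exp

open Exp

/-- The `j`-th bit of the encoding is set. -/
def Inst.Bit (I : Inst) (j : ℕ) : Prop := I.encode.getD j false = true

/-- What the arrays of number less than `14` hold, in terms of the instance. -/
structure GraphRep (I : Inst) (N u v : ℕ) (A : Arrays) : Prop where
  bit : ∀ j, A 0 0 j = tr (I.Bit j)
  size : A 1 0 0 = I.n
  row : A 2 I.n 0 = I.n * I.n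
  adj : ∀ i j, A 3 i j = tr (I.graph.Adj i j)
  pair : ∀ i j, A 4 i j = tr (I.pair i j)
  first : A 6 0 0 = u
  second : A 7 0 0 = v
  mate : ∀ i j, A 8 i j = tr (Mate I.graph u v i j)
  req : ∀ i, A 10 i 0 = tr (Req I.graph I.pair u v i)
  capacity : ∀ i < N, ∀ j < N, A 13 i j = capacity I.graph I.pair u v N i j
  setting : Setting I.graph I.pair u v N

/-- The quantifiers of the program range over numbers less than `N` only. This loses nothing,
because all edges and pairs lie below `n`. -/
theorem graphRep_of_defines {I : Inst} {N : ℕ} {A : Arrays} (hN : N = I.encode.length)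
    (hI : ∃ T : Finset (Fin I.n), T.card ≤ 2 ∧ IsDeletionSet I.G 2 T)
    (h0 : A 0 = inputArrays I.encode 0) (hA : Defines N A 1 graphDefs) :
    ∃ u v, GraphRep I N u v A := by
  obtain ⟨h1, h2, h3, h4, h5, h6, h7, h8, h9, h10, h11, h12, h13, -⟩ := hA
  simp only [Nat.reduceAdd] at h2 h3 h4 h5 h6 h7 h8 h9 h10 h11 h12 h13
  have hlen := I.length_encode
  have hnN : I.n + 2 ≤ N := by omega
  have hN0 : 0 < N := by omega
  have bit : ∀ j, A 0 0 j = tr (I.Bit j) := by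
    intro j
    rw [h0]
    simp only [inputArrays, and_self, if_true, Inst.Bit]
    cases I.encode.getD j false <;> simp [tr]
  have size : A 1 0 0 = I.n := by
    rw [h1, table, if_pos ⟨hN0, hN0⟩, sizeDef, eval_leastE (by decide)]
    -- The input begins with `n` ones and a zero, so `n` is the position of the first zero.
    rw [← leastBelow_eq (N := N) (m := I.n) (Q := fun j => ¬ I.Bit j)
      (by omega) (by simp only [Inst.Bit, I.encode_zero]; decide)
      (fun y hy h => h (I.encode_one hy))]
    simp [leastBelow, bit]
  have row : ∀ i < N, A 2 i 0 = i * I.n := by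
    intro i hi
    rw [h2, table, if_pos ⟨hi, hN0⟩]
    simp only [rowDef, eval, eval_ltE, eval_cell, size, ne_eq, tr_eq_zero, not_not,
      Function.update_self]
    rw [← sum_filter]
    have : (range N).filter (fun x => x < I.n) = range I.n := by
      ext x
      simp only [mem_filter, mem_range]
      omega
    rw [this]
    simp [env, mul_comm]
  have adj : ∀ i j, A 3 i j = tr (I.graph.Adj i j) := by
    intro i j
    rw [h3, table]
    split_ifs with h
    · simp only [adjDef, eval_andE, eval_ltE, eval_cell, eval_col, size, eval, tr_eq_zero, not_not,
        env, bit]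
      simp [row i h.1]
      congr 1
      refine propext ⟨fun ⟨hi, hj, hb⟩ => ?_, fun ha => ?_⟩
      · exact (I.graph_adj i j).2 ⟨hi, hj, (I.encode_adj hi hj).1 hb⟩
      · obtain ⟨hi, hj, ha⟩ := (I.graph_adj i j).1 ha
        exact ⟨hi, hj, (I.encode_adj hi hj).2 ha⟩
    · refine (tr_of_false fun ha => ?_).symm
      obtain ⟨hi, hj, ha⟩ := (I.graph_adj i j).1 ha
      omega
  have pair : ∀ i j, A 4 i j = tr (I.pair i j) := by
    intro i j
    rw [h4, table]
    split_ifs with h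
    · simp [pairDef, size, env, bit, row i h.1, row j h.2, row I.n (by omega)]
      congr 1
      refine propext ⟨fun ⟨hne, hi, hj, hb⟩ => ⟨hne, hi, hj, ?_⟩, fun ⟨hne, hi, hj, hb⟩ =>
        ⟨hne, hi, hj, ?_⟩⟩
      · exact (or_iff_not_imp_left.2 hb).imp (I.encode_pair hi hj).1 (I.encode_pair hj hi).1
      · exact or_iff_not_imp_left.1 (hb.imp (I.encode_pair hi hj).2 (I.encode_pair hj hi).2)
    · refine (tr_of_false ?_).symm
      rintro ⟨-, hi, hj, -⟩
      omega
  have hadj : ∀ i j, I.graph.Adj i j → i < N := by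
    intro i j h
    obtain ⟨hi, -⟩ := (I.graph_adj i j).1 h
    omega
  have del : ∀ i < N, ∀ j < N, A 5 i j = tr (DeletionPair I.graph i j) := by
    intro i hi j hj
    rw [h5, table, if_pos ⟨hi, hj⟩]
    simp [deletionPairDef, mateE, env, adj]
    congr 1
    refine propext ⟨fun ⟨hne, hb⟩ => ⟨hne, fun x y z hxy hxz => ?_⟩, fun ⟨hne, hb⟩ =>
      ⟨hne, fun x hx y hy z hz => ?_⟩⟩
    · have k1 := hxy
      have k2 := hxz
      simp only [Mate, ne_eq] at k1 k2
      exact hb x (hadj _ _ k1.2.2.2.2) y (hadj _ _ k1.2.2.2.2.symm) z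
        (hadj _ _ k2.2.2.2.2.symm) k1.1 k1.2.1 k1.2.2.1 k1.2.2.2.1 k1.2.2.2.2 k1.1 k1.2.1
        k2.2.2.1 k2.2.2.2.1 k2.2.2.2.2
    · intro a1 a2 a3 a4 a5 a6 a7 a8 a9 a10
      exact hb x y z ⟨a1, a2, a3, a4, a5⟩ ⟨a6, a7, a8, a9, a10⟩
  -- The given deletion set only guarantees that the search succeeds. The program uses the
  -- lexicographically first pair, which may be a different one.
  obtain ⟨u₀, hu₀, v₀, hv₀, huv₀⟩ := Inst.exists_deletionPair hnN hI
  obtain ⟨u, hu⟩ : ∃ u, leastBelow N (fun a => ∃ b < N, DeletionPair I.graph a b) = u := ⟨_, rfl⟩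
  have hus := leastBelow_spec (N := N) (Q := fun a => ∃ b < N, DeletionPair I.graph a b)
    ⟨u₀, hu₀, v₀, hv₀, huv₀⟩
  rw [hu] at hus
  obtain ⟨v, hv⟩ : ∃ v, leastBelow N (fun b => DeletionPair I.graph u b) = v := ⟨_, rfl⟩
  have hvs := leastBelow_spec (N := N) (Q := fun b => DeletionPair I.graph u b) hus.2
  rw [hv] at hvs
  have first : A 6 0 0 = u := by
    rw [h6, table, if_pos ⟨hN0, hN0⟩, firstDef, eval_leastE (by decide), ← hu, leastBelow]
    refine sum_congr rfl fun i _ => congrArg tr (propext ?_)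
    refine forall_congr' fun j => forall_congr' fun hj => forall_congr' fun _ => ?_
    simp only [eval_exE, eval, tr_eq_zero]
    refine not_congr (exists_congr fun b => and_congr_right fun hb => ?_)
    simp [del j hj b hb]
  have second : A 7 0 0 = v := by
    rw [h7, table, if_pos ⟨hN0, hN0⟩, secondDef, eval_leastE (by decide), ← hv, leastBelow]
    refine sum_congr rfl fun i _ => congrArg tr (propext ?_)
    refine forall_congr' fun j => forall_congr' fun hj => forall_congr' fun _ => ?_
    simp [first, del u hus.1 j hj]
  have hS : Setting I.graph I.pair u v N := Inst.setting hvs.2 hus.1 hvs.1 (by omega)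
  have mate : ∀ i j, A 8 i j = tr (Mate I.graph u v i j) := by
    intro i j
    rw [h8, table]
    split_ifs with h
    · simp [mateDef, mateE, env, adj, first, second, Mate]
    · refine (tr_of_false fun hm => h ⟨hS.mate_lt hm, hS.mate_lt hm.symm⟩).symm
  have outer : ∀ i, A 9 i 0 = tr (Outer I.graph I.pair u v i) := by
    intro i
    rw [h9, table]
    split_ifs with h
    · simp [outerDef, env, mate, pair]
      congr 1
      refine propext ⟨fun ⟨y, _, hy⟩ => ⟨y, hy⟩, fun ⟨y, hy⟩ =>
        ⟨y, hS.pair_lt _ _ (hS.pair_symm _ _ hy.1), hy⟩⟩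
    · exact (tr_of_false fun ⟨y, hy, _⟩ => h ⟨hS.pair_lt _ _ hy, hN0⟩).symm
  have req : ∀ i, A 10 i 0 = tr (Req I.graph I.pair u v i) := by
    intro i
    rw [h10, table]
    split_ifs with h
    · simp [reqDef, env, mate, pair, outer, first, second]
      congr 1
      rw [← or_iff_not_imp_left]
      refine propext (and_congr_right fun _ => and_congr_right fun _ => or_congr_right ?_)
      exact ⟨fun ⟨y, _, hy⟩ => ⟨y, hy⟩, fun ⟨y, hy⟩ => ⟨y, hS.mate_lt hy.1.symm, hy⟩⟩
    · exact (tr_of_false fun hr => h ⟨hS.req_lt hr, hN0⟩).symm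
  have hex : ∀ i w, (∃ y < N, Mate I.graph u v i y ∧ I.graph.Adj y w) ↔
      ∃ y, Mate I.graph u v i y ∧ I.graph.Adj y w := fun i w =>
    ⟨fun ⟨y, _, hy⟩ => ⟨y, hy⟩, fun ⟨y, hy⟩ => ⟨y, hS.mate_lt hy.1.symm, hy⟩⟩
  have blocked : ∀ i < N, ∀ j < N, A 11 i j = tr (Blocked I.graph I.pair u v i j) := by
    intro i hi j hj
    rw [h11, table, if_pos ⟨hi, hj⟩]
    simp only [blockedDef, eval_orE, eval_andE, eval_notE, eval_eqE, eval_exE, eval_cell, eval_col,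
      eval, tr_eq_zero, not_not]
    simp only [env, mate, pair, req, adj, first, second, tr_eq_zero, not_not, ne_eq,
      Function.update_self, OfNat.zero_ne_ofNat, OfNat.one_ne_ofNat,
      not_false_eq_true, Function.update_of_ne, zero_ne_one, hex]
    rfl
  have extra : ∀ i < N, ∀ j < N, A 12 i j = tr (Extra I.graph I.pair u v j i) := by
    intro i hi j hj
    rw [h12, table, if_pos ⟨hi, hj⟩]
    simp [extraDef, env, mate, req, adj]
    congr 1
    refine propext (and_congr_right fun _ => and_congr_right fun _ => ?_)
    exact ⟨fun ⟨y, _, hy⟩ => ⟨y, hy⟩, fun ⟨y, hy⟩ => ⟨y, hS.mate_lt hy.1.symm, hy⟩⟩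
  refine ⟨u, v, bit, size, row _ (by omega), adj, pair, first, second, mate, req, ?_, hS⟩
  intro i hi j hj
  rw [h13, table, if_pos ⟨hi, hj⟩]
  have hb : A 11 (env i j 0) (env i j 1) = _ := blocked i hi j hj
  simp only [capacityDef, eval, eval_orE, eval_andE, eval_eqE, eval_cell, first, second]
  by_cases h : Blocked I.graph I.pair u v i j
  · rw [capacity, if_pos h, if_pos (by rw [hb, tr_of_true h]; exact one_ne_zero)]
  · rw [capacity, if_neg h, if_neg (by rw [hb, tr_of_false h]; simp)]
    simp only [env, Function.update_self, ne_eq, zero_ne_one, not_false_eq_true,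
      Function.update_of_ne, extra i hi u hus.1, extra j hj v hvs.1, tr_eq_zero, not_not]
    rw [tr]
    congr

/-! ### The computation of the minimum cut -/

namespace Exp

def predDef : Exp :=
  leastE 2 3 (andE (arr 20 (var 3) (cell 22)) (ltE (col 21 (var 3)) (col 21 (cell 22))))

def residualDef : Exp :=
  cond (eqE (cell 22) (cell 6)) (arr 20 (var 0) (var 1))
    (cond (ltE (cell 24) size)
      (sub (add (arr 20 (var 0) (var 1))
          (andE (eqE (var 0) (cell 22)) (eqE (var 1) (cell 24))))
        (andE (eqE (var 0) (cell 24)) (eqE (var 1) (cell 22))))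
      (arr 20 (var 0) (var 1)))

def labelDef : Exp :=
  cond (eqE (cell 22) (cell 6)) (col 21 (var 0))
    (cond (ltE (cell 24) size) (col 21 (var 0))
      (cond (ltE (col 21 (cell 22)) size) (add (col 21 (var 0)) (eqE (var 0) (cell 22)))
        (col 21 (var 0))))

def tokenDef : Exp :=
  cond (eqE (cell 22) (cell 6)) (cell 7) (cond (ltE (cell 24) size) (cell 24) (cell 22))

def counterDef : Exp :=
  cond (eqE (cell 22) (cell 6)) (add (cell 23) (num 1)) (cell 23)

end Exp

/-- The new state of the augmenting path algorithm, in separate arrays. -/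
def flowCompute : Stm := tabs 24 predDef [residualDef, labelDef, tokenDef, counterDef]

/-- The new state replaces the old one. -/
def flowCopy : Stm :=
  .seq (.tab 20 (arr 25 (var 0) (var 1))) (.seq (.tab 21 (arr 26 (var 0) (var 1)))
    (.seq (.tab 22 (cell 27)) (.tab 23 (cell 28))))

/-- One step of the augmenting path algorithm. -/
def flowStep : Stm := .seq flowCompute flowCopy

/-- The state of the algorithm that is held by the arrays. -/
def flowOf (A : Arrays) : Flow := ⟨A 20, fun x => A 21 x 0, A 22 0 0, A 23 0 0⟩

/-- The new state is computed in the arrays `24` to `28` before the old one in `20` to `23` is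
overwritten. The condition `hz` is needed because `Flow.step` acts on functions on all of `ℕ`, while
tables are cut off at `N`. -/
theorem flowOf_run_flowStep {N u v : ℕ} {A : Arrays} (hN : 0 < N)
    (hz : ∀ i j, ¬ (i < N ∧ j < N) → A 20 i j = 0 ∧ A 21 i j = 0)
    (hu : A 6 0 0 = u) (hv : A 7 0 0 = v) (hcur : A 22 0 0 < N) :
    flowOf (flowStep.run N A) = (flowOf A).step N u v ∧
      ∀ i j, ¬ (i < N ∧ j < N) → flowStep.run N A 20 i j = 0 ∧ flowStep.run N A 21 i j = 0 := by
  obtain ⟨⟨h24, h25, h26, h27, h28, -⟩, hlow, -⟩ :=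
    run_tabs (N := N) 24 predDef [residualDef, labelDef, tokenDef, counterDef] rfl A
  change flowOf (flowCopy.run N (flowCompute.run N A)) = _ ∧
    ∀ i j, _ → flowCopy.run N (flowCompute.run N A) 20 i j = 0 ∧
      flowCopy.run N (flowCompute.run N A) 21 i j = 0
  simp only [Nat.reduceAdd] at h25 h26 h27 h28
  rw [← flowCompute] at h24 h25 h26 h27 h28 hlow
  set B := flowCompute.run N A with hB
  have b6 : B 6 = A 6 := hlow 6 (by omega)
  have b7 : B 7 = A 7 := hlow 7 (by omega)
  have b20 : B 20 = A 20 := hlow 20 (by omega)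
  have b21 : B 21 = A 21 := hlow 21 (by omega)
  have b22 : B 22 = A 22 := hlow 22 (by omega)
  have b23 : B 23 = A 23 := hlow 23 (by omega)
  have c20 : flowCopy.run N B 20 = B 25 := by
    funext i j
    simp only [flowCopy, Stm.run]
    rw [Function.update_of_ne (by decide), Function.update_of_ne (by decide),
      Function.update_of_ne (by decide), Function.update_self]
    split_ifs with h
    · rfl
    · rw [h25, table, if_neg h]
  have c21 : flowCopy.run N B 21 = B 26 := by
    funext i j
    simp only [flowCopy, Stm.run]
    rw [Function.update_of_ne (by decide), Function.update_of_ne (by decide),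
      Function.update_self]
    split_ifs with h
    · rfl
    · rw [h26, table, if_neg h]
  have c22 : flowCopy.run N B 22 0 0 = B 27 0 0 := by
    simp only [flowCopy, Stm.run]
    rw [Function.update_of_ne (by decide), Function.update_self, if_pos ⟨hN, hN⟩]
    rfl
  have c23 : flowCopy.run N B 23 0 0 = B 28 0 0 := by
    simp only [flowCopy, Stm.run]
    rw [Function.update_self, if_pos ⟨hN, hN⟩]
    rfl
  have hpred : B 24 0 0 = (flowOf A).pred N := by
    rw [h24, table, if_pos ⟨hN, hN⟩, predDef, eval_leastE (by decide), Flow.pred, leastBelow]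
    refine sum_congr rfl fun i _ => congrArg tr (propext ?_)
    refine forall_congr' fun j => forall_congr' fun hj => forall_congr' fun _ => ?_
    simp [b20, b21, b22, flowOf]
  have d25 : ∀ i j, B 25 i j = if i < N ∧ j < N then residualDef.eval N B (env i j) else 0 :=
    fun i j => by rw [h25, table]
  have d26 : ∀ i, B 26 i 0 = if i < N then labelDef.eval N B (env i 0) else 0 :=
    fun i => by rw [h26, table]; simp [hN]
  have d27 : B 27 0 0 = tokenDef.eval N B (env 0 0) := by rw [h27, table]; simp [hN]
  have d28 : B 28 0 0 = counterDef.eval N B (env 0 0) := by rw [h28, table]; simp [hN]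
  refine ⟨?_, fun i j h => ⟨by rw [c20, h25, table, if_neg h], by rw [c21, h26, table, if_neg h]⟩⟩
  have hz20 : ∀ i j, ¬ (i < N ∧ j < N) → A 20 i j = 0 := fun i j h => (hz i j h).1
  have hz21 : ∀ i, ¬ i < N → A 21 i 0 = 0 := fun i h => (hz i 0 (by tauto)).2
  have hflow : flowOf (flowCopy.run N B) = ⟨B 25, fun x => B 26 x 0, B 27 0 0, B 28 0 0⟩ := by
    rw [flowOf, c20, c21, c22, c23]
  rw [hflow, Flow.step]
  have e25 : B 25 = fun i j => if i < N ∧ j < N then residualDef.eval N B (env i j) else 0 := by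
    funext i j; exact d25 i j
  have e26 : (fun x => B 26 x 0) =
      fun i => if i < N then labelDef.eval N B (env i 0) else 0 := by
    funext i; exact d26 i
  rw [e25, e26, d27, d28]
  have fcur : (flowOf A).cur = A 22 0 0 := rfl
  have flab : ∀ x, (flowOf A).lab x = A 21 x 0 := fun _ => rfl
  have fc : (flowOf A).c = A 20 := rfl
  have fcnt : (flowOf A).cnt = A 23 0 0 := rfl
  by_cases h1 : A 22 0 0 = u
  · rw [if_pos (show (flowOf A).cur = u from h1)]
    ext1
    · funext i j
      simp [residualDef, b22, b6, hu, h1, b20, env, fc]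
      exact fun h => (hz20 i j (by omega)).symm
    · funext i
      simp [labelDef, b22, b6, hu, h1, b21, env, flab]
      exact fun h => (hz21 i (by omega)).symm
    · simp [tokenDef, b22, b6, hu, h1, b7, hv]
    · simp [counterDef, b22, b6, hu, h1, b23, fcnt]
  rw [if_neg (show ¬ (flowOf A).cur = u from h1)]
  by_cases h2 : (flowOf A).pred N < N
  · rw [if_pos h2]
    ext1
    · funext i j
      have hval : residualDef.eval N B (env i j) = A 20 i j +
          (if i = A 22 0 0 ∧ j = (flowOf A).pred N then 1 else 0) -
          (if i = (flowOf A).pred N ∧ j = A 22 0 0 then 1 else 0) := by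
        simp [residualDef, b22, b6, hu, hpred, h1, h2, b20, env, tr_eq_ite]
      simp only [hval, fc, fcur]
      split_ifs with hij k1 k2 k3 k4 <;> first | rfl | (rw [hz20 i j hij]) | omega
    · funext i
      simp [labelDef, b22, b6, hu, h1, b21, env, flab, hpred, h2]
      exact fun h => (hz21 i (by omega)).symm
    · simp [tokenDef, b22, b6, hu, h1, h2, hpred]
    · simp [counterDef, b22, b6, hu, h1, b23, fcnt]
  rw [if_neg h2]
  have hres : (fun i j => if i < N ∧ j < N then residualDef.eval N B (env i j) else 0) =
      (flowOf A).c := by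
    funext i j
    simp [residualDef, b22, b6, hu, hpred, h1, h2, b20, env, fc]
    exact fun h => (hz20 i j (by omega)).symm
  have htok : tokenDef.eval N B (env 0 0) = (flowOf A).cur := by
    simp [tokenDef, b22, b6, hu, h1, h2, hpred, fcur]
  have hcnt : counterDef.eval N B (env 0 0) = (flowOf A).cnt := by
    simp [counterDef, b22, b6, hu, h1, b23, fcnt]
  rw [hres, htok, hcnt]
  by_cases h3 : A 21 (A 22 0 0) 0 < N
  · rw [if_pos (show (flowOf A).lab (flowOf A).cur < N from h3)]
    ext1
    · rfl
    · funext i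
      have hval : labelDef.eval N B (env i 0) = A 21 i 0 + if i = A 22 0 0 then 1 else 0 := by
        simp [labelDef, b22, b6, hu, h1, b21, env, hpred, h2, h3, tr_eq_ite]
      simp only [hval, flab, fcur]
      split_ifs with hi k1 k2 <;> first | rfl | (rw [hz21 i hi]) | omega
    · rfl
    · rfl
  · rw [if_neg (show ¬ (flowOf A).lab (flowOf A).cur < N from h3)]
    ext1
    · rfl
    · funext i
      simp [labelDef, b22, b6, hu, h1, b21, env, flab, hpred, h2, h3]
      exact fun h => (hz21 i (by omega)).symm
    · rfl
    · rfl

/-- The augmenting path algorithm. -/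
def flowLoop : Stm := .rep (.rep (.rep (.rep (.rep flowStep))))

theorem run_flowLoop (N : ℕ) (A : Arrays) :
    flowLoop.run N A = (flowStep.run N)^[N ^ 5] A := by
  simp only [flowLoop, Stm.run]
  have h : ∀ (f : Arrays → Arrays) (a b : ℕ), (f^[a])^[b] = f^[a * b] := fun f a b =>
    (Function.iterate_mul f a b).symm
  change (((((flowStep.run N)^[N])^[N])^[N])^[N])^[N] A = _
  rw [h, h, h, h, show N * (N * (N * (N * N))) = N ^ 5 by ring]

theorem flowOf_iterate {N u v : ℕ} {c₀ : ℕ → ℕ → ℕ} {A : Arrays} (hvN : v < N)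
    (huv : u ≠ v) (hz : ∀ i j, ¬ (i < N ∧ j < N) → A 20 i j = 0 ∧ A 21 i j = 0)
    (hu : A 6 0 0 = u) (hv : A 7 0 0 = v) (hinv : (flowOf A).Inv N u v c₀) (m : ℕ) :
    flowOf ((flowStep.run N)^[m] A) = (Flow.step N u v)^[m] (flowOf A) ∧
      ((flowOf ((flowStep.run N)^[m] A)).Inv N u v c₀ ∧
      (∀ i j, ¬ (i < N ∧ j < N) → (flowStep.run N)^[m] A 20 i j = 0 ∧
        (flowStep.run N)^[m] A 21 i j = 0)) ∧
      ∀ l < 20, (flowStep.run N)^[m] A l = A l := by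
  induction m with
  | zero => exact ⟨rfl, ⟨hinv, hz⟩, fun _ _ => rfl⟩
  | succ m ih =>
    obtain ⟨h1, ⟨h2, h3⟩, h4⟩ := ih
    rw [Function.iterate_succ_apply', Function.iterate_succ_apply']
    obtain ⟨k1, k2⟩ := flowOf_run_flowStep (by omega) h3
      (by rw [h4 6 (by omega), hu]) (by rw [h4 7 (by omega), hv]) h2.cur_lt
    refine ⟨by rw [k1, h1], ⟨?_, k2⟩, fun l hl => ?_⟩
    · rw [k1]
      exact (Flow.step_spec hvN huv h2).1
    · rw [flowStep.run_above (k := 20) rfl _ hl, h4 l hl]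

theorem GraphRep.congr {I : Inst} {N u v : ℕ} {A B : Arrays} (h : GraphRep I N u v A)
    (hAB : ∀ l < 14, B l = A l) : GraphRep I N u v B where
  bit := by rw [hAB 0 (by omega)]; exact h.bit
  size := by rw [hAB 1 (by omega)]; exact h.size
  row := by rw [hAB 2 (by omega)]; exact h.row
  adj := by rw [hAB 3 (by omega)]; exact h.adj
  pair := by rw [hAB 4 (by omega)]; exact h.pair
  first := by rw [hAB 6 (by omega)]; exact h.first
  second := by rw [hAB 7 (by omega)]; exact h.second
  mate := by rw [hAB 8 (by omega)]; exact h.mate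
  req := by rw [hAB 10 (by omega)]; exact h.req
  capacity := by rw [hAB 13 (by omega)]; exact h.capacity
  setting := h.setting

/-- The computation of the minimum cut. -/
def flowProg : Stm :=
  .seq (tabs 20 (arr 13 (var 0) (var 1)) [num 0, cell 7, num 0]) flowLoop

theorem cutCap_congr {N : ℕ} {c d : ℕ → ℕ → ℕ} (h : ∀ i < N, ∀ j < N, c i j = d i j)
    {X : Finset ℕ} (hX : X ⊆ range N) : cutCap N c X = cutCap N d X :=
  sum_congr rfl fun i hi => sum_congr rfl fun j hj =>
    h i (mem_range.1 (hX hi)) j (mem_range.1 (mem_sdiff.1 hj).1)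

theorem run_flowProg {I : Inst} {N u v : ℕ} {A : Arrays} (h : GraphRep I N u v A) :
    (∀ X ⊆ range N, u ∈ X → v ∉ X →
      flowProg.run N A 23 0 0 ≤ cutCap N (capacity I.graph I.pair u v N) X) ∧
    ∃ X ⊆ range N, u ∈ X ∧ v ∉ X ∧
      cutCap N (capacity I.graph I.pair u v N) X = flowProg.run N A 23 0 0 := by
  have hS := h.setting
  have hN : 0 < N := by have := hS.u_lt; omega
  obtain ⟨⟨h20, h21, h22, h23, -⟩, hlow, -⟩ :=
    run_tabs (N := N) 20 (arr 13 (var 0) (var 1)) [num 0, cell 7, num 0] rfl A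
  simp only [Nat.reduceAdd] at h21 h22 h23
  change (∀ X ⊆ range N, _ → _ → flowLoop.run N ((tabs 20 (arr 13 (var 0) (var 1))
    [num 0, cell 7, num 0]).run N A) 23 0 0 ≤ _) ∧ ∃ X ⊆ range N, _ ∧ _ ∧ _ =
    flowLoop.run N ((tabs 20 (arr 13 (var 0) (var 1)) [num 0, cell 7, num 0]).run N A) 23 0 0
  set B := (tabs 20 (arr 13 (var 0) (var 1)) [num 0, cell 7, num 0]).run N A
  have hB : GraphRep I N u v B := h.congr fun l hl => hlow l (by omega)
  have c20 : ∀ i < N, ∀ j < N, B 20 i j = capacity I.graph I.pair u v N i j := by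
    intro i hi j hj
    rw [h20, table, if_pos ⟨hi, hj⟩]
    exact hB.capacity i hi j hj
  have hflow : flowOf B = Flow.init v (B 20) := by
    ext1
    · rfl
    · funext x
      change B 21 x 0 = 0
      rw [h21, table]
      simp
    · change B 22 0 0 = v
      rw [h22, table, if_pos ⟨hN, hN⟩]
      exact hB.second
    · change B 23 0 0 = 0
      rw [h23, table]
      simp
  have hz : ∀ i j, ¬ (i < N ∧ j < N) → B 20 i j = 0 ∧ B 21 i j = 0 := fun i j hij =>
    ⟨by rw [h20, table, if_neg hij], by rw [h21, table, if_neg hij]⟩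
  have hle : ∀ i < N, ∀ j < N, B 20 i j ≤ N := by
    intro i hi j hj
    rw [c20 i hi j hj, capacity]
    split_ifs <;> omega
  have key := (flowOf_iterate hS.v_lt hS.ne hz hB.first hB.second
    (c₀ := B 20) (by rw [hflow]; exact Flow.init_inv hS.v_lt) (N ^ 5)).1
  have hcnt : flowLoop.run N B 23 0 0 =
      ((Flow.step N u v)^[N ^ 5] (Flow.init v (B 20))).cnt := by
    rw [run_flowLoop, ← hflow, ← key]
    rfl
  rw [hcnt]
  obtain ⟨r1, X, r2, r3, r4, r5⟩ := Flow.run_spec hS.u_lt hS.v_lt hS.ne hle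
  refine ⟨fun X hX hu hv => ?_, X, r2, r3, r4, ?_⟩
  · rw [← cutCap_congr c20 hX]
    exact r1 X hX hu hv
  · rw [← cutCap_congr c20 r2]
    exact r5

/-! ### The bound of the instance -/

namespace Exp

/-- The position of the sign in the input. -/
def signPos : Exp := add (add (add (cell 1) (num 1)) (col 2 (cell 1))) (col 2 (cell 1))

def boundDef : Exp :=
  add (add (cell 30) (cell 30))
    (arr 0 (num 0) (add (add signPos (num 1)) (sub (sub size (num 1)) (cell 31))))

end Exp

/-- The next digit of the bound is read. -/
def boundStep : Stm :=
  .seq (.tab 32 boundDef) (.seq (.tab 33 (add (cell 31) (num 1)))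
    (.seq (.tab 30 (cell 32)) (.tab 31 (cell 33))))

/-- The bound is read. -/
def boundProg : Stm := .seq (tabs 30 (num 0) [num 0]) (.rep boundStep)

theorem run_boundStep {I : Inst} {N u v : ℕ} {A : Arrays} (h : GraphRep I N u v A) :
    boundStep.run N A 30 0 0 = 2 * A 30 0 0 +
        (I.k.natAbs.bits.getD (N - 1 - A 31 0 0) false).toNat ∧
      boundStep.run N A 31 0 0 = A 31 0 0 + 1 := by
  have hN : 0 < N := by have := h.setting.u_lt; omega
  have hval : boundDef.eval N A (env 0 0) = 2 * A 30 0 0 +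
        (I.k.natAbs.bits.getD (N - 1 - A 31 0 0) false).toNat := by
    have hb : ∀ b : Bool, tr (b = true) = b.toNat := by
      intro b
      cases b <;> simp [tr]
    -- The position may lie beyond the end of the input. There both the array and the list of digits
    -- have the default value zero.
    rw [← I.encode_bits, ← hb]
    change _ = _ + tr (I.Bit _)
    rw [← h.bit]
    simp only [boundDef, signPos, eval, eval_cell, eval_col, h.size, h.row]
    ring
  constructor
  · simp [boundStep, Stm.run, hN, hval]
  · simp [boundStep, Stm.run, hN]

/-- After `m` rounds the cell holds the number with its last `N - m` digits removed. Initially this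
is `0`, since there are at most `N` digits. -/
theorem run_boundProg {I : Inst} {N u v : ℕ} {A : Arrays} (h : GraphRep I N u v A)
    (hlen : I.k.natAbs.bits.length ≤ N) : boundProg.run N A 30 0 0 = I.k.natAbs := by
  obtain ⟨⟨h30, h31, -⟩, hlow, -⟩ := run_tabs (N := N) 30 (num 0) [num 0] rfl A
  change (boundStep.run N)^[N] ((tabs 30 (num 0) [num 0]).run N A) 30 0 0 = _
  simp only [Nat.reduceAdd] at h31
  set B := (tabs 30 (num 0) [num 0]).run N A
  have hB : GraphRep I N u v B := h.congr fun l hl => hlow l (by omega)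
  have key : ∀ m ≤ N, (boundStep.run N)^[m] B 30 0 0 = I.k.natAbs / 2 ^ (N - m) ∧
      (boundStep.run N)^[m] B 31 0 0 = m ∧ ∀ l < 14, (boundStep.run N)^[m] B l = B l := by
    intro m
    induction m with
    | zero =>
      intro _
      refine ⟨?_, ?_, fun _ _ => rfl⟩
      · rw [Nat.sub_zero, div_two_pow_eq_zero hlen, Function.iterate_zero_apply, h30, table]
        simp
      · rw [Function.iterate_zero_apply, h31, table]
        simp
    | succ m ih =>
      intro hm
      obtain ⟨i1, i2, i3⟩ := ih (by omega)
      obtain ⟨j1, j2⟩ := run_boundStep (hB.congr i3)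
      rw [Function.iterate_succ_apply']
      refine ⟨?_, ?_, fun l hl => ?_⟩
      · rw [j1, i1, i2, div_two_pow_eq I.k.natAbs (N - (m + 1))]
        have e1 : N - (m + 1) + 1 = N - m := by omega
        have e2 : N - 1 - m = N - (m + 1) := by omega
        rw [e1, e2]
      · rw [j2, i2]
      · rw [boundStep.run_above (k := 14) rfl _ hl, i3 l hl]
  have := (key N le_rfl).1
  simpa using this

/-! ### The answer -/

namespace Exp

def attachableDef : Exp :=
  allE 2 (impE (col 10 (var 2)) (orE (arr 3 (var 2) (cell 6)) (orE (arr 3 (var 2) (cell 7))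
    (exE 3 (andE (arr 8 (var 2) (var 3))
      (orE (arr 3 (var 3) (cell 6)) (arr 3 (var 3) (cell 7))))))))

def helperDef : Exp :=
  andE (notE (col 10 (var 0))) (exE 2 (andE (arr 8 (var 0) (var 2)) (andE (col 10 (var 2))
    (andE (notE (arr 3 (var 2) (cell 6))) (notE (arr 3 (var 2) (cell 7)))))))

def bridgeDef : Exp :=
  andE (orE (eqE (var 0) (cell 6)) (arr 3 (var 0) (cell 6)))
    (andE (orE (eqE (var 0) (var 1)) (arr 8 (var 0) (var 1))) (arr 3 (var 1) (cell 7)))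

def onBridgeE (z : Exp) : Exp :=
  andE (neE z (cell 6)) (orE (eqE z (var 0)) (eqE z (var 1)))

def joinVertDef : Exp :=
  sum 2 (orE (col 10 (var 2)) (orE (col 41 (var 2)) (onBridgeE (var 2))))

def joinPairDef : Exp :=
  sum 2 (exE 3 (andE (ltE (var 2) (var 3)) (andE (arr 8 (var 2) (var 3))
    (andE (arr 4 (var 2) (var 3)) (andE (notE (col 10 (var 2)))
      (notE (andE (onBridgeE (var 2)) (onBridgeE (var 3)))))))))

def innerPairDef : Exp :=
  sum 2 (exE 3 (andE (ltE (var 2) (var 3)) (andE (arr 8 (var 2) (var 3))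
    (andE (arr 4 (var 2) (var 3)) (notE (col 10 (var 2)))))))

def reqCountDef : Exp := sum 2 (col 10 (var 2))

def answerDef : Exp :=
  andE (notE (arr 0 (num 0) signPos))
    (orE
      (andE (cell 40) (exE 2 (exE 3 (andE (arr 42 (var 2) (var 3))
        (leE (add (add (num 1) (arr 43 (var 2) (var 3))) (arr 44 (var 2) (var 3))) (cell 30))))))
      (andE (ltE (cell 23) size) (leE (add (add (cell 46) (cell 45)) (cell 23)) (cell 30))))

end Exp

/-- The definitions of the arrays from `40` on. -/
def answerProg : Stm :=
  tabs 40 attachableDef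
    [helperDef, bridgeDef, joinVertDef, joinPairDef, innerPairDef, reqCountDef, answerDef]

theorem run_answerProg {I : Inst} {N u v : ℕ} {A : Arrays} (h : GraphRep I N u v A)
    (hK : A 30 0 0 = I.k.natAbs)
    (hcut : (∀ X ⊆ range N, u ∈ X → v ∉ X →
        A 23 0 0 ≤ cutCap N (capacity I.graph I.pair u v N) X) ∧
      ∃ X ⊆ range N, u ∈ X ∧ v ∉ X ∧
        cutCap N (capacity I.graph I.pair u v N) X = A 23 0 0) :
    answerProg.run N A 47 0 0 = tr I.Yes := by
  have hS := h.setting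
  have hN : 0 < N := by have := hS.u_lt; omega
  obtain ⟨⟨h40, h41, h42, h43, h44, h45, h46, h47, -⟩, hlow, -⟩ :=
    run_tabs (N := N) 40 attachableDef
      [helperDef, bridgeDef, joinVertDef, joinPairDef, innerPairDef, reqCountDef, answerDef] rfl A
  simp only [Nat.reduceAdd] at h41 h42 h43 h44 h45 h46 h47
  rw [← answerProg] at h40 h41 h42 h43 h44 h45 h46 h47 hlow
  have hB : GraphRep I N u v (answerProg.run N A) := h.congr fun l hl => hlow l (by omega)
  rw [← hlow 30 (by omega)] at hK
  rw [← hlow 23 (by omega)] at hcut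
  set B := answerProg.run N A
  have adj := hB.adj
  have pair := hB.pair
  have mate := hB.mate
  have req := hB.req
  have first := hB.first
  have second := hB.second
  have hm : ∀ {x y}, Mate I.graph u v x y → y < N := fun h => hS.mate_lt h.symm
  have attach : B 40 0 0 = tr (Attachable I.graph I.pair u v) := by
    rw [h40, table, if_pos ⟨hN, hN⟩]
    simp [attachableDef, adj, mate, req, first, second]
    congr 1
    refine propext ⟨fun hA x hx => ?_, fun hA x _ hx h1 h2 => ?_⟩
    · have := hA x (hS.req_lt hx) hx
      by_cases h1 : I.graph.Adj x u
      · exact Or.inl h1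
      by_cases h2 : I.graph.Adj x v
      · exact Or.inr (Or.inl h2)
      obtain ⟨y, -, hy, hy'⟩ := this h1 h2
      exact Or.inr (Or.inr ⟨y, hy, or_iff_not_imp_left.2 hy'⟩)
    · obtain ⟨y, hy, hy'⟩ := ((hA x hx).resolve_left h1).resolve_left h2
      exact ⟨y, hm hy, hy, or_iff_not_imp_left.1 hy'⟩
  have helper : ∀ x, B 41 x 0 = tr (Helper I.graph I.pair u v x) := by
    intro x
    rw [h41, table]
    split_ifs with hx
    · simp [helperDef, adj, mate, req, first, second, env]
      congr 1
      refine propext (and_congr_right fun _ => ?_)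
      exact ⟨fun ⟨y, _, hy⟩ => ⟨y, hy⟩, fun ⟨y, hy⟩ => ⟨y, hm hy.1, hy⟩⟩
    · exact (tr_of_false fun ⟨_, y, hy, _⟩ => hx ⟨hS.mate_lt hy, hN⟩).symm
  have bridge : ∀ a < N, ∀ b < N, B 42 a b = tr (Bridge I.graph u v a b) := by
    intro a ha b hb
    rw [h42, table, if_pos ⟨ha, hb⟩]
    simp [bridgeDef, adj, mate, first, second, env, Bridge, or_iff_not_imp_left]
  have hon : ∀ (w : Exp) (z : ℕ → ℕ), (onBridgeE w).eval N B z =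
      tr (w.eval N B z ≠ u ∧ (w.eval N B z = z 0 ∨ w.eval N B z = z 1)) := by
    intro w z
    simp only [onBridgeE, eval_andE, eval_neE, eval_orE, eval_eqE, eval_cell, first, eval,
      tr_eq_zero, not_not]
  have joinVert : ∀ a < N, ∀ b < N, B 43 a b = count N (JoinVert I.graph I.pair u v a b) := by
    intro a ha b hb
    rw [h43, table, if_pos ⟨ha, hb⟩, ← sum_tr, joinVertDef, eval]
    refine sum_congr rfl fun x _ => ?_
    simp only [eval_orE, eval_col, eval, hon, req, helper, env, Function.update_self, ne_eq,
      OfNat.zero_ne_ofNat, OfNat.one_ne_ofNat, not_false_eq_true, Function.update_of_ne,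
      zero_ne_one, tr_eq_zero, not_not]
    rfl
  have joinPair : ∀ a < N, ∀ b < N, B 44 a b = count N (JoinPair I.graph I.pair u v a b) := by
    intro a ha b hb
    rw [h44, table, if_pos ⟨ha, hb⟩, ← sum_tr, joinPairDef, eval]
    refine sum_congr rfl fun x _ => ?_
    simp only [eval_exE, eval_andE, eval_notE, eval_ltE, eval_col, eval, hon, req, mate, pair, env,
      Function.update_self, ne_eq, OfNat.zero_ne_ofNat, OfNat.one_ne_ofNat,
      Nat.reduceEqDiff, not_false_eq_true, Function.update_of_ne, zero_ne_one, tr_eq_zero, not_not]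
    refine congrArg tr (propext ⟨fun ⟨y, _, hy⟩ => ⟨y, hy⟩, fun ⟨y, hy⟩ => ⟨y, hm hy.2.1, hy⟩⟩)
  have inner : B 45 0 0 = count N (InnerPair I.graph I.pair u v) := by
    rw [h45, table, if_pos ⟨hN, hN⟩, ← sum_tr, innerPairDef, eval]
    refine sum_congr rfl fun x _ => ?_
    simp only [eval_exE, eval_andE, eval_notE, eval_ltE, eval_col, eval, req, mate, pair,
      Function.update_self, ne_eq, Nat.reduceEqDiff, not_false_eq_true, Function.update_of_ne,
      tr_eq_zero, not_not]
    refine congrArg tr (propext ⟨fun ⟨y, _, hy⟩ => ⟨y, hy⟩, fun ⟨y, hy⟩ => ⟨y, hm hy.2.1, hy⟩⟩)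
  have reqCount : B 46 0 0 = count N (Req I.graph I.pair u v) := by
    rw [h46, table, if_pos ⟨hN, hN⟩, ← sum_tr]
    simp [reqCountDef, req]
  have sign : B 0 0 (I.n + 1 + I.n * I.n + I.n * I.n) = tr (I.k < 0) := by
    rw [hB.bit, Inst.Bit, I.encode_sign, decide_eq_true_eq]
  -- Both inequalities are upper bounds on the capacity of the cut, so it suffices to test the
  -- minimum.
  have hsep : (∃ X ⊆ range N, u ∈ X ∧ v ∉ X ∧ cutCap N (capacity I.graph I.pair u v N) X < N ∧
        count N (Req I.graph I.pair u v) + count N (InnerPair I.graph I.pair u v) +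
          cutCap N (capacity I.graph I.pair u v N) X ≤ I.k.natAbs) ↔
      B 23 0 0 < N ∧ count N (Req I.graph I.pair u v) + count N (InnerPair I.graph I.pair u v) +
        B 23 0 0 ≤ I.k.natAbs := by
    constructor
    · rintro ⟨X, hX, huX, hvX, h1, h2⟩
      have := hcut.1 X hX huX hvX
      omega
    · rintro ⟨h1, h2⟩
      obtain ⟨X, hX, huX, hvX, he⟩ := hcut.2
      exact ⟨X, hX, huX, hvX, by omega, by omega⟩
  -- A negative bound is rejected by its sign bit; otherwise `k` equals its absolute value.
  have hyes : I.Yes ↔ ¬ I.k < 0 ∧ ∃ H ≤ I.graph, (∀ x y, I.pair x y → H.Reachable x y) ∧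
      H.edgeSet.ncard ≤ I.k.natAbs := by
    rw [I.yes_iff]
    constructor
    · rintro ⟨H, h1, h2, h3⟩
      exact ⟨by omega, H, h1, h2, by omega⟩
    · rintro ⟨h0, H, h1, h2, h3⟩
      exact ⟨H, h1, h2, by omega⟩
  rw [hyes, hS.exists_forest_iff, hsep, h47, table, if_pos ⟨hN, hN⟩]
  simp only [answerDef, signPos, eval_andE, eval_orE, eval_notE, eval_exE, eval_ltE, eval_leE,
    eval_cell, eval_col, eval, hB.size, hB.row, sign, attach, inner, reqCount, hK, tr_eq_zero,
    not_not, Function.update_self, ne_eq, Nat.reduceEqDiff, not_false_eq_true,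
    Function.update_of_ne]
  refine congrArg tr (propext (and_congr_right fun _ => or_congr_left (and_congr_right fun _ => ?_)))
  refine exists_congr fun a => and_congr_right fun ha => exists_congr fun b =>
    and_congr_right fun hb => ?_
  rw [bridge a ha b hb, joinVert a ha b hb, joinPair a ha b hb, tr_eq_zero, not_not]

/-! ### The whole program -/

/-- The arrays that describe the graph, the minimum cut, the bound, and the answer. -/
def steinerProg : Stm :=
  .seq (tabs 1 sizeDef [rowDef, adjDef, pairDef, deletionPairDef, firstDef, secondDef, mateDef,
      outerDef, reqDef, blockedDef, extraDef, capacityDef])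
    (.seq flowProg (.seq boundProg answerProg))

theorem steinerProg_wf : steinerProg.WF := by
  refine ⟨tabs_wf _ _ _ rfl, ⟨tabs_wf _ _ _ rfl, tabs_wf _ _ _ rfl, ?_⟩, ⟨tabs_wf _ _ _ rfl, ?_⟩,
    tabs_wf _ _ _ rfl⟩
  · simp [flowCopy, Stm.WF, Exp.Avoids, cell]
  · simp [boundStep, boundDef, signPos, Stm.WF, Exp.Avoids, cell, col]

theorem run_steinerProg (I : Inst)
    (hI : ∃ T : Finset (Fin I.n), T.card ≤ 2 ∧ IsDeletionSet I.G 2 T) :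
    steinerProg.run I.encode.length (inputArrays I.encode) 47 0 0 = tr I.Yes := by
  obtain ⟨hdef, hlow, -⟩ := run_tabs (N := I.encode.length) 1 sizeDef
    [rowDef, adjDef, pairDef, deletionPairDef, firstDef, secondDef, mateDef, outerDef, reqDef,
      blockedDef, extraDef, capacityDef] rfl (inputArrays I.encode)
  obtain ⟨u, v, hA⟩ := graphRep_of_defines rfl hI (hlow 0 one_pos) hdef
  have hF := hA.congr fun l hl =>
    flowProg.run_above (N := I.encode.length) (k := 14) rfl _ hl
  have hlen := I.length_encode
  refine run_answerProg (hF.congr fun l hl => boundProg.run_above (k := 14) rfl _ hl)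
    (run_boundProg hF (by omega)) ?_
  rw [boundProg.run_above (k := 24) rfl _ (by omega : 23 < 24)]
  exact run_flowProg hA

end SteinerForest

theorem lemma10 :
    SteinerForest.PolyTimeSolvableOn SteinerForest.Inst.encode
      (fun I => ∃ T : Finset (Fin I.n), T.card ≤ 2 ∧ SteinerForest.IsDeletionSet I.G 2 T)
      SteinerForest.Inst.Yes := by
  refine SteinerForest.PolyTimeSolvableOn.of_stm SteinerForest.steinerProg
    SteinerForest.steinerProg_wf 47 fun I hI => ?_
  rw [SteinerForest.run_steinerProg I hI]
  exact ⟨SteinerForest.tr_of_true, SteinerForest.tr_of_false⟩
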